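/- **Setting.** Let $\mathbf{k}$ be a field, $H$ a Hopf $\mathbf k$-algebra with coproduct $f\mapsto f_{(1)}\otimes f_{(2)}$, counit $\epsilon$ and antipode $S$ (not assumed bijective). A *left-right Yetter-Drinfeld module algebra* $(L,\blacktriangleright,\rho)$ over $H$ is a $\mathbf k$-algebra $L$ with a left $H$-module structure $\blacktriangleright$ and a right $H$-comodule structure $\rho(a)=a_{[0]}\otimes a_{[1]}$ such that $h\blacktriangleright(ab)=(h_{(1)}\blacktriangleright a)(h_{(2)}\blacktriangleright b)$, $h\blacktriangleright 1=\epsilon(h)1$, $\rho(ab)=a_{[0]}b_{[0]}\otimes b_{[1]}a_{[1]}$, $\rho(1)=1\otimes 1$ and $(h_{(1)}\blacktriangleright a_{[0]})\otimes h_{(2)}a_{[1]}=(h_{(2)}\blacktriangleright a)_{[0]}\otimes(h_{(2)}\blacktriangleright a)_{[1]}h_{(1)}$. It is *braided commutative* if $x_{[0]}(x_{[1]}\blacktriangleright a)=ax$ for all $a,x\in L$. Its smash product $L\sharp H$ is $L\otimes H$ with product $(a\sharp h)(a'\sharp h')=a(h_{(1)}\blacktriangleright a')\sharp h_{(2)}h'$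 and unit $1\sharp 1$. A *right-left Yetter-Drinfeld module algebra* $(R,\blacktriangleleft,\lambda)$ is a $\mathbf k$-algebra $R$ with a right $H$-module structure $\blacktriangleleft$ and a left $H$-comodule structure $\lambda(a)=a_{[-1]}\otimes a_{[0]}$ such that $(ab)\blacktriangleleft h=(a\blacktriangleleft h_{(1)})(b\blacktriangleleft h_{(2)})$, $1\blacktriangleleft h=\epsilon(h)1$, $\lambda(ab)=b_{[-1]}a_{[-1]}\otimes a_{[0]}b_{[0]}$, $\lambda(1)=1\otimes1$ and $a_{[-1]}h_{(1)}\otimes(a_{[0]}\blacktriangleleft h_{(2)})=h_{(2)}(a\blacktriangleleft h_{(1)})_{[-1]}\otimes(a\blacktriangleleft h_{(1)})_{[0]}$. It is *braided commutative* if $(a\blacktriangleleft y_{[-1]})y_{[0]}=ya$ for all $a,y\in R$. Its smash product $H\sharp R$ is $H\otimes R$ with product $(h\sharp a)(h'\sharp a')=hh'_{(1)}\sharp(a\blacktriangleleft h'_{(2)})a'$ and unit $1\sharp1$. In smash products, elements of $H$, $L$, $R$ stand for $1\sharp f$, $x\sharp1$ (in $L\sharp H$) and $f\sharp1$, $1\sharp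 y$ (in $H\sharp R$), and $\cdot$ is the product. A *left bialgebroid* over a $\mathbf k$-algebra $A$ with total algebra $\mathcal K$ consists of an algebra homomorphism $\alpha:A\to\mathcal K$ and an antihomomorphism $\beta:A\to\mathcal K$ with commuting images, and a comonoid $(\mathcal K,\Delta:\mathcal K\to\mathcal K\otimes_A\mathcal K,\epsilon:\mathcal K\to A)$ in the category of $A$-bimodules, where $a.k.b=\alpha(a)\beta(b)k$, such that $k\otimes(g\otimes h)\mapsto\Delta(k)(g\otimes h)$ factors through a unital left action $\mathcal K\otimes(\mathcal K\otimes_A\mathcal K)\to\mathcal K\otimes_A\mathcal K$, and $k\otimes a\mapsto\epsilon(k\alpha(a))$ is a unital left action of $\mathcal K$ on $A$. A *right bialgebroid* over $A$ is defined in the same way with $b.k.a=k\alpha(a)\beta(b)$, with $(g\otimes h)\otimes k\mapsto(g\otimes h)\Delta(k)$ factoring through a unital right action on $\mathcal K\otimes_A\mathcal K$, and with $a\otimes k\mapsto\epsilon(\alpha(a)k)$ a unital right action on $A$. Let $L$ and $R$ be antiisomorphic algebras (so that $R$ plays the role of $A^{\mathrm{op}}$ for $A=L$). A *symmetric Hopf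 algebroid* over $L$ consists of a left $L$-bialgebroid $(\mathcal K,\alpha_L,\beta_L,\Delta_L,\epsilon_L)$ and a right $R$-bialgebroid $(\mathcal K,\alpha_R,\beta_R,\Delta_R,\epsilon_R)$ with the same total algebra $\mathcal K$, and an antihomomorphism of algebras $\tau:\mathcal K\to\mathcal K$ such that $$\alpha_L\epsilon_L\beta_R=\beta_R,\quad \beta_L\epsilon_L\alpha_R=\alpha_R,\quad \alpha_R\epsilon_R\beta_L=\beta_L,\quad \beta_R\epsilon_R\alpha_L=\alpha_L,$$ $$(\Delta_R\otimes_L\mathrm{id})\Delta_L=(\mathrm{id}\otimes_R\Delta_L)\Delta_R,\quad (\Delta_L\otimes_R\mathrm{id})\Delta_R=(\mathrm{id}\otimes_L\Delta_R)\Delta_L,\quad \tau\beta_L=\alpha_L,\quad \tau\beta_R=\alpha_R,$$ $$\mu(\tau\otimes\mathrm{id})\Delta_L=\alpha_R\epsilon_R,\qquad \mu(\mathrm{id}\otimes\tau)\Delta_R=\alpha_L\epsilon_L,$$ where the last two left hand sides are induced by $k\otimes k'\mapsto\tau(k)k'$ and $k\otimes k'\mapsto k\,\tau(k')$. **Theorem.**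 Let $(L,\blacktriangleright,\rho)$ and $(R,\blacktriangleleft,\lambda)$ be braided commutative left-right and right-left Yetter-Drinfeld module algebras over $H$, compatible via an antiisomorphism of algebras $\phi:L\to R$, that is, $$\phi(f\blacktriangleright x)=\phi(x)\blacktriangleleft S f,\qquad \phi(x)_{[-1]}\otimes\phi(x)_{[0]}=S(x_{[1]})\otimes\phi(x_{[0]})\qquad(f\in H,\ x\in L).$$ 1. $L\sharp H$ is a symmetric Hopf algebroid with structure maps $\alpha_L(x)=x\sharp1$, $\beta_L(x)=x_{[0]}\sharp x_{[1]}$, $\Delta_L(x\sharp f)=(x\sharp f_{(1)})\otimes_L(1\sharp f_{(2)})$, $\epsilon_L(x\sharp f)=\epsilon(f)x$, $\alpha_R(y)=S(y_{[-1]})\cdot\phi^{-1}(y_{[0]})$, $\beta_R(y)=\phi^{-1}(y)\sharp1$, $\Delta_R(x\sharp f)=(x\sharp f_{(1)})\otimes_R(1\sharp f_{(2)})$, $\epsilon_R(x\sharp f)=\phi(x)\blacktriangleleft f$, $\tau(x\sharp f)=Sf\,S^2(x_{[1]})\cdot x_{[0]}$. 2. $H\sharp R$ is a symmetric Hopf algebroid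 with structure maps $\alpha_L'(x)=\lambda(\phi(x))$, $\beta_L'(x)=1\sharp(\phi(x_{[0]})\blacktriangleleft x_{[1]})$, $\Delta_L'(f\sharp y)=(f_{(1)}\sharp1)\otimes_L(f_{(2)}\sharp y)$, $\epsilon_L'(f\sharp y)=f S(y_{[-1]})\blacktriangleright\phi^{-1}(y_{[0]})$, $\alpha_R'(y)=1\sharp y$, $\beta_R'(y)=y_{[-1]}\sharp y_{[0]}$, $\Delta_R'(f\sharp y)=(f_{(1)}\sharp1)\otimes_R(f_{(2)}\sharp y)$, $\epsilon_R'(f\sharp y)=\epsilon(f)y$, $\tau'(f\sharp y)=y_{[0]}\cdot S^2(y_{[-1]})Sf$. 3. The map $\Psi:L\sharp H\to H\sharp R$, $\Psi(x\sharp f)=\lambda(\phi(x))\cdot f$, is an isomorphism of algebras with inverse $\Psi^{-1}(f\sharp y)=fS(y_{[-1]})\cdot\phi^{-1}(y_{[0]})$, and it identifies the two symmetric Hopf algebroids, i.e. it commutes with all sources, targets, coproducts, counits and antipodes. 4. The algebras $L$ and $R$ are embedded in $L\sharp H\cong H\sharp R$ by the injective homomorphisms $\alpha_L$ and $\alpha_R$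 (respectively $\alpha_L'$ and $\alpha_R'$). The canonical homomorphisms $H\to L\sharp H$, $f\mapsto 1\sharp f$, and $H\to H\sharp R$, $f\mapsto f\sharp1$, correspond under $\Psi$, and they are injective if $L\neq0$. Moreover $\operatorname{Im}\alpha_L=\operatorname{Im}\beta_R$ and $\operatorname{Im}\alpha_R=\operatorname{Im}\beta_L$, and likewise in $H\sharp R$. 5. $\phi=\epsilon_R\circ\alpha_L$ and $\phi^{-1}=\epsilon_L\circ\beta_R$ (in both presentations). -/

import Mathlib

open scoped TensorProduct

noncomputable section

namespace ScalarExtension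

open Coalgebra HopfAlgebra

/-! ### Module algebras, Yetter-Drinfeld module algebras, smash products -/

section YetterDrinfeld

/-- A left `H`-module algebra `L`; `act h a` is `h ▷ a`. -/
structure LeftModuleAlgebra (k H L : Type*) [Field k] [Ring H] [Bialgebra k H]
    [Ring L] [Algebra k L] where
  act : H →ₗ[k] L →ₗ[k] L
  one_act : ∀ a, act 1 a = a
  mul_act : ∀ g h a, act (g * h) a = act g (act h a)
  /-- `h ▷ (a b) = (h₁ ▷ a) (h₂ ▷ b)` -/
  act_mul : ∀ h a b, act h (a * b) =
    LinearMap.mul' k L (TensorProduct.map (act.flip a) (act.flip b) (comul h))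
  act_one : ∀ h, act h 1 = counit (R := k) h • (1 : L)

/-- A right `H`-module algebra `R`; `act a h` is `a ◁ h`. -/
structure RightModuleAlgebra (k H R : Type*) [Field k] [Ring H] [Bialgebra k H]
    [Ring R] [Algebra k R] where
  act : R →ₗ[k] H →ₗ[k] R
  act_unit : ∀ a, act a 1 = a
  act_act : ∀ g h a, act a (g * h) = act (act a g) h
  /-- `(a b) ◁ h = (a ◁ h₁) (b ◁ h₂)` -/
  mul_act : ∀ h a b, act (a * b) h =
    LinearMap.mul' k R (TensorProduct.map (act a) (act b) (comul h))
  one_act : ∀ h, act 1 h = counit (R := k) h • (1 : R)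

/-- A left-right Yetter-Drinfeld module algebra `(L, ▷, ρ)` over `H`,
with `coact = ρ : a ↦ a₀ ⊗ a₁`. -/
structure LRYetterDrinfeldAlgebra (k H L : Type*) [Field k] [Ring H] [Bialgebra k H]
    [Ring L] [Algebra k L] extends LeftModuleAlgebra k H L where
  coact : L →ₗ[k] L ⊗[k] H
  coact_coassoc : ∀ a, TensorProduct.assoc k L H H (coact.rTensor H (coact a)) =
    (comul (R := k) (A := H)).lTensor L (coact a)
  coact_counit : ∀ a,
    TensorProduct.rid k L ((counit (R := k) (A := H)).lTensor L (coact a)) = a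
  /-- `(h₁ ▷ a₀) ⊗ h₂ a₁ = (h₂ ▷ a)₀ ⊗ (h₂ ▷ a)₁ h₁` -/
  yetterDrinfeld : ∀ h a,
    TensorProduct.map₂ act (LinearMap.mul k H) (comul h) (coact a) =
      LinearMap.mul' k (L ⊗[k] H)
        (TensorProduct.map (coact ∘ₗ act.flip a)
          (Algebra.TensorProduct.includeRight : H →ₐ[k] L ⊗[k] H).toLinearMap
          (TensorProduct.comm k H H (comul h)))
  /-- `(a b)₀ ⊗ (a b)₁ = a₀ b₀ ⊗ b₁ a₁` -/
  coact_mul : ∀ a b, coact (a * b) =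
    TensorProduct.map₂ (LinearMap.mul k L) (LinearMap.mul k H).flip (coact a) (coact b)
  coact_one : coact 1 = 1 ⊗ₜ[k] 1

/-- A right-left Yetter-Drinfeld module algebra `(R, ◁, lam)` over `H`,
with `coact = lam : a ↦ a₋₁ ⊗ a₀`. -/
structure RLYetterDrinfeldAlgebra (k H R : Type*) [Field k] [Ring H] [Bialgebra k H]
    [Ring R] [Algebra k R] extends RightModuleAlgebra k H R where
  coact : R →ₗ[k] H ⊗[k] R
  coact_coassoc : ∀ a,
    TensorProduct.assoc k H H R ((comul (R := k) (A := H)).rTensor R (coact a)) =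
      coact.lTensor H (coact a)
  coact_counit : ∀ a,
    TensorProduct.lid k R ((counit (R := k) (A := H)).rTensor R (coact a)) = a
  /-- `a₋₁ h₁ ⊗ (a₀ ◁ h₂) = h₂ (a ◁ h₁)₋₁ ⊗ (a ◁ h₁)₀` -/
  yetterDrinfeld : ∀ h a,
    TensorProduct.map₂ (LinearMap.mul k H) act (coact a) (comul h) =
      LinearMap.mul' k (H ⊗[k] R)
        (TensorProduct.map
          (Algebra.TensorProduct.includeLeft : H →ₐ[k] H ⊗[k] R).toLinearMap
          (coact ∘ₗ act a)
          (TensorProduct.comm k H H (comul h)))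
  /-- `(a b)₋₁ ⊗ (a b)₀ = b₋₁ a₋₁ ⊗ a₀ b₀` -/
  coact_mul : ∀ a b, coact (a * b) =
    TensorProduct.map₂ (LinearMap.mul k H).flip (LinearMap.mul k R) (coact a) (coact b)
  coact_one : coact 1 = 1 ⊗ₜ[k] 1

variable {k H L R : Type*} [Field k] [Ring H] [Ring L] [Algebra k L] [Ring R] [Algebra k R]

/-- Braided commutativity: `x₀ (x₁ ▷ a) = a x`. -/
def LRYetterDrinfeldAlgebra.BraidedCommutative [Bialgebra k H]
    (D : LRYetterDrinfeldAlgebra k H L) : Prop :=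
  ∀ a x, LinearMap.mul' k L ((D.act.flip a).lTensor L (D.coact x)) = a * x

/-- Braided commutativity: `(a ◁ y₋₁) y₀ = y a`. -/
def RLYetterDrinfeldAlgebra.BraidedCommutative [Bialgebra k H]
    (D : RLYetterDrinfeldAlgebra k H R) : Prop :=
  ∀ a y, LinearMap.mul' k R ((D.act a).rTensor R (D.coact y)) = y * a

/-- A `k`-linear bijection `φ` which is an antiisomorphism of algebras
(preservation of the unit follows from bijectivity). -/
def IsAntiIso (φ : L ≃ₗ[k] R) : Prop := ∀ x y, φ (x * y) = φ y * φ x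

/-- Compatibility of the actions and coactions via `φ : L → R`. -/
structure CompatibleVia [HopfAlgebra k H] (𝓛 : LRYetterDrinfeldAlgebra k H L)
    (𝓡 : RLYetterDrinfeldAlgebra k H R) (φ : L ≃ₗ[k] R) : Prop where
  /-- `φ (f ▷ x) = φ x ◁ S f` -/
  map_act : ∀ f x, φ (𝓛.act f x) = 𝓡.act (φ x) (antipode k f)
  /-- `φ(x)₋₁ ⊗ φ(x)₀ = S (x₁) ⊗ φ (x₀)` -/
  map_coact : ∀ x, 𝓡.coact (φ x) =
    TensorProduct.map (antipode k) φ.toLinearMap (TensorProduct.comm k L H (𝓛.coact x))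

end YetterDrinfeld

section Smash

variable {k H L R : Type*} [Field k] [Ring H] [Bialgebra k H] [Ring L] [Algebra k L]
  [Ring R] [Algebra k R]

/-- The smash product `L ♯ H`: the vector space `L ⊗ H` with product
`(a ♯ h) (b ♯ g) = a (h₁ ▷ b) ♯ h₂ g`. -/
def LeftModuleAlgebra.Smash (_D : LeftModuleAlgebra k H L) : Type _ := L ⊗[k] H

/-- The smash product `H ♯ R`: the vector space `H ⊗ R` with product
`(h ♯ a) (g ♯ b) = h g₁ ♯ (a ◁ g₂) b`. -/
def RightModuleAlgebra.Smash (_D : RightModuleAlgebra k H R) : Type _ := H ⊗[k] R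

namespace LeftModuleAlgebra

variable (D : LeftModuleAlgebra k H L)

instance : AddCommGroup D.Smash := inferInstanceAs (AddCommGroup (L ⊗[k] H))
instance : Module k D.Smash := inferInstanceAs (Module k (L ⊗[k] H))

/-- The identification of the underlying vector space. -/
def ofTensor : L ⊗[k] H ≃ₗ[k] D.Smash := LinearEquiv.refl k _

/-- `sharp a h = a ♯ h` -/
def sharp : L →ₗ[k] H →ₗ[k] D.Smash := TensorProduct.mk k L H

/-- `opMap (a ⊗ h)` is the endomorphism `b ⊗ g ↦ a (h₁ ▷ b) ⊗ h₂ g` of `L ⊗ H`. -/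
def opMap : L ⊗[k] H →ₗ[k] L ⊗[k] H →ₗ[k] L ⊗[k] H :=
  TensorProduct.lift
    ((LinearMap.mul k (Module.End k (L ⊗[k] H))).compl₁₂
      ((LinearMap.rTensorHom H) ∘ₗ LinearMap.mul k L)
      ((TensorProduct.map₂ D.act (LinearMap.mul k H)) ∘ₗ comul))

theorem opMap_tmul (a : L) (h : H) (t : L ⊗[k] H) :
    D.opMap (a ⊗ₜ h) t = (LinearMap.mulLeft k a).rTensor H
      (TensorProduct.map₂ D.act (LinearMap.mul k H) (comul h) t) := rfl

theorem opMap_tmul_tmul (a b : L) (h g : H) :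
    D.opMap (a ⊗ₜ h) (b ⊗ₜ g) =
      TensorProduct.map (LinearMap.mulLeft k a ∘ₗ D.act.flip b) (LinearMap.mulRight k g)
        (comul h) := by
  rw [opMap_tmul]
  generalize (comul h : H ⊗[k] H) = t
  induction t with
  | zero => simp
  | tmul x y => simp
  | add x y hx hy => simp only [map_add, LinearMap.add_apply, hx, hy]

/-- The diagonal action `b ⊗ g ↦ (h₁ ▷ b) ⊗ h₂ g` of `H` on `L ⊗ H`. -/
abbrev diag (h : H) : L ⊗[k] H →ₗ[k] L ⊗[k] H :=
  TensorProduct.map₂ D.act (LinearMap.mul k H) (comul h)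

theorem diag_mul (g h : H) (t : L ⊗[k] H) : D.diag (g * h) t = D.diag g (D.diag h t) := by
  have key : ∀ u v : H ⊗[k] H, TensorProduct.map₂ D.act (LinearMap.mul k H) (u * v) t =
      TensorProduct.map₂ D.act (LinearMap.mul k H) u
        (TensorProduct.map₂ D.act (LinearMap.mul k H) v t) := by
    intro u v
    induction u with
    | zero => simp
    | add x y hx hy => simp only [add_mul, map_add, LinearMap.add_apply, hx, hy]
    | tmul x y =>
      induction v with
      | zero => simp
      | add x y hx hy => simp only [mul_add, map_add, LinearMap.add_apply, hx, hy]
      | tmul z w =>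
        induction t with
        | zero => simp
        | add x y hx hy => simp only [map_add, hx, hy]
        | tmul b e => simp [D.mul_act, mul_assoc]
  simp only [diag, Bialgebra.comul_mul, key]

theorem diag_one (t : L ⊗[k] H) : D.diag 1 t = t := by
  induction t with
  | zero => simp
  | add x y hx hy => rw [map_add, hx, hy]
  | tmul b e => simp [diag, D.one_act, Algebra.TensorProduct.one_def]

theorem diag_rTensor_mulLeft (h : H) (b c : L) (e : H) :
    D.diag h ((b * c) ⊗ₜ e) =
      TensorProduct.lift ((LinearMap.compl₁₂ (LinearMap.mul k (Module.End k (L ⊗[k] H)))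
        ((LinearMap.rTensorHom H) ∘ₗ LinearMap.mul k L ∘ₗ D.act.flip b)
        ((TensorProduct.map₂ D.act (LinearMap.mul k H)) ∘ₗ comul))) (comul h) (c ⊗ₜ e) := by
  let F : H ⊗[k] (H ⊗[k] H) →ₗ[k] L ⊗[k] H :=
    TensorProduct.map (LinearMap.mul' k L) LinearMap.id ∘ₗ
      (TensorProduct.assoc k L L H).symm.toLinearMap ∘ₗ
      TensorProduct.map (D.act.flip b) (TensorProduct.map (D.act.flip c) (LinearMap.mulRight k e))
  have h1 : D.diag h ((b * c) ⊗ₜ e) =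
      F (TensorProduct.assoc k H H H ((comul (R := k) (A := H)).rTensor H (comul h))) := by
    simp only [diag]
    generalize (comul h : H ⊗[k] H) = t
    induction t with
    | zero => simp
    | add x y hx hy => simp only [map_add, LinearMap.add_apply, hx, hy]
    | tmul x y =>
      simp only [TensorProduct.map₂_apply_tmul, TensorProduct.map_tmul, D.act_mul,
        LinearMap.rTensor_tmul, LinearMap.mul_apply']
      generalize (comul x : H ⊗[k] H) = t
      induction t with
      | zero => simp
      | add x y hx hy => simp only [map_add, TensorProduct.add_tmul, hx, hy]
      | tmul x z => simp [F]
  rw [h1, Coalgebra.coassoc_apply]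
  generalize (comul h : H ⊗[k] H) = t
  induction t with
  | zero => simp
  | add x y hx hy => simp only [map_add, LinearMap.add_apply, hx, hy]
  | tmul x y =>
    simp only [LinearMap.lTensor_tmul, TensorProduct.lift.tmul, LinearMap.compl₁₂_apply,
      LinearMap.comp_apply, LinearMap.mul_apply', Module.End.mul_apply]
    generalize (comul y : H ⊗[k] H) = t
    induction t with
    | zero => simp
    | add x y hx hy => simp only [map_add, TensorProduct.tmul_add, LinearMap.add_apply, hx, hy]
    | tmul z w => simp [F]

theorem opMap_opMap (s t u : L ⊗[k] H) :
    D.opMap (D.opMap s t) u = D.opMap s (D.opMap t u) := by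
  induction s with
  | zero => simp
  | add x y hx hy => simp only [map_add, LinearMap.add_apply, hx, hy]
  | tmul a h =>
    induction t with
    | zero => simp
    | add x y hx hy => simp only [map_add, LinearMap.add_apply, hx, hy]
    | tmul b g =>
      rw [D.opMap_tmul_tmul, D.opMap_tmul b g, D.opMap_tmul a h]
      change _ = (LinearMap.mulLeft k a).rTensor H (D.diag h
        ((LinearMap.mulLeft k b).rTensor H (D.diag g u)))
      have h2 : ∀ t : H ⊗[k] H, D.opMap (TensorProduct.map (LinearMap.mulLeft k a ∘ₗ D.act.flip b)
          (LinearMap.mulRight k g) t) u = (LinearMap.mulLeft k a).rTensor H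
            (TensorProduct.lift ((LinearMap.compl₁₂ (LinearMap.mul k (Module.End k (L ⊗[k] H)))
              ((LinearMap.rTensorHom H) ∘ₗ LinearMap.mul k L ∘ₗ D.act.flip b)
              ((TensorProduct.map₂ D.act (LinearMap.mul k H)) ∘ₗ comul))) t (D.diag g u)) := by
        intro t
        induction t with
        | zero => simp
        | add x y hx hy => simp only [map_add, LinearMap.add_apply, hx, hy]
        | tmul x y =>
          simp only [TensorProduct.map_tmul, LinearMap.mulRight_apply, LinearMap.comp_apply,
            D.opMap_tmul, LinearMap.mulLeft_apply, TensorProduct.lift.tmul,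
            LinearMap.compl₁₂_apply, LinearMap.mul_apply', Module.End.mul_apply]
          have := D.diag_mul y g u
          simp only [diag] at this
          rw [this]
          generalize (TensorProduct.map₂ D.act (LinearMap.mul k H)) (comul y) _ = v
          induction v with
          | zero => simp
          | add x y hx hy => simp only [map_add, hx, hy]
          | tmul p q => simp
      rw [h2]
      congr 1
      generalize D.diag g u = v
      induction v with
      | zero => simp
      | add x y hx hy => simp only [map_add, hx, hy]
      | tmul p q => exact (D.diag_rTensor_mulLeft h b p q).symm

theorem opMap_one_left (t : L ⊗[k] H) : D.opMap (1 ⊗ₜ 1) t = t := by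
  rw [D.opMap_tmul]
  change (LinearMap.mulLeft k (1 : L)).rTensor H (D.diag 1 t) = t
  rw [D.diag_one]
  simp

theorem opMap_one_right (t : L ⊗[k] H) : D.opMap t (1 ⊗ₜ 1) = t := by
  induction t with
  | zero => simp
  | add x y hx hy => simp only [map_add, LinearMap.add_apply, hx, hy]
  | tmul a h =>
    have key : ∀ t : H ⊗[k] H, TensorProduct.map (LinearMap.mulLeft k a ∘ₗ D.act.flip 1)
        (LinearMap.mulRight k 1) t =
        TensorProduct.map (LinearMap.toSpanSingleton k L a) LinearMap.id
          ((counit (R := k) (A := H)).rTensor H t) := by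
      intro t
      induction t with
      | zero => simp
      | add x y hx hy => simp only [map_add, hx, hy]
      | tmul x y => simp [D.act_one]
    rw [D.opMap_tmul_tmul, key, Coalgebra.rTensor_counit_comul]
    simp

instance : Ring D.Smash :=
  { (inferInstance : AddCommGroup D.Smash) with
    mul := fun s t => D.opMap s t
    one := (1 : L) ⊗ₜ[k] (1 : H)
    mul_assoc := D.opMap_opMap
    one_mul := D.opMap_one_left
    mul_one := D.opMap_one_right
    left_distrib := fun s => map_add (D.opMap s)
    right_distrib := fun s t u => LinearMap.congr_fun (map_add D.opMap s t) u
    zero_mul := fun t => LinearMap.congr_fun (map_zero D.opMap) t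
    mul_zero := fun s => map_zero (D.opMap s) }

instance : Algebra k D.Smash :=
  Algebra.ofModule (fun r s t => LinearMap.congr_fun (map_smul D.opMap r s) t)
    (fun r s t => map_smul (D.opMap s) r t)

theorem one_def : (1 : D.Smash) = D.sharp 1 1 := rfl

/-- `(a ♯ h) (b ♯ g) = a (h₁ ▷ b) ♯ h₂ g` -/
theorem sharp_mul_sharp (a b : L) (h g : H) : D.sharp a h * D.sharp b g =
    D.ofTensor (TensorProduct.map (LinearMap.mulLeft k a ∘ₗ D.act.flip b)
      (LinearMap.mulRight k g) (comul h)) :=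
  D.opMap_tmul_tmul a b h g

/-- The canonical map `L → L ♯ H`, `x ↦ x ♯ 1`. -/
def inl : L →ₐ[k] D.Smash :=
  AlgHom.ofLinearMap (D.sharp.flip 1) rfl (fun x y => by
    simp only [LinearMap.flip_apply, sharp_mul_sharp, Bialgebra.comul_one,
      Algebra.TensorProduct.one_def]
    simp [D.one_act]
    rfl)

/-- The canonical map `H → L ♯ H`, `f ↦ 1 ♯ f`. -/
def inr : H →ₐ[k] D.Smash :=
  AlgHom.ofLinearMap (D.sharp 1) rfl (fun x y => by
    have key : ∀ t : H ⊗[k] H, TensorProduct.map (LinearMap.mulLeft k 1 ∘ₗ D.act.flip 1)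
        (LinearMap.mulRight k y) t =
        TensorProduct.map (LinearMap.toSpanSingleton k L 1) (LinearMap.mulRight k y)
          ((counit (R := k) (A := H)).rTensor H t) := by
      intro t
      induction t with
      | zero => simp
      | add x y hx hy => simp only [map_add, hx, hy]
      | tmul x y => simp [D.act_one]
    rw [sharp_mul_sharp, key, Coalgebra.rTensor_counit_comul]
    simp
    rfl)

theorem inl_apply (x : L) : D.inl x = D.sharp x 1 := rfl

theorem inr_apply (f : H) : D.inr f = D.sharp 1 f := rfl

end LeftModuleAlgebra

namespace RightModuleAlgebra

variable (D : RightModuleAlgebra k H R)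

instance : AddCommGroup D.Smash := inferInstanceAs (AddCommGroup (H ⊗[k] R))
instance : Module k D.Smash := inferInstanceAs (Module k (H ⊗[k] R))

/-- The identification of the underlying vector space. -/
def ofTensor : H ⊗[k] R ≃ₗ[k] D.Smash := LinearEquiv.refl k _

/-- `sharp h a = h ♯ a` -/
def sharp : H →ₗ[k] R →ₗ[k] D.Smash := TensorProduct.mk k H R

/-- The diagonal right action `g ⊗ b ↦ g h₁ ⊗ (b ◁ h₂)` of `H` on `H ⊗ R`. -/
abbrev diag : H →ₗ[k] H ⊗[k] R →ₗ[k] H ⊗[k] R :=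
  (TensorProduct.map₂ (LinearMap.mul k H) D.act).flip ∘ₗ comul

/-- `opMap (g ⊗ b)` is the endomorphism `h ⊗ a ↦ h g₁ ⊗ (a ◁ g₂) b` of `H ⊗ R`. -/
def opMap : H ⊗[k] R →ₗ[k] H ⊗[k] R →ₗ[k] H ⊗[k] R :=
  TensorProduct.lift
    ((LinearMap.mul k (Module.End k (H ⊗[k] R))).compl₁₂
      ((LinearMap.lTensorHom H) ∘ₗ (LinearMap.mul k R).flip) D.diag).flip

theorem opMap_tmul (g : H) (b : R) (t : H ⊗[k] R) :
    D.opMap (g ⊗ₜ b) t = (LinearMap.mulRight k b).lTensor H (D.diag g t) := rfl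

theorem opMap_tmul_tmul (h g : H) (a b : R) :
    D.opMap (g ⊗ₜ b) (h ⊗ₜ a) =
      TensorProduct.map (LinearMap.mulLeft k h) (LinearMap.mulRight k b ∘ₗ D.act a)
        (comul g) := by
  rw [opMap_tmul]
  simp only [diag, LinearMap.comp_apply, LinearMap.flip_apply]
  generalize (comul g : H ⊗[k] H) = t
  induction t with
  | zero => simp
  | tmul x y => simp
  | add x y hx hy => simp only [map_add, hx, hy]

theorem diag_mul (g h : H) (t : H ⊗[k] R) : D.diag (g * h) t = D.diag h (D.diag g t) := by
  have key : ∀ u v : H ⊗[k] H, TensorProduct.map₂ (LinearMap.mul k H) D.act t (u * v) =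
      TensorProduct.map₂ (LinearMap.mul k H) D.act
        (TensorProduct.map₂ (LinearMap.mul k H) D.act t u) v := by
    intro u v
    induction u with
    | zero => simp
    | add x y hx hy => simp only [add_mul, map_add, LinearMap.add_apply, hx, hy]
    | tmul x y =>
      induction v with
      | zero => simp
      | add x y hx hy => simp only [mul_add, map_add, hx, hy]
      | tmul z w =>
        induction t with
        | zero => simp
        | add x y hx hy => simp only [map_add, LinearMap.add_apply, hx, hy]
        | tmul b e => simp [D.act_act, mul_assoc]
  simp only [diag, LinearMap.comp_apply, LinearMap.flip_apply, Bialgebra.comul_mul, key]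

theorem diag_one (t : H ⊗[k] R) : D.diag 1 t = t := by
  induction t with
  | zero => simp
  | add x y hx hy => rw [map_add, hx, hy]
  | tmul b e => simp [diag, D.act_unit, Algebra.TensorProduct.one_def]

theorem diag_lTensor_mulRight (h : H) (b c : R) (e : H) :
    D.diag h (e ⊗ₜ (c * b)) =
      TensorProduct.lift ((LinearMap.compl₁₂ (LinearMap.mul k (Module.End k (H ⊗[k] R)))
        ((LinearMap.lTensorHom H) ∘ₗ (LinearMap.mul k R).flip ∘ₗ D.act b) D.diag).flip)
        (comul h) (e ⊗ₜ c) := by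
  let F : H ⊗[k] (H ⊗[k] H) →ₗ[k] H ⊗[k] R :=
    TensorProduct.map (LinearMap.mulLeft k e)
      (LinearMap.mul' k R ∘ₗ TensorProduct.map (D.act c) (D.act b))
  have h1 : D.diag h (e ⊗ₜ (c * b)) =
      F ((comul (R := k) (A := H)).lTensor H (comul h)) := by
    simp only [diag, LinearMap.comp_apply, LinearMap.flip_apply]
    generalize (comul h : H ⊗[k] H) = t
    induction t with
    | zero => simp
    | add x y hx hy => simp only [map_add, hx, hy]
    | tmul x y => simp [D.mul_act, F]
  rw [h1, ← Coalgebra.coassoc_apply]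
  generalize (comul h : H ⊗[k] H) = t
  induction t with
  | zero => simp
  | add x y hx hy => simp only [map_add, LinearMap.add_apply, hx, hy]
  | tmul x y =>
    simp only [LinearMap.rTensor_tmul, TensorProduct.lift.tmul, LinearMap.flip_apply,
      LinearMap.compl₁₂_apply, LinearMap.comp_apply, LinearMap.mul_apply', Module.End.mul_apply]
    generalize (comul x : H ⊗[k] H) = t
    induction t with
    | zero => simp
    | add x y hx hy => simp only [map_add, TensorProduct.add_tmul, hx, hy]
    | tmul z w => simp [F]

theorem opMap_opMap (s t u : H ⊗[k] R) :
    D.opMap (D.opMap s t) u = D.opMap s (D.opMap t u) := by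
  induction s with
  | zero => simp
  | add x y hx hy => simp only [map_add, LinearMap.add_apply, hx, hy]
  | tmul h a =>
    induction t with
    | zero => simp
    | add x y hx hy => simp only [map_add, LinearMap.add_apply, hx, hy]
    | tmul g b =>
      rw [D.opMap_tmul_tmul, D.opMap_tmul g b, D.opMap_tmul h a]
      have h2 : ∀ t : H ⊗[k] H, D.opMap (TensorProduct.map (LinearMap.mulLeft k g)
          (LinearMap.mulRight k a ∘ₗ D.act b) t) u = (LinearMap.mulRight k a).lTensor H
            (TensorProduct.lift ((LinearMap.compl₁₂ (LinearMap.mul k (Module.End k (H ⊗[k] R)))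
              ((LinearMap.lTensorHom H) ∘ₗ (LinearMap.mul k R).flip ∘ₗ D.act b) D.diag).flip)
              t (D.diag g u)) := by
        intro t
        induction t with
        | zero => simp
        | add x y hx hy => simp only [map_add, LinearMap.add_apply, hx, hy]
        | tmul x y =>
          rw [TensorProduct.map_tmul, D.opMap_tmul, LinearMap.mulLeft_apply, D.diag_mul]
          simp only [TensorProduct.lift.tmul, LinearMap.flip_apply, LinearMap.compl₁₂_apply,
            LinearMap.mul_apply', Module.End.mul_apply]
          generalize D.diag x _ = v
          induction v with
          | zero => simp
          | add x y hx hy => simp only [map_add, hx, hy]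
          | tmul p q => simp [mul_assoc]
      rw [h2]
      congr 1
      generalize D.diag g u = v
      induction v with
      | zero => simp
      | add x y hx hy => simp only [map_add, hx, hy]
      | tmul p q => exact (D.diag_lTensor_mulRight h b q p).symm

theorem opMap_one_left (t : H ⊗[k] R) : D.opMap (1 ⊗ₜ 1) t = t := by
  rw [D.opMap_tmul, D.diag_one]
  simp

theorem opMap_one_right (t : H ⊗[k] R) : D.opMap t (1 ⊗ₜ 1) = t := by
  induction t with
  | zero => simp
  | add x y hx hy => simp only [map_add, LinearMap.add_apply, hx, hy]
  | tmul h a =>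
    have key : ∀ t : H ⊗[k] H, TensorProduct.map (LinearMap.mulLeft k 1)
        (LinearMap.mulRight k a ∘ₗ D.act 1) t =
        TensorProduct.map LinearMap.id (LinearMap.toSpanSingleton k R a)
          ((counit (R := k) (A := H)).lTensor H t) := by
      intro t
      induction t with
      | zero => simp
      | add x y hx hy => simp only [map_add, hx, hy]
      | tmul x y => simp [D.one_act]
    rw [D.opMap_tmul_tmul, key, Coalgebra.lTensor_counit_comul]
    simp

instance : Ring D.Smash :=
  { (inferInstance : AddCommGroup D.Smash) with
    mul := fun s t => D.opMap t s
    one := (1 : H) ⊗ₜ[k] (1 : R)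
    mul_assoc := fun s t u => (D.opMap_opMap u t s).symm
    one_mul := D.opMap_one_right
    mul_one := D.opMap_one_left
    left_distrib := fun s t u => LinearMap.congr_fun (map_add D.opMap t u) s
    right_distrib := fun s t u => map_add (D.opMap u) s t
    zero_mul := fun t => map_zero (D.opMap t)
    mul_zero := fun s => LinearMap.congr_fun (map_zero D.opMap) s }

instance : Algebra k D.Smash :=
  Algebra.ofModule (fun r s t => map_smul (D.opMap t) r s)
    (fun r s t => LinearMap.congr_fun (map_smul D.opMap r t) s)

theorem one_def : (1 : D.Smash) = D.sharp 1 1 := rfl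

/-- `(h ♯ a) (g ♯ b) = h g₁ ♯ (a ◁ g₂) b` -/
theorem sharp_mul_sharp (h g : H) (a b : R) : D.sharp h a * D.sharp g b =
    D.ofTensor (TensorProduct.map (LinearMap.mulLeft k h) (LinearMap.mulRight k b ∘ₗ D.act a)
      (comul g)) :=
  D.opMap_tmul_tmul h g a b

/-- The canonical map `H → H ♯ R`, `f ↦ f ♯ 1`. -/
def inl : H →ₐ[k] D.Smash :=
  AlgHom.ofLinearMap (D.sharp.flip 1) rfl (fun x y => by
    have key : ∀ t : H ⊗[k] H, TensorProduct.map (LinearMap.mulLeft k x)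
        (LinearMap.mulRight k 1 ∘ₗ D.act 1) t =
        TensorProduct.map (LinearMap.mulLeft k x) (LinearMap.toSpanSingleton k R 1)
          ((counit (R := k) (A := H)).lTensor H t) := by
      intro t
      induction t with
      | zero => simp
      | add x y hx hy => simp only [map_add, hx, hy]
      | tmul x y => simp [D.one_act]
    simp only [LinearMap.flip_apply]
    rw [sharp_mul_sharp, key, Coalgebra.lTensor_counit_comul]
    simp
    rfl)

/-- The canonical map `R → H ♯ R`, `y ↦ 1 ♯ y`. -/
def inr : R →ₐ[k] D.Smash :=
  AlgHom.ofLinearMap (D.sharp 1) rfl (fun x y => by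
    rw [sharp_mul_sharp, Bialgebra.comul_one, Algebra.TensorProduct.one_def]
    simp [D.act_unit]
    rfl)

theorem inl_apply (f : H) : D.inl f = D.sharp f 1 := rfl

theorem inr_apply (y : R) : D.inr y = D.sharp 1 y := rfl

end RightModuleAlgebra

end Smash

/-! ### Tensor products over noncommutative algebras -/

section Balanced

variable {k A B M N P Q : Type*} [Field k] [AddCommGroup M] [Module k M] [AddCommGroup N]
  [Module k N] [AddCommGroup P] [Module k P] [AddCommGroup Q] [Module k Q]

/-- The relations `m.a ⊗ n = m ⊗ a.n`, for `m.a = r a m` and `a.n = l a n`. -/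
def balancedRel (r : A → M →ₗ[k] M) (l : A → N →ₗ[k] N) : Submodule k (M ⊗[k] N) :=
  Submodule.span k {t | ∃ a m n, t = r a m ⊗ₜ n - m ⊗ₜ l a n}

/-- The tensor product `M ⊗_A N` for a right action `r` of `A` on `M` and a left action `l` of
`A` on `N`, as a quotient of `M ⊗ N`. -/
abbrev BTensor (r : A → M →ₗ[k] M) (l : A → N →ₗ[k] N) : Type _ :=
  (M ⊗[k] N) ⧸ balancedRel r l

namespace BTensor

variable (r : A → M →ₗ[k] M) (l : A → N →ₗ[k] N)

/-- The projection `M ⊗ N → M ⊗_A N`. -/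
abbrev proj : M ⊗[k] N →ₗ[k] BTensor r l := (balancedRel r l).mkQ

theorem proj_balanced (a : A) (m : M) (n : N) :
    proj r l (r a m ⊗ₜ n) = proj r l (m ⊗ₜ l a n) :=
  (Submodule.Quotient.eq _).2 (Submodule.subset_span ⟨a, m, n, rfl⟩)

variable {r l}

/-- Balanced maps factor through `M ⊗_A N`. -/
def lift (F : M ⊗[k] N →ₗ[k] Q) (hF : ∀ a m n, F (r a m ⊗ₜ n) = F (m ⊗ₜ l a n)) :
    BTensor r l →ₗ[k] Q :=
  (balancedRel r l).liftQ F (Submodule.span_le.2 (by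
    rintro _ ⟨a, m, n, rfl⟩
    simp [hF]))

@[simp]
theorem lift_proj (F : M ⊗[k] N →ₗ[k] Q) (hF : ∀ a m n, F (r a m ⊗ₜ n) = F (m ⊗ₜ l a n))
    (t : M ⊗[k] N) : lift F hF (proj r l t) = F t := rfl

theorem induction {p : BTensor r l → Prop} (h : ∀ m n, p (proj r l (m ⊗ₜ n)))
    (hadd : ∀ s t, p s → p t → p (s + t)) (t : BTensor r l) : p t := by
  obtain ⟨t, rfl⟩ := Submodule.mkQ_surjective _ t
  induction t with
  | zero => simpa using h 0 0
  | tmul m n => exact h m n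
  | add x y hx hy => simpa only [map_add] using hadd _ _ hx hy

/-- `f ⊗ id` on `M ⊗_A N`, for `f` commuting with the right action of `A` on `M`. -/
def actLeft (f : M →ₗ[k] M) (hf : ∀ a m, f (r a m) = r a (f m)) :
    BTensor r l →ₗ[k] BTensor r l :=
  lift (proj r l ∘ₗ f.rTensor N) (fun a m n => by
    simp only [LinearMap.comp_apply, LinearMap.rTensor_tmul, hf, proj_balanced])

/-- `id ⊗ g` on `M ⊗_A N`, for `g` commuting with the left action of `A` on `N`. -/
def actRight (g : N →ₗ[k] N) (hg : ∀ a n, g (l a n) = l a (g n)) :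
    BTensor r l →ₗ[k] BTensor r l :=
  lift (proj r l ∘ₗ g.lTensor M) (fun a m n => by
    simp only [LinearMap.comp_apply, LinearMap.lTensor_tmul, hg, proj_balanced])

theorem actLeft_proj (f : M →ₗ[k] M) (hf : ∀ a m, f (r a m) = r a (f m)) (m : M) (n : N) :
    actLeft (l := l) f hf (proj r l (m ⊗ₜ n)) = proj r l (f m ⊗ₜ n) := rfl

theorem actRight_proj (g : N →ₗ[k] N) (hg : ∀ a n, g (l a n) = l a (g n)) (m : M) (n : N) :
    actRight (r := r) g hg (proj r l (m ⊗ₜ n)) = proj r l (m ⊗ₜ g n) := rfl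

end BTensor

/-- The tensor product `M ⊗_A N ⊗_B P`, for actions of `A` on `M` (right, `r₁`) and `N`
(left, `l₁`) and of `B` on `N` (right, `r₂`) and `P` (left, `l₂`), as a quotient of
`M ⊗ (N ⊗ P)`. -/
abbrev BTensor₃ (r₁ : A → M →ₗ[k] M) (l₁ : A → N →ₗ[k] N) (r₂ : B → N →ₗ[k] N)
    (l₂ : B → P →ₗ[k] P) : Type _ :=
  (M ⊗[k] (N ⊗[k] P)) ⧸ Submodule.span k
    ({t : M ⊗[k] (N ⊗[k] P) | ∃ a m n p, t = r₁ a m ⊗ₜ (n ⊗ₜ p) - m ⊗ₜ (l₁ a n ⊗ₜ p)} ∪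
      {t : M ⊗[k] (N ⊗[k] P) | ∃ b m n p, t = m ⊗ₜ (r₂ b n ⊗ₜ p) - m ⊗ₜ (n ⊗ₜ l₂ b p)})

namespace BTensor₃

variable (r₁ : A → M →ₗ[k] M) (l₁ : A → N →ₗ[k] N) (r₂ : B → N →ₗ[k] N) (l₂ : B → P →ₗ[k] P)

/-- The projection `M ⊗ (N ⊗ P) → M ⊗_A N ⊗_B P`. -/
abbrev proj : M ⊗[k] (N ⊗[k] P) →ₗ[k] BTensor₃ r₁ l₁ r₂ l₂ := Submodule.mkQ _

theorem proj_balanced₁ (a : A) (m : M) (n : N) (p : P) :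
    proj r₁ l₁ r₂ l₂ (r₁ a m ⊗ₜ (n ⊗ₜ p)) = proj r₁ l₁ r₂ l₂ (m ⊗ₜ (l₁ a n ⊗ₜ p)) :=
  (Submodule.Quotient.eq _).2 (Submodule.subset_span (Or.inl ⟨a, m, n, p, rfl⟩))

theorem proj_balanced₂ (b : B) (m : M) (n : N) (p : P) :
    proj r₁ l₁ r₂ l₂ (m ⊗ₜ (r₂ b n ⊗ₜ p)) = proj r₁ l₁ r₂ l₂ (m ⊗ₜ (n ⊗ₜ l₂ b p)) :=
  (Submodule.Quotient.eq _).2 (Submodule.subset_span (Or.inr ⟨b, m, n, p, rfl⟩))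

/-- The canonical map `(M ⊗_A N) ⊗ P → M ⊗_A N ⊗_B P`. -/
def ofLeft : BTensor r₁ l₁ →ₗ[k] P →ₗ[k] BTensor₃ r₁ l₁ r₂ l₂ :=
  BTensor.lift (TensorProduct.curry
      (proj r₁ l₁ r₂ l₂ ∘ₗ (TensorProduct.assoc k M N P).toLinearMap))
    (fun a m n => by
      ext p
      exact proj_balanced₁ r₁ l₁ r₂ l₂ a m n p)

/-- The canonical map `M ⊗ (N ⊗_B P) → M ⊗_A N ⊗_B P`. -/
def ofRight : M →ₗ[k] BTensor r₂ l₂ →ₗ[k] BTensor₃ r₁ l₁ r₂ l₂ :=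
  (BTensor.lift ((TensorProduct.mk k M (N ⊗[k] P)).compr₂ (proj r₁ l₁ r₂ l₂)).flip
    (fun b n p => by
      ext m
      exact proj_balanced₂ r₁ l₁ r₂ l₂ b m n p)).flip

theorem ofLeft_proj (m : M) (n : N) (p : P) :
    ofLeft r₁ l₁ r₂ l₂ (BTensor.proj r₁ l₁ (m ⊗ₜ n)) p =
      proj r₁ l₁ r₂ l₂ (m ⊗ₜ (n ⊗ₜ p)) := rfl

theorem ofRight_proj (m : M) (n : N) (p : P) :
    ofRight r₁ l₁ r₂ l₂ m (BTensor.proj r₂ l₂ (n ⊗ₜ p)) =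
      proj r₁ l₁ r₂ l₂ (m ⊗ₜ (n ⊗ₜ p)) := rfl

variable {r₁ l₁ r₂ l₂}

/-- `f ⊗ id : M' ⊗_B P → M ⊗_A N ⊗_B P` for a right `B`-linear `f : M' → M ⊗_A N`. -/
def mapLeft (hc : ∀ a b n, r₂ b (l₁ a n) = l₁ a (r₂ b n))
    (f : Q →ₗ[k] BTensor r₁ l₁) (r' : B → Q →ₗ[k] Q)
    (hf : ∀ b q, f (r' b q) = BTensor.actRight (r₂ b) (fun a n => hc a b n) (f q)) :
    BTensor r' l₂ →ₗ[k] BTensor₃ r₁ l₁ r₂ l₂ :=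
  BTensor.lift (TensorProduct.lift (ofLeft r₁ l₁ r₂ l₂ ∘ₗ f)) (fun b q p => by
    simp only [TensorProduct.lift.tmul, LinearMap.comp_apply, hf]
    generalize f q = t
    induction t using BTensor.induction with
    | h m n => exact proj_balanced₂ r₁ l₁ r₂ l₂ b m n p
    | hadd s t hs ht => simp only [map_add, LinearMap.add_apply, hs, ht])

/-- `id ⊗ g : M ⊗_A P' → M ⊗_A N ⊗_B P` for a left `A`-linear `g : P' → N ⊗_B P`. -/
def mapRight (hc : ∀ a b n, r₂ b (l₁ a n) = l₁ a (r₂ b n))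
    (g : Q →ₗ[k] BTensor r₂ l₂) (l' : A → Q →ₗ[k] Q)
    (hg : ∀ a q, g (l' a q) = BTensor.actLeft (l₁ a) (fun b n => (hc a b n).symm) (g q)) :
    BTensor r₁ l' →ₗ[k] BTensor₃ r₁ l₁ r₂ l₂ :=
  BTensor.lift (TensorProduct.lift ((ofRight r₁ l₁ r₂ l₂).compl₂ g)) (fun a m q => by
    simp only [TensorProduct.lift.tmul, LinearMap.compl₂_apply, hg]
    generalize g q = t
    induction t using BTensor.induction with
    | h n p => exact proj_balanced₁ r₁ l₁ r₂ l₂ a m n p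
    | hadd s t hs ht => simp only [map_add, hs, ht])

end BTensor₃

end Balanced

/-! ### Bialgebroids and symmetric Hopf algebroids -/

section Bialgebroid

open LinearMap (mulLeft mulRight)

theorem mulRight_mulLeft {k K : Type*} [Field k] [Ring K] [Algebra k K] (u v x : K) :
    mulRight k u (mulLeft k v x) = mulLeft k v (mulRight k u x) := by
  simp only [LinearMap.mulLeft_apply, LinearMap.mulRight_apply, mul_assoc]

theorem mulLeft_mulRight {k K : Type*} [Field k] [Ring K] [Algebra k K] (u v x : K) :
    mulLeft k u (mulRight k v x) = mulRight k v (mulLeft k u x) := by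
  simp only [LinearMap.mulLeft_apply, LinearMap.mulRight_apply, mul_assoc]

/-- A homomorphism `source` and an antihomomorphism `target` from `A` to `K` with mutually
commuting images. -/
structure SourceTarget (k A K : Type*) [Field k] [Ring A] [Algebra k A] [Ring K]
    [Algebra k K] where
  source : A →ₐ[k] K
  target : A →ₗ[k] K
  target_one : target 1 = 1
  target_mul : ∀ a b, target (a * b) = target b * target a
  commute : ∀ a b, source a * target b = target b * source a

namespace SourceTarget

variable {k A K : Type*} [Field k] [Ring A] [Algebra k A] [Ring K] [Algebra k K]
  (s : SourceTarget k A K)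

/-- `K ⊗_A K` for the bimodule structure `a.x.b = source a * target b * x`. -/
abbrev TensorL : Type _ := BTensor (fun b : A => mulLeft k (s.target b))
  (fun a : A => mulLeft k (s.source a))

/-- `K ⊗_A K` for the bimodule structure `b.x.a = x * source a * target b`. -/
abbrev TensorR : Type _ := BTensor (fun a : A => mulRight k (s.source a))
  (fun b : A => mulRight k (s.target b))

/-- The projection `K ⊗ K → K ⊗_A K`. -/
abbrev projL : K ⊗[k] K →ₗ[k] s.TensorL := BTensor.proj _ _

/-- The projection `K ⊗ K → K ⊗_A K`. -/
abbrev projR : K ⊗[k] K →ₗ[k] s.TensorR := BTensor.proj _ _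

/-- `dotL [x ⊗ y] (g ⊗ h) = [x g ⊗ y h]` -/
def dotL : s.TensorL →ₗ[k] K ⊗[k] K →ₗ[k] s.TensorL :=
  BTensor.lift ((LinearMap.mul k (K ⊗[k] K)).compr₂ s.projL) (fun a m n => by
    ext g h
    simpa [mul_assoc] using BTensor.proj_balanced (fun b : A => mulLeft k (s.target b))
      (fun a : A => mulLeft k (s.source a)) a (m * g) (n * h))

/-- `dotR [x ⊗ y] (g ⊗ h) = [g x ⊗ h y]` -/
def dotR : s.TensorR →ₗ[k] K ⊗[k] K →ₗ[k] s.TensorR :=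
  BTensor.lift ((LinearMap.mul k (K ⊗[k] K)).flip.compr₂ s.projR) (fun a m n => by
    ext g h
    simpa [mul_assoc] using BTensor.proj_balanced (fun a : A => mulRight k (s.source a))
      (fun b : A => mulRight k (s.target b)) a (g * m) (h * n))

theorem dotL_proj (t u : K ⊗[k] K) : s.dotL (s.projL t) u = s.projL (t * u) := rfl

theorem dotR_proj (t u : K ⊗[k] K) : s.dotR (s.projR t) u = s.projR (u * t) := rfl

theorem mulLeft_comm (a b : A) (x : K) :
    mulLeft k (s.target b) (mulLeft k (s.source a) x) =
      mulLeft k (s.source a) (mulLeft k (s.target b) x) := by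
  simp only [LinearMap.mulLeft_apply, ← mul_assoc, s.commute]

theorem mulRight_comm (a b : A) (x : K) :
    mulRight k (s.source a) (mulRight k (s.target b) x) =
      mulRight k (s.target b) (mulRight k (s.source a) x) := by
  simp only [LinearMap.mulRight_apply, mul_assoc, s.commute]

/-- `ε ⊗ id : K ⊗_A K → A ⊗_A K ≅ K`, `x ⊗ y ↦ ε(x).y = source (ε x) * y` -/
def counitIdL (ε : K →ₗ[k] A)
    (hε : ∀ a b x, ε (s.source a * s.target b * x) = a * ε x * b) : s.TensorL →ₗ[k] K :=
  BTensor.lift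
    (LinearMap.mul' k K ∘ₗ TensorProduct.map (s.source.toLinearMap ∘ₗ ε) LinearMap.id)
    (fun b y z => by
      have := hε 1 b y
      rw [map_one, one_mul, one_mul] at this
      simp [this, mul_assoc])

/-- `id ⊗ ε : K ⊗_A K → K ⊗_A A ≅ K`, `x ⊗ y ↦ x.ε(y) = target (ε y) * x` -/
def idCounitL (ε : K →ₗ[k] A)
    (hε : ∀ a b x, ε (s.source a * s.target b * x) = a * ε x * b) : s.TensorL →ₗ[k] K :=
  BTensor.lift
    (LinearMap.mul' k K ∘ₗ TensorProduct.map (s.target ∘ₗ ε) LinearMap.id ∘ₗ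
      (TensorProduct.comm k K K).toLinearMap)
    (fun a y z => by
      have := hε a 1 z
      rw [s.target_one, mul_one, mul_one] at this
      simp [this, s.target_mul, mul_assoc])

/-- `ε ⊗ id : K ⊗_A K → A ⊗_A K ≅ K`, `x ⊗ y ↦ ε(x).y = y * target (ε x)` -/
def counitIdR (ε : K →ₗ[k] A)
    (hε : ∀ a b x, ε (x * s.source a * s.target b) = b * ε x * a) : s.TensorR →ₗ[k] K :=
  BTensor.lift
    (LinearMap.mul' k K ∘ₗ TensorProduct.map LinearMap.id (s.target ∘ₗ ε) ∘ₗ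
      (TensorProduct.comm k K K).toLinearMap)
    (fun a y z => by
      have := hε a 1 y
      rw [s.target_one, mul_one, one_mul] at this
      simp [this, s.target_mul, mul_assoc])

/-- `id ⊗ ε : K ⊗_A K → K ⊗_A A ≅ K`, `x ⊗ y ↦ x.ε(y) = x * source (ε y)` -/
def idCounitR (ε : K →ₗ[k] A)
    (hε : ∀ a b x, ε (x * s.source a * s.target b) = b * ε x * a) : s.TensorR →ₗ[k] K :=
  BTensor.lift
    (LinearMap.mul' k K ∘ₗ TensorProduct.map LinearMap.id (s.source.toLinearMap ∘ₗ ε))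
    (fun b y z => by
      have := hε 1 b z
      rw [map_one, mul_one, mul_one] at this
      simp [this, mul_assoc])

/-- `x ⊗ y ↦ τ x * y` on `K ⊗_A K` -/
def mulAntipodeL (τ : K →ₗ[k] K) (hτ : ∀ x y, τ (x * y) = τ y * τ x)
    (hst : ∀ a, τ (s.target a) = s.source a) : s.TensorL →ₗ[k] K :=
  BTensor.lift (LinearMap.mul' k K ∘ₗ τ.rTensor K) (fun a y z => by
    simp [hτ, hst, mul_assoc])

/-- `x ⊗ y ↦ x * τ y` on `K ⊗_A K` -/
def mulAntipodeR (τ : K →ₗ[k] K) (hτ : ∀ x y, τ (x * y) = τ y * τ x)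
    (hst : ∀ a, τ (s.target a) = s.source a) : s.TensorR →ₗ[k] K :=
  BTensor.lift (LinearMap.mul' k K ∘ₗ τ.lTensor K) (fun a y z => by
    simp [hτ, hst, mul_assoc])

variable {s} {K' : Type*} [Ring K'] [Algebra k K'] {s' : SourceTarget k A K'}

/-- `Ψ ⊗ Ψ : K ⊗_A K → K' ⊗_A K'` -/
def mapL (Ψ : K →ₐ[k] K') (hs : ∀ a, Ψ (s.source a) = s'.source a)
    (ht : ∀ a, Ψ (s.target a) = s'.target a) : s.TensorL →ₗ[k] s'.TensorL :=
  BTensor.lift (s'.projL ∘ₗ TensorProduct.map Ψ.toLinearMap Ψ.toLinearMap)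
    (fun a y z => by
      have h := BTensor.proj_balanced (fun b : A => mulLeft k (s'.target b))
        (fun a : A => mulLeft k (s'.source a)) a (Ψ y) (Ψ z)
      simpa [hs, ht] using h)

/-- `Ψ ⊗ Ψ : K ⊗_A K → K' ⊗_A K'` -/
def mapR (Ψ : K →ₐ[k] K') (hs : ∀ a, Ψ (s.source a) = s'.source a)
    (ht : ∀ a, Ψ (s.target a) = s'.target a) : s.TensorR →ₗ[k] s'.TensorR :=
  BTensor.lift (s'.projR ∘ₗ TensorProduct.map Ψ.toLinearMap Ψ.toLinearMap)
    (fun a y z => by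
      have h := BTensor.proj_balanced (fun a : A => mulRight k (s'.source a))
        (fun b : A => mulRight k (s'.target b)) a (Ψ y) (Ψ z)
      simpa [hs, ht] using h)

end SourceTarget

/-- A left bialgebroid with total algebra `K` over the base algebra `A`. -/
structure LeftBialgebroid (k A K : Type*) [Field k] [Ring A] [Algebra k A] [Ring K]
    [Algebra k K] where
  /-- source and target -/
  st : SourceTarget k A K
  comul : K →ₗ[k] st.TensorL
  counit : K →ₗ[k] A
  /-- `comul` is a map of bimodules -/
  comul_source : ∀ a x, comul (mulLeft k (st.source a) x) =
    BTensor.actLeft (mulLeft k (st.source a)) (fun b y => (st.mulLeft_comm a b y).symm) (comul x)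
  comul_target : ∀ b x, comul (mulLeft k (st.target b) x) =
    BTensor.actRight (mulLeft k (st.target b)) (fun a y => st.mulLeft_comm a b y) (comul x)
  /-- `counit` is a map of bimodules -/
  counit_bimodule : ∀ a b x, counit (st.source a * st.target b * x) = a * counit x * b
  /-- `(comul ⊗ id) ∘ comul = (id ⊗ comul) ∘ comul` in `K ⊗_A K ⊗_A K` -/
  coassoc : ∀ x,
    BTensor₃.mapLeft (l₂ := fun a => mulLeft k (st.source a)) st.mulLeft_comm
      comul (fun b => mulLeft k (st.target b)) comul_target (comul x) =
    BTensor₃.mapRight (r₁ := fun b => mulLeft k (st.target b)) st.mulLeft_comm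
      comul (fun a => mulLeft k (st.source a)) comul_source (comul x)
  /-- `(counit ⊗ id) ∘ comul = id` -/
  counit_left : ∀ x, st.counitIdL counit counit_bimodule (comul x) = x
  /-- `(id ⊗ counit) ∘ comul = id` -/
  counit_right : ∀ x, st.idCounitL counit counit_bimodule (comul x) = x
  /-- `x ⊗ (g ⊗ h) ↦ comul x (g ⊗ h)` factors through `K ⊗ (K ⊗_A K)` -/
  takeuchi : ∀ x a g h, st.dotL (comul x) (mulLeft k (st.target a) g ⊗ₜ h) =
    st.dotL (comul x) (g ⊗ₜ mulLeft k (st.source a) h)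
  /-- the factored map is a unital left action -/
  one_dot : ∀ t, BTensor.lift (st.dotL (comul 1)) (takeuchi 1) t = t
  mul_dot : ∀ x y t, BTensor.lift (st.dotL (comul (x * y))) (takeuchi (x * y)) t =
    BTensor.lift (st.dotL (comul x)) (takeuchi x)
      (BTensor.lift (st.dotL (comul y)) (takeuchi y) t)
  /-- `x ⊗ a ↦ counit (x * source a)` is a unital left action of `K` on `A` -/
  counit_one_source : ∀ a, counit (1 * st.source a) = a
  counit_mul_source : ∀ x y a,
    counit (x * y * st.source a) = counit (x * st.source (counit (y * st.source a)))

/-- A right bialgebroid with total algebra `K` over the base algebra `A`. -/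
structure RightBialgebroid (k A K : Type*) [Field k] [Ring A] [Algebra k A] [Ring K]
    [Algebra k K] where
  /-- source and target -/
  st : SourceTarget k A K
  comul : K →ₗ[k] st.TensorR
  counit : K →ₗ[k] A
  /-- `comul` is a map of bimodules -/
  comul_source : ∀ a x, comul (mulRight k (st.source a) x) =
    BTensor.actRight (mulRight k (st.source a)) (fun b y => st.mulRight_comm a b y) (comul x)
  comul_target : ∀ b x, comul (mulRight k (st.target b) x) =
    BTensor.actLeft (mulRight k (st.target b)) (fun a y => (st.mulRight_comm a b y).symm)
      (comul x)
  /-- `counit` is a map of bimodules -/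
  counit_bimodule : ∀ a b x, counit (x * st.source a * st.target b) = b * counit x * a
  /-- `(comul ⊗ id) ∘ comul = (id ⊗ comul) ∘ comul` in `K ⊗_A K ⊗_A K` -/
  coassoc : ∀ x,
    BTensor₃.mapLeft (l₂ := fun b => mulRight k (st.target b))
      (fun b a y => st.mulRight_comm a b y)
      comul (fun a => mulRight k (st.source a)) comul_source (comul x) =
    BTensor₃.mapRight (r₁ := fun a => mulRight k (st.source a))
      (fun b a y => st.mulRight_comm a b y)
      comul (fun b => mulRight k (st.target b)) comul_target (comul x)
  /-- `(counit ⊗ id) ∘ comul = id` -/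
  counit_left : ∀ x, st.counitIdR counit counit_bimodule (comul x) = x
  /-- `(id ⊗ counit) ∘ comul = id` -/
  counit_right : ∀ x, st.idCounitR counit counit_bimodule (comul x) = x
  /-- `(g ⊗ h) ⊗ x ↦ (g ⊗ h) comul x` factors through `(K ⊗_A K) ⊗ K` -/
  takeuchi : ∀ x a g h, st.dotR (comul x) (mulRight k (st.source a) g ⊗ₜ h) =
    st.dotR (comul x) (g ⊗ₜ mulRight k (st.target a) h)
  /-- the factored map is a unital right action -/
  dot_one : ∀ t, BTensor.lift (st.dotR (comul 1)) (takeuchi 1) t = t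
  dot_mul : ∀ x y t, BTensor.lift (st.dotR (comul (x * y))) (takeuchi (x * y)) t =
    BTensor.lift (st.dotR (comul y)) (takeuchi y)
      (BTensor.lift (st.dotR (comul x)) (takeuchi x) t)
  /-- `a ⊗ x ↦ counit (source a * x)` is a unital right action of `K` on `A` -/
  counit_source_one : ∀ a, counit (st.source a * 1) = a
  counit_source_mul : ∀ x y a,
    counit (st.source a * (x * y)) = counit (st.source (counit (st.source a * x)) * y)

variable {k A K L R : Type*} [Field k] [Ring A] [Algebra k A] [Ring K] [Algebra k K]
  [Ring L] [Algebra k L] [Ring R] [Algebra k R]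

namespace LeftBialgebroid

variable (D : LeftBialgebroid k A K)

theorem dotL_one (x : K) : D.st.dotL (D.comul x) (1 ⊗ₜ 1) = D.comul x := by
  generalize D.comul x = t
  obtain ⟨t, rfl⟩ := Submodule.mkQ_surjective _ t
  rw [SourceTarget.dotL_proj, ← Algebra.TensorProduct.one_def, mul_one]

theorem comul_mul (x y : K) : D.comul (x * y) =
    BTensor.lift (D.st.dotL (D.comul x)) (D.takeuchi x) (D.comul y) := by
  have h := D.mul_dot x y (D.st.projL (1 ⊗ₜ 1))
  simpa only [BTensor.lift_proj, dotL_one] using h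

theorem comul_one : D.comul 1 = D.st.projL (1 ⊗ₜ 1) := by
  rw [← D.one_dot (D.st.projL (1 ⊗ₜ 1)), BTensor.lift_proj, dotL_one]

theorem comul_mul_source (x u : K) (a : A) (hu : D.st.source a = u) :
    D.comul (mulRight k u x) = BTensor.actLeft (mulRight k u) (fun _ y => mulRight_mulLeft u _ y) (D.comul x) := by
  subst hu
  have h := D.comul_source a 1
  rw [LinearMap.mulLeft_apply, mul_one, comul_one, BTensor.actLeft_proj] at h
  rw [LinearMap.mulRight_apply, comul_mul, h, BTensor.lift_proj]
  generalize D.comul x = t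
  induction t using BTensor.induction with
  | h m n =>
    rw [SourceTarget.dotL_proj, BTensor.actLeft_proj]
    simp only [Algebra.TensorProduct.tmul_mul_tmul, LinearMap.mulLeft_apply,
      LinearMap.mulRight_apply, mul_one]
  | hadd s t hs ht => rw [map_add, LinearMap.add_apply, hs, ht, map_add]

theorem comul_mul_target (x u : K) (a : A) (hu : D.st.target a = u) :
    D.comul (mulRight k u x) = BTensor.actRight (mulRight k u) (fun _ y => mulRight_mulLeft u _ y) (D.comul x) := by
  subst hu
  have h := D.comul_target a 1
  rw [LinearMap.mulLeft_apply, mul_one, comul_one, BTensor.actRight_proj] at h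
  rw [LinearMap.mulRight_apply, comul_mul, h, BTensor.lift_proj]
  generalize D.comul x = t
  induction t using BTensor.induction with
  | h m n =>
    rw [SourceTarget.dotL_proj, BTensor.actRight_proj]
    simp only [Algebra.TensorProduct.tmul_mul_tmul, LinearMap.mulLeft_apply,
      LinearMap.mulRight_apply, mul_one]
  | hadd s t hs ht => rw [map_add, LinearMap.add_apply, hs, ht, map_add]

end LeftBialgebroid

namespace RightBialgebroid

variable (D : RightBialgebroid k A K)

theorem dotR_one (x : K) : D.st.dotR (D.comul x) (1 ⊗ₜ 1) = D.comul x := by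
  generalize D.comul x = t
  obtain ⟨t, rfl⟩ := Submodule.mkQ_surjective _ t
  rw [SourceTarget.dotR_proj, ← Algebra.TensorProduct.one_def, one_mul]

theorem comul_mul (x y : K) : D.comul (x * y) =
    BTensor.lift (D.st.dotR (D.comul y)) (D.takeuchi y) (D.comul x) := by
  have h := D.dot_mul x y (D.st.projR (1 ⊗ₜ 1))
  simpa only [BTensor.lift_proj, dotR_one] using h

theorem comul_one : D.comul 1 = D.st.projR (1 ⊗ₜ 1) := by
  rw [← D.dot_one (D.st.projR (1 ⊗ₜ 1)), BTensor.lift_proj, dotR_one]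

theorem comul_source_mul (x u : K) (a : A) (hu : D.st.source a = u) :
    D.comul (mulLeft k u x) = BTensor.actRight (mulLeft k u) (fun _ y => mulLeft_mulRight u _ y) (D.comul x) := by
  subst hu
  have h := D.comul_source a 1
  rw [LinearMap.mulRight_apply, one_mul, comul_one, BTensor.actRight_proj] at h
  rw [LinearMap.mulLeft_apply, comul_mul, h, BTensor.lift_proj]
  generalize D.comul x = t
  induction t using BTensor.induction with
  | h m n =>
    rw [SourceTarget.dotR_proj, BTensor.actRight_proj]
    simp only [Algebra.TensorProduct.tmul_mul_tmul, LinearMap.mulLeft_apply,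
      LinearMap.mulRight_apply, one_mul]
  | hadd s t hs ht => rw [map_add, LinearMap.add_apply, hs, ht, map_add]

theorem comul_target_mul (x u : K) (a : A) (hu : D.st.target a = u) :
    D.comul (mulLeft k u x) = BTensor.actLeft (mulLeft k u) (fun _ y => mulLeft_mulRight u _ y) (D.comul x) := by
  subst hu
  have h := D.comul_target a 1
  rw [LinearMap.mulRight_apply, one_mul, comul_one, BTensor.actLeft_proj] at h
  rw [LinearMap.mulLeft_apply, comul_mul, h, BTensor.lift_proj]
  generalize D.comul x = t
  induction t using BTensor.induction with
  | h m n =>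
    rw [SourceTarget.dotR_proj, BTensor.actLeft_proj]
    simp only [Algebra.TensorProduct.tmul_mul_tmul, LinearMap.mulLeft_apply,
      LinearMap.mulRight_apply, one_mul]
  | hadd s t hs ht => rw [map_add, LinearMap.add_apply, hs, ht, map_add]

end RightBialgebroid

/-- A symmetric Hopf algebroid: a left `L`-bialgebroid and a right `R`-bialgebroid with the same
total algebra `K`, and an antipode. The case `R = Lᵐᵒᵖ` is that of a symmetric Hopf algebroid over
the algebra `L`; here `R` is any algebra playing the role of the opposite of `L`. -/
structure SymmetricHopfAlgebroid (k L R K : Type*) [Field k] [Ring L] [Algebra k L] [Ring R]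
    [Algebra k R] [Ring K] [Algebra k K] where
  left : LeftBialgebroid k L K
  right : RightBialgebroid k R K
  antipode : K →ₗ[k] K
  antipode_one : antipode 1 = 1
  antipode_mul : ∀ x y, antipode (x * y) = antipode y * antipode x
  source_counit_target_right : ∀ b, left.st.source (left.counit (right.st.target b)) = right.st.target b
  target_counit_source_right : ∀ b, left.st.target (left.counit (right.st.source b)) = right.st.source b
  source_counit_target_left : ∀ a, right.st.source (right.counit (left.st.target a)) = left.st.target a
  target_counit_source_left : ∀ a, right.st.target (right.counit (left.st.source a)) = left.st.source a
  /-- `(Δ_R ⊗_L id) ∘ Δ_L = (id ⊗_R Δ_L) ∘ Δ_R` in `K ⊗_R K ⊗_L K` -/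
  mixed_coassoc₁ : ∀ x,
    BTensor₃.mapLeft (l₁ := fun b => mulRight k (right.st.target b))
      (r₂ := fun a => mulLeft k (left.st.target a)) (l₂ := fun a => mulLeft k (left.st.source a))
      (fun _ _ y => mulLeft_mulRight _ _ y)
      right.comul (fun a => mulLeft k (left.st.target a))
      (fun a y => right.comul_source_mul y _ _ (source_counit_target_left a)) (left.comul x) =
    BTensor₃.mapRight (r₁ := fun b => mulRight k (right.st.source b))
      (l₁ := fun b => mulRight k (right.st.target b)) (r₂ := fun a => mulLeft k (left.st.target a))
      (fun _ _ y => mulLeft_mulRight _ _ y)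
      left.comul (fun b => mulRight k (right.st.target b))
      (fun b y => left.comul_mul_source y _ _ (source_counit_target_right b)) (right.comul x)
  /-- `(Δ_L ⊗_R id) ∘ Δ_R = (id ⊗_L Δ_R) ∘ Δ_L` in `K ⊗_L K ⊗_R K` -/
  mixed_coassoc₂ : ∀ x,
    BTensor₃.mapLeft (l₁ := fun a => mulLeft k (left.st.source a))
      (r₂ := fun b => mulRight k (right.st.source b)) (l₂ := fun b => mulRight k (right.st.target b))
      (fun _ _ y => mulRight_mulLeft _ _ y)
      left.comul (fun b => mulRight k (right.st.source b))
      (fun b y => left.comul_mul_target y _ _ (target_counit_source_right b)) (right.comul x) =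
    BTensor₃.mapRight (r₁ := fun a => mulLeft k (left.st.target a))
      (l₁ := fun a => mulLeft k (left.st.source a)) (r₂ := fun b => mulRight k (right.st.source b))
      (fun _ _ y => mulRight_mulLeft _ _ y)
      right.comul (fun a => mulLeft k (left.st.source a))
      (fun a y => right.comul_target_mul y _ _ (target_counit_source_left a)) (left.comul x)
  antipode_target_left : ∀ a, antipode (left.st.target a) = left.st.source a
  antipode_target_right : ∀ b, antipode (right.st.target b) = right.st.source b
  /-- `μ ∘ (τ ⊗ id) ∘ Δ_L = α_R ∘ ε_R` -/
  mul_antipode_left : ∀ x,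
    left.st.mulAntipodeL antipode antipode_mul antipode_target_left (left.comul x) =
      right.st.source (right.counit x)
  /-- `μ ∘ (id ⊗ τ) ∘ Δ_R = α_L ∘ ε_L` -/
  mul_antipode_right : ∀ x,
    right.st.mulAntipodeR antipode antipode_mul antipode_target_right (right.comul x) =
      left.st.source (left.counit x)

/-- An isomorphism of total algebras that identifies two symmetric Hopf algebroids over the same
pair of base algebras. -/
structure SymmetricHopfAlgebroid.IsIso {K' : Type*} [Ring K'] [Algebra k K']
    (D : SymmetricHopfAlgebroid k L R K) (D' : SymmetricHopfAlgebroid k L R K')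
    (Ψ : K ≃ₐ[k] K') : Prop where
  source_left : ∀ a, Ψ (D.left.st.source a) = D'.left.st.source a
  target_left : ∀ a, Ψ (D.left.st.target a) = D'.left.st.target a
  source_right : ∀ b, Ψ (D.right.st.source b) = D'.right.st.source b
  target_right : ∀ b, Ψ (D.right.st.target b) = D'.right.st.target b
  counit_left : ∀ x, D'.left.counit (Ψ x) = D.left.counit x
  counit_right : ∀ x, D'.right.counit (Ψ x) = D.right.counit x
  /-- `(Ψ ⊗_L Ψ) ∘ Δ_L = Δ'_L ∘ Ψ` -/
  comul_left : ∀ x,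
    SourceTarget.mapL (Ψ : K →ₐ[k] K') source_left target_left (D.left.comul x) =
      D'.left.comul (Ψ x)
  /-- `(Ψ ⊗_R Ψ) ∘ Δ_R = Δ'_R ∘ Ψ` -/
  comul_right : ∀ x,
    SourceTarget.mapR (Ψ : K →ₐ[k] K') source_right target_right (D.right.comul x) =
      D'.right.comul (Ψ x)
  antipode : ∀ x, Ψ (D.antipode x) = D'.antipode (Ψ x)

end Bialgebroid

end ScalarExtension

end

open ScalarExtension Coalgebra HopfAlgebra

noncomputable section

set_option synthInstance.maxSize 100000
set_option synthInstance.maxHeartbeats 400000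

namespace ScalarExtension

open Coalgebra HopfAlgebra

/-! ### Sweedler sums -/

section Sweedler

/-! Everything takes place in one algebra `K` isomorphic to L ♯ H, spanned by products α(x)ι(f),
where α(x) = x ♯ 1 and ι(f) = 1 ♯ f; below, ι is suppressed. Two more maps L → K matter: the target
β(x) = x₀ ♯ x₁ of the left bialgebroid and γ(x) = S²x₁ · x₀, for which γ ∘ φ⁻¹ is the source of the
right one. Braided commutativity of L makes α and β commute, and its Yetter-Drinfeld condition gives
f β(x) = β(f₂ ▷ x) f₁.

As S need not be invertible, the link between β and γ uses R. Carried to L along φ, the action of R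
becomes a right action ◁ with h ▷ x = x ◁ Sh, which plays the part of ▷ precomposed with an inverse
of S. Put θ(x) = S²x₁ ▷ x₀ and η(x) = x₀ ◁ x₁. Then γ = β ∘ θ (`sourceR_eq`). The Yetter-Drinfeld
condition of R gives θ(x ◁ h) = θ(x) ◁ S²h (`theta_ract`), from which θ ∘ η = id (`theta_eta`), so β
= γ ∘ η. Hence β and γ have the same image, γ commutes with α, and γ(x) f = f₁ γ(x ◁ f₂)
(`sourceR_mul_embH`). Since moreover α(x) = S(x₁) γ(x₀) (`emb_eq_sw_sourceR`), the products f γ(x)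
also span `K`; this is the presentation H ♯ R in disguise.

With these relations each axiom is a short Sweedler computation in whichever spanning family, α(x)f
or f γ(x), makes the maps simple. Both coproducts are given by x f₁ ⊗ f₂ and differ only in the
relations imposed on the tensor product, so all four coassociativity laws reduce to that of H. The
Takeuchi conditions are the rules for moving β or γ past elements of H. The antipode sends α to γ
and f to Sf; it is antimultiplicative by the rule for γ(x) Sf.

The map Ψ sends x to λ(φ x) and fixes H. It is multiplicative because H ♯ R satisfies mirror
relations, braided commutativity of R making λ an antihomomorphism; it sends γ(x) to 1 ♯ φ(x), which
produces the inverse. Since the construction works for any `K` with an isomorphism `E` from L ♯ H,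
using the identity and Ψ gives two symmetric Hopf algebroids that Ψ identifies (`isIso`). It then
remains to read the structure maps on f ♯ φ(x) = f γ(x). -/

/-- Linearity of an unbundled map. -/
class IsLin (k : Type*) {M N : Type*} [Semiring k] [AddCommMonoid M] [Module k M]
    [AddCommMonoid N] [Module k N] (f : M → N) : Prop where
  map_add : ∀ x y, f (x + y) = f x + f y
  map_smul : ∀ (c : k) x, f (c • x) = c • f x

variable {k M N P Q M' N' F : Type*} [Field k] [AddCommMonoid M] [Module k M] [AddCommMonoid N]
  [Module k N] [AddCommMonoid P] [AddCommMonoid Q]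
  [AddCommMonoid M'] [Module k M'] [AddCommMonoid N'] [Module k N']

/-- The sum of `f a b` over a chosen decomposition of `t` into a sum of tensors `a ⊗ b`. -/
def sw (t : M ⊗[k] N) (f : M → N → P) : P :=
  ∑ p ∈ (TensorProduct.exists_finset t).choose, f p.1 p.2

theorem map_sw [FunLike F P Q] [AddMonoidHomClass F P Q] (g : F) (t : M ⊗[k] N)
    (f : M → N → P) : g (sw t f) = sw t fun a b => g (f a b) :=
  map_sum g _ _

theorem mul_sw {K : Type*} [Ring K] (c : K) (t : M ⊗[k] N) (f : M → N → K) :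
    c * sw t f = sw t fun a b => c * f a b :=
  Finset.mul_sum _ _ _

theorem sw_mul {K : Type*} [Ring K] (c : K) (t : M ⊗[k] N) (f : M → N → K) :
    sw t f * c = sw t fun a b => f a b * c :=
  Finset.sum_mul _ _ _

theorem sw_comm (t : M ⊗[k] N) (u : M' ⊗[k] N') (f : M → N → M' → N' → P) :
    (sw t fun a b => sw u fun c d => f a b c d) = sw u fun c d => sw t fun a b => f a b c d :=
  Finset.sum_comm

theorem sw_induction {p : P → Prop} (h₀ : p 0) (hadd : ∀ s t, p s → p t → p (s + t))
    (t : M ⊗[k] N) (f : M → N → P) (h : ∀ a b, p (f a b)) : p (sw t f) :=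
  Finset.sum_induction _ p hadd h₀ fun _ _ => h _ _

variable [Module k P] [Module k Q]

theorem smul_sw (c : k) (t : M ⊗[k] N) (f : M → N → P) :
    c • sw t f = sw t fun a b => c • f a b :=
  Finset.smul_sum

theorem tmul_sw (c : Q) (t : M ⊗[k] N) (f : M → N → P) :
    c ⊗ₜ[k] sw t f = sw t fun a b => c ⊗ₜ[k] f a b :=
  TensorProduct.tmul_sum _ _ _

theorem sw_tmul_right (c : Q) (t : M ⊗[k] N) (f : M → N → P) :
    sw t f ⊗ₜ[k] c = sw t fun a b => f a b ⊗ₜ[k] c :=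
  TensorProduct.sum_tmul _ _ _

theorem map_sw_apply (g : P →ₗ[k] Q →ₗ[k] M') (t : M ⊗[k] N) (f : M → N → P) (c : Q) :
    g (sw t f) c = sw t fun a b => g (f a b) c := by
  simp only [sw, map_sum, LinearMap.sum_apply]

theorem sw_apply (t : M ⊗[k] N) (f : M → N → P →ₗ[k] Q) (c : P) :
    (sw t f) c = sw t fun a b => f a b c := by
  simp only [sw, LinearMap.sum_apply]

/-- This and the following instances certify the multilinearity of Sweedler summands by instance
search. `sw` accepts any function; linearity is needed only when the tensor itself is rewritten. -/
instance isLin_id : IsLin k fun x : M => x := ⟨fun _ _ => rfl, fun _ _ => rfl⟩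

instance isLin_coe [FunLike F M N] [LinearMapClass F k M N] (g : F) : IsLin k (g : M → N) :=
  ⟨map_add g, map_smul g⟩

instance isLin_coe_apply [FunLike F N P] [LinearMapClass F k N P] (g : F) (f : M → N)
    [IsLin k f] : IsLin k fun x => g (f x) :=
  ⟨fun x y => by rw [IsLin.map_add k (f := f), map_add],
    fun c x => by rw [IsLin.map_smul (k := k) (f := f), map_smul]⟩

instance isLin_bilin (g : N →ₗ[k] P →ₗ[k] Q) (f : M → N) (c : P) [IsLin k f] :
    IsLin k fun x => g (f x) c :=
  ⟨fun x y => by rw [IsLin.map_add k (f := f), map_add, LinearMap.add_apply],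
    fun c x => by rw [IsLin.map_smul (k := k) (f := f), map_smul, LinearMap.smul_apply]⟩

instance isLin_mul_const {K : Type*} [Ring K] [Algebra k K] (f : M → K) (c : K) [IsLin k f] :
    IsLin k fun x => f x * c :=
  ⟨fun x y => by rw [IsLin.map_add k (f := f), add_mul],
    fun c x => by rw [IsLin.map_smul (k := k) (f := f), smul_mul_assoc]⟩

instance isLin_const_mul {K : Type*} [Ring K] [Algebra k K] (f : M → K) (c : K) [IsLin k f] :
    IsLin k fun x => c * f x :=
  ⟨fun x y => by rw [IsLin.map_add k (f := f), mul_add],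
    fun c x => by rw [IsLin.map_smul (k := k) (f := f), mul_smul_comm]⟩

instance isLin_tmul_const (f : M → N) (c : P) [IsLin k f] : IsLin k fun x => f x ⊗ₜ[k] c :=
  ⟨fun x y => by rw [IsLin.map_add k (f := f), TensorProduct.add_tmul],
    fun c x => by rw [IsLin.map_smul (k := k) (f := f), TensorProduct.smul_tmul']⟩

instance isLin_const_tmul (f : M → N) (c : P) [IsLin k f] : IsLin k fun x => c ⊗ₜ[k] f x :=
  ⟨fun x y => by rw [IsLin.map_add k (f := f), TensorProduct.tmul_add],
    fun c x => by rw [IsLin.map_smul (k := k) (f := f), TensorProduct.tmul_smul]⟩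

instance isLin_mul {K : Type*} [Ring K] [Algebra k K] (c : K) : IsLin k (HMul.hMul c) :=
  isLin_const_mul (fun x => x) c

instance isLin_tmul (c : P) : IsLin k (TensorProduct.tmul k (N := M) c) :=
  isLin_const_tmul (fun x => x) c

instance isLin_smul_const (f : M → k) (c : P) [IsLin k f] : IsLin k fun x => f x • c :=
  ⟨fun x y => by rw [IsLin.map_add k (f := f), add_smul],
    fun c x => by rw [IsLin.map_smul (k := k) (f := f), smul_assoc]⟩

instance isLin_const_smul (f : M → P) (c : k) [IsLin k f] : IsLin k fun x => c • f x :=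
  ⟨fun x y => by rw [IsLin.map_add k (f := f), smul_add],
    fun d x => by rw [IsLin.map_smul (k := k) (f := f), smul_comm]⟩

instance isLin_const_smul_algebra {K : Type*} [Ring K] [Algebra k K] (f : M → K) (c : k)
    [IsLin k f] : IsLin k fun x => c • f x := isLin_const_smul f c

instance isLin_smul_algebra {K : Type*} [Ring K] [Algebra k K] (c : k) :
    IsLin k (HSMul.hSMul c : K → K) :=
  isLin_const_smul (fun x => x) c

instance isLin_smul_const_algebra {K : Type*} [Ring K] [Algebra k K] (f : M → k) (c : K)
    [IsLin k f] : IsLin k fun x => f x • c := isLin_smul_const f c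

instance isLin_sw_fun (t : M ⊗[k] N) (f : Q → M → N → P) [∀ a b, IsLin k fun x => f x a b] :
    IsLin k fun x => sw t fun a b => f x a b :=
  ⟨fun x y => by
    simp only [sw, fun a b => IsLin.map_add k (f := fun x => f x a b) x y, Finset.sum_add_distrib],
    fun c x => by
    simp only [sw, fun a b => IsLin.map_smul (k := k) (f := fun x => f x a b) c x,
      Finset.smul_sum]⟩

/-- The linear map with underlying function `f`. -/
def linMap (f : M → N) [h : IsLin k f] : M →ₗ[k] N := ⟨⟨f, h.map_add⟩, h.map_smul⟩

theorem linMap_apply (f : M → N) [IsLin k f] (x : M) : linMap (k := k) f x = f x := rfl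

/-- The bilinear map with underlying function `f`. -/
def linMap₂ (f : M → N → P) [h₁ : ∀ b, IsLin k fun a => f a b]
    [h₂ : ∀ a, IsLin k fun b => f a b] : M →ₗ[k] N →ₗ[k] P :=
  LinearMap.mk₂ k f (fun x y b => (h₁ b).map_add x y) (fun c x b => (h₁ b).map_smul c x)
    (fun a => (h₂ a).map_add) (fun c a => (h₂ a).map_smul c)

theorem linMap₂_apply (f : M → N → P) [∀ b, IsLin k fun a => f a b]
    [∀ a, IsLin k fun b => f a b] (a : M) (b : N) : linMap₂ (k := k) f a b = f a b := rfl

/-- For a bilinear summand the sum does not depend on the chosen decomposition. -/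
theorem sw_eq_lift (t : M ⊗[k] N) (f : M → N → P) [∀ b, IsLin k fun a => f a b]
    [∀ a, IsLin k fun b => f a b] : sw t f = TensorProduct.lift (linMap₂ f) t := by
  conv_rhs => rw [(TensorProduct.exists_finset t).choose_spec]
  simp [sw, linMap₂_apply]

instance isLin_sw_tensor (t : Q → M ⊗[k] N) (f : M → N → P) [IsLin k t]
    [∀ b, IsLin k fun a => f a b] [∀ a, IsLin k fun b => f a b] :
    IsLin k fun x => sw (t x) fun a b => f a b :=
  ⟨fun x y => by simp only [sw_eq_lift, IsLin.map_add k (f := t), map_add],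
    fun c x => by simp only [sw_eq_lift, IsLin.map_smul (k := k) (f := t), map_smul]⟩

section bilinear

variable (f : M → N → P) [∀ b, IsLin k fun a => f a b] [∀ a, IsLin k fun b => f a b]

theorem sw_tmul (m : M) (n : N) : sw (m ⊗ₜ[k] n) f = f m n := by simp [sw_eq_lift, linMap₂_apply]

theorem sw_sw (t : M' ⊗[k] N') (g : M' → N' → M ⊗[k] N) :
    sw (sw t g) f = sw t fun a b => sw (g a b) f := by
  simp only [sw_eq_lift (f := f), map_sw]

theorem sw_map (t : M' ⊗[k] N') (g : M' →ₗ[k] M) (h : N' →ₗ[k] N) :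
    sw (TensorProduct.map g h t) f = sw t fun a b => f (g a) (h b) := by
  rw [sw_eq_lift]
  conv_lhs => rw [(TensorProduct.exists_finset t).choose_spec]
  simp [sw, linMap₂_apply]

theorem sw_comm_tensor (t : N ⊗[k] M) :
    sw (TensorProduct.comm k N M t) f = sw t fun a b => f b a := by
  rw [sw_eq_lift]
  conv_lhs => rw [(TensorProduct.exists_finset t).choose_spec]
  simp [sw, linMap₂_apply]

end bilinear

theorem sw_tmul_self (t : M ⊗[k] N) : (sw t fun a b => a ⊗ₜ[k] b) = t :=
  (TensorProduct.exists_finset t).choose_spec.symm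

theorem lift_eq_sw (g : M →ₗ[k] N →ₗ[k] P) (t : M ⊗[k] N) :
    TensorProduct.lift g t = sw t fun a b => g a b := by
  conv_lhs => rw [← sw_tmul_self t, map_sw]
  rfl

theorem map_eq_sw (g : M →ₗ[k] M') (h : N →ₗ[k] N') (t : M ⊗[k] N) :
    TensorProduct.map g h t = sw t fun a b => g a ⊗ₜ h b := by
  conv_lhs => rw [← sw_tmul_self t, map_sw]
  rfl

theorem map₂_eq_sw (g : M →ₗ[k] M' →ₗ[k] P) (h : N →ₗ[k] N' →ₗ[k] Q) (t : M ⊗[k] N)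
    (u : M' ⊗[k] N') : TensorProduct.map₂ g h t u =
      sw t fun a b => sw u fun c d => g a c ⊗ₜ h b d := by
  conv_lhs => rw [← sw_tmul_self t, ← sw_tmul_self u, map_sw_apply]
  simp only [map_sw, TensorProduct.map₂_apply_tmul, TensorProduct.map_tmul]

theorem sw_assoc (t : (M ⊗[k] N) ⊗[k] Q) (f : M → N → Q → P)
    [∀ b c, IsLin k fun a => f a b c] [∀ a c, IsLin k fun b => f a b c]
    [∀ a b, IsLin k fun c => f a b c] :
    (sw (TensorProduct.assoc k M N Q t) fun a s => sw s fun b c => f a b c) =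
      sw t fun s c => sw s fun a b => f a b c := by
  rw [← sw_tmul_self t]
  simp only [map_sw, sw_sw]
  congr 1
  funext s c
  conv_lhs => rw [← sw_tmul_self s, sw_tmul_right, map_sw, sw_sw]
  conv_rhs => rw [sw_tmul]
  simp only [TensorProduct.assoc_tmul, sw_tmul]

/-- A common form for the coassociativity of H and of the coactions on L and R. -/
theorem sw_of_assoc (g : M →ₗ[k] M' ⊗[k] P) (h : N →ₗ[k] P ⊗[k] N') (t : M ⊗[k] N')
    (u : M' ⊗[k] N)
    (e : TensorProduct.assoc k M' P N' (g.rTensor N' t) = h.lTensor M' u) (f : M' → P → N' → Q)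
    [∀ b c, IsLin k fun a => f a b c] [∀ a c, IsLin k fun b => f a b c]
    [∀ a b, IsLin k fun c => f a b c] :
    (sw t fun a c => sw (g a) fun a b => f a b c) = sw u fun a b => sw (h b) fun b c => f a b c := by
  have h₁ := sw_assoc (g.rTensor N' t) f
  rw [e, LinearMap.rTensor, LinearMap.lTensor, sw_map, sw_map] at h₁
  exact h₁.symm

end Sweedler

/-! ### Sweedler calculus in a Hopf algebra -/

section Hopf

variable {k H P : Type*} [Field k] [Ring H] [AddCommMonoid P] [Module k P]

local notation "δ" => Coalgebra.comul (R := k) (A := H)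
local notation "ε" => Coalgebra.counit (R := k) (A := H)
local notation "𝑺" => HopfAlgebra.antipode k (A := H)

section Bialgebra

variable [Bialgebra k H]

theorem sw_coassoc (h : H) (f : H → H → H → P)
    [∀ b c, IsLin k fun a => f a b c] [∀ a c, IsLin k fun b => f a b c]
    [∀ a b, IsLin k fun c => f a b c] :
    (sw (δ h) fun a c => sw (δ a) fun a b => f a b c) =
      sw (δ h) fun a b => sw (δ b) fun b c => f a b c :=
  sw_of_assoc _ _ _ _ (Coalgebra.coassoc_apply h) f

theorem sw_counit_smul (h : H) (f : H → P) [IsLin k f] :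
    (sw (δ h) fun a b => ε a • f b) = f h := by
  have e := Coalgebra.rTensor_counit_comul (R := k) h
  rw [LinearMap.rTensor, map_eq_sw] at e
  have := congrArg (fun t => sw t fun a b => a • f b) e
  simpa only [sw_sw, sw_tmul, LinearMap.id_apply, one_smul] using this

theorem sw_counit_smul_right (h : H) (f : H → P) [IsLin k f] :
    (sw (δ h) fun a b => ε b • f a) = f h := by
  have e := Coalgebra.lTensor_counit_comul (R := k) h
  rw [LinearMap.lTensor, map_eq_sw] at e
  have := congrArg (fun t => sw t fun a b => b • f a) e
  simpa only [sw_sw, sw_tmul, LinearMap.id_apply, one_smul] using this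

theorem sw_comul_mul (g h : H) (f : H → H → P) [∀ b, IsLin k fun a => f a b]
    [∀ a, IsLin k fun b => f a b] :
    sw (δ (g * h)) f = sw (δ g) fun a b => sw (δ h) fun c d => f (a * c) (b * d) := by
  rw [Bialgebra.comul_mul]
  conv_lhs => rw [← sw_tmul_self (δ g), ← sw_tmul_self (δ h)]
  simp only [sw_mul, mul_sw, sw_sw, Algebra.TensorProduct.tmul_mul_tmul, sw_tmul]
  exact sw_comm _ _ _

theorem sw_comul_one (f : H → H → P) [∀ b, IsLin k fun a => f a b]
    [∀ a, IsLin k fun b => f a b] : sw (δ 1) f = f 1 1 := by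
  rw [Bialgebra.comul_one, Algebra.TensorProduct.one_def, sw_tmul]

end Bialgebra

variable [HopfAlgebra k H]

theorem sw_antipode_mul (h : H) (f : H → P) [hf : IsLin k f] :
    (sw (δ h) fun a b => f (𝑺 a * b)) = ε h • f 1 := by
  have e := HopfAlgebra.mul_antipode_rTensor_comul_apply (R := k) h
  rw [LinearMap.rTensor, map_eq_sw, map_sw, Algebra.algebraMap_eq_smul_one] at e
  rw [← hf.map_smul, ← e]
  exact (map_sw (⟨⟨f, hf.map_add⟩, hf.map_smul⟩ : H →ₗ[k] P) _ _).symm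

theorem sw_mul_antipode (h : H) (f : H → P) [hf : IsLin k f] :
    (sw (δ h) fun a b => f (a * 𝑺 b)) = ε h • f 1 := by
  have e := HopfAlgebra.mul_antipode_lTensor_comul_apply (R := k) h
  rw [LinearMap.lTensor, map_eq_sw, map_sw, Algebra.algebraMap_eq_smul_one] at e
  rw [← hf.map_smul, ← e]
  exact (map_sw (⟨⟨f, hf.map_add⟩, hf.map_smul⟩ : H →ₗ[k] P) _ _).symm

section cancel

variable (h : H) (f : H → H → P) [∀ b, IsLin k fun a => f a b] [∀ a, IsLin k fun b => f a b]

theorem sw_cancel_right_antipode_mul :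
    (sw (δ h) fun a b => sw (δ b) fun c d => f a (𝑺 c * d)) = f h 1 := by
  simp only [fun a b => sw_antipode_mul (k := k) b (f a)]
  exact sw_counit_smul_right h fun a => f a 1

theorem sw_cancel_right_mul_antipode :
    (sw (δ h) fun a b => sw (δ b) fun c d => f a (c * 𝑺 d)) = f h 1 := by
  simp only [fun a b => sw_mul_antipode (k := k) b (f a)]
  exact sw_counit_smul_right h fun a => f a 1

theorem sw_cancel_left_antipode_mul :
    (sw (δ h) fun a b => sw (δ a) fun c d => f (𝑺 c * d) b) = f 1 h := by
  simp only [fun a b => sw_antipode_mul (k := k) a fun c => f c b]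
  exact sw_counit_smul h fun a => f 1 a

theorem sw_cancel_left_mul_antipode :
    (sw (δ h) fun a b => sw (δ a) fun c d => f (c * 𝑺 d) b) = f 1 h := by
  simp only [fun a b => sw_mul_antipode (k := k) a fun c => f c b]
  exact sw_counit_smul h fun a => f 1 a

end cancel

/-- Uniqueness of convolution inverses in Hom(H, H ⊗ H): the right-hand side is a left inverse of Δ,
and Δ ∘ S is a right inverse because Δ is multiplicative. -/
theorem comul_antipode (h : H) : δ (𝑺 h) = sw (δ h) fun a b => 𝑺 b ⊗ₜ[k] 𝑺 a := by
  -- The left inverse property: S(h₂)h₃ ⊗ S(h₁)h₄ collapses from the inside out.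
  have inv : ∀ h : H, (sw (δ h) fun a b => (sw (δ a) fun c d => 𝑺 d ⊗ₜ[k] 𝑺 c) * δ b) =
      ε h • (1 : H ⊗[k] H) := by
    intro h
    calc _ = sw (δ h) fun a b => sw (δ a) fun c d => sw (δ b) fun e f =>
          (𝑺 d * e) ⊗ₜ[k] (𝑺 c * f) := by
          congr! 3 with a b
          conv_lhs => rw [← sw_tmul_self (δ b)]
          simp only [sw_mul, mul_sw, Algebra.TensorProduct.tmul_mul_tmul]
          exact sw_comm _ _ _
      _ = sw (δ h) fun a b => sw (δ b) fun c d => sw (δ d) fun e f =>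
          (𝑺 c * e) ⊗ₜ[k] (𝑺 a * f) := by rw [sw_coassoc]
      _ = sw (δ h) fun a b => sw (δ b) fun c d => sw (δ c) fun e f =>
          (𝑺 e * f) ⊗ₜ[k] (𝑺 a * d) := by
          congr! 3 with a b
          rw [sw_coassoc]
      _ = sw (δ h) fun a b => 1 ⊗ₜ[k] (𝑺 a * b) := by
          congr! 3 with a b
          rw [sw_cancel_left_antipode_mul (f := fun x y => x ⊗ₜ[k] (𝑺 a * y))]
      _ = _ := by rw [sw_antipode_mul (f := fun x => (1 : H) ⊗ₜ[k] x)]; rfl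
  calc δ (𝑺 h) = sw (δ h) fun a b => (ε a • (1 : H ⊗[k] H)) * δ (𝑺 b) := by
        simp only [smul_mul_assoc, one_mul]
        rw [sw_counit_smul (f := fun b => δ (𝑺 b))]
    _ = sw (δ h) fun a b => sw (δ a) fun a c => (sw (δ a) fun c d => 𝑺 d ⊗ₜ[k] 𝑺 c) *
          δ (c * 𝑺 b) := by
        simp only [← inv, sw_mul, mul_assoc, Bialgebra.comul_mul]
    _ = _ := by
        rw [sw_coassoc, sw_cancel_right_mul_antipode
          (f := fun a b => (sw (δ a) fun c d => 𝑺 d ⊗ₜ[k] 𝑺 c) * δ b), Bialgebra.comul_one, mul_one]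

theorem sw_comul_antipode (h : H) (f : H → H → P) [∀ b, IsLin k fun a => f a b]
    [∀ a, IsLin k fun b => f a b] :
    sw (δ (𝑺 h)) f = sw (δ h) fun a b => f (𝑺 b) (𝑺 a) := by
  rw [comul_antipode, sw_sw]
  simp only [sw_tmul]

end Hopf

/-! ### Yetter-Drinfeld axioms as Sweedler identities -/

section YetterDrinfeldSweedler

variable {k H L R P : Type*} [Field k] [Ring H] [Ring L] [Algebra k L] [Ring R] [Algebra k R]
  [AddCommMonoid P] [Module k P]

local notation "δ" => Coalgebra.comul (R := k) (A := H)
local notation "ε" => Coalgebra.counit (R := k) (A := H)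
local notation "𝑺" => HopfAlgebra.antipode k (A := H)

section Left

variable [Bialgebra k H] (D : LRYetterDrinfeldAlgebra k H L)

namespace LRYetterDrinfeldAlgebra

theorem sw_coact_coassoc (x : L) (f : L → H → H → P) [∀ b c, IsLin k fun a => f a b c]
    [∀ a c, IsLin k fun b => f a b c] [∀ a b, IsLin k fun c => f a b c] :
    (sw (D.coact x) fun a c => sw (D.coact a) fun a b => f a b c) =
      sw (D.coact x) fun a b => sw (δ b) fun b c => f a b c :=
  sw_of_assoc _ _ _ _ (D.coact_coassoc x) f

theorem sw_coact_counit (x : L) (f : L → P) [hf : IsLin k f] :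
    (sw (D.coact x) fun a b => ε b • f a) = f x := by
  have e := D.coact_counit x
  rw [LinearMap.lTensor, map_eq_sw, map_sw] at e
  have := congrArg (linMap (k := k) f) e
  simpa only [map_sw, TensorProduct.rid_tmul, map_smul, linMap_apply, LinearMap.id_apply]
    using this

theorem sw_coact_mul (a b : L) (f : L → H → P) [∀ b, IsLin k fun a => f a b]
    [∀ a, IsLin k fun b => f a b] :
    sw (D.coact (a * b)) f =
      sw (D.coact a) fun u v => sw (D.coact b) fun u' v' => f (u * u') (v' * v) := by
  rw [D.coact_mul, map₂_eq_sw]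
  simp only [sw_sw, sw_tmul, LinearMap.mul_apply', LinearMap.flip_apply]

theorem sw_coact_one (f : L → H → P) [∀ b, IsLin k fun a => f a b]
    [∀ a, IsLin k fun b => f a b] : sw (D.coact 1) f = f 1 1 := by
  rw [D.coact_one, sw_tmul]

theorem sw_yetterDrinfeld (h : H) (a : L) (f : L → H → P) [∀ b, IsLin k fun a => f a b]
    [∀ a, IsLin k fun b => f a b] :
    (sw (δ h) fun p q => sw (D.coact a) fun u v => f (D.act p u) (q * v)) =
      sw (δ h) fun p q => sw (D.coact (D.act q a)) fun u v => f u (v * p) := by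
  have e := D.yetterDrinfeld h a
  rw [map₂_eq_sw, map_eq_sw, sw_comm_tensor, map_sw] at e
  have := congrArg (fun t => sw t f) e
  simp only [sw_sw, sw_tmul, LinearMap.mul_apply'] at this
  rw [this]
  congr! 3 with p q
  simp only [LinearMap.comp_apply, LinearMap.flip_apply, LinearMap.mul'_apply]
  conv_lhs => rw [← sw_tmul_self (D.coact (D.act q a))]
  simp only [sw_mul, sw_sw, AlgHom.toLinearMap_apply, Algebra.TensorProduct.includeRight_apply,
    Algebra.TensorProduct.tmul_mul_tmul, mul_one, sw_tmul]

theorem BraidedCommutative.sw_eq {D : LRYetterDrinfeldAlgebra k H L} (hD : D.BraidedCommutative)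
    (a x : L) : (sw (D.coact x) fun u v => u * D.act v a) = a * x := by
  rw [← hD, LinearMap.lTensor, map_eq_sw, map_sw]
  rfl

end LRYetterDrinfeldAlgebra

end Left

section Right

variable [Bialgebra k H] (D : RLYetterDrinfeldAlgebra k H R)

theorem RightModuleAlgebra.mul_act_sw (D : RightModuleAlgebra k H R) (h : H) (a b : R) :
    D.act (a * b) h = sw (δ h) fun p q => D.act a p * D.act b q := by
  rw [D.mul_act, map_eq_sw, map_sw]
  rfl

namespace RLYetterDrinfeldAlgebra

theorem sw_coact_coassoc (y : R) (f : H → H → R → P) [∀ b c, IsLin k fun a => f a b c]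
    [∀ a c, IsLin k fun b => f a b c] [∀ a b, IsLin k fun c => f a b c] :
    (sw (D.coact y) fun a c => sw (δ a) fun a b => f a b c) =
      sw (D.coact y) fun a b => sw (D.coact b) fun b c => f a b c :=
  sw_of_assoc _ _ _ _ (D.coact_coassoc y) f

theorem sw_coact_counit (y : R) (f : R → P) [hf : IsLin k f] :
    (sw (D.coact y) fun a b => ε a • f b) = f y := by
  have e := D.coact_counit y
  rw [LinearMap.rTensor, map_eq_sw, map_sw] at e
  have := congrArg (linMap (k := k) f) e
  simpa only [map_sw, TensorProduct.lid_tmul, map_smul, linMap_apply, LinearMap.id_apply]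
    using this

theorem sw_coact_mul (a b : R) (f : H → R → P) [∀ b, IsLin k fun a => f a b]
    [∀ a, IsLin k fun b => f a b] :
    sw (D.coact (a * b)) f =
      sw (D.coact a) fun u v => sw (D.coact b) fun u' v' => f (u' * u) (v * v') := by
  rw [D.coact_mul, map₂_eq_sw]
  simp only [sw_sw, sw_tmul, LinearMap.mul_apply', LinearMap.flip_apply]

theorem sw_coact_one (f : H → R → P) [∀ b, IsLin k fun a => f a b]
    [∀ a, IsLin k fun b => f a b] : sw (D.coact 1) f = f 1 1 := by
  rw [D.coact_one, sw_tmul]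

theorem sw_yetterDrinfeld (h : H) (a : R) (f : H → R → P) [∀ b, IsLin k fun a => f a b]
    [∀ a, IsLin k fun b => f a b] :
    (sw (D.coact a) fun u v => sw (δ h) fun p q => f (u * p) (D.act v q)) =
      sw (δ h) fun p q => sw (D.coact (D.act a p)) fun u v => f (q * u) v := by
  have e := D.yetterDrinfeld h a
  rw [map₂_eq_sw, map_eq_sw, sw_comm_tensor, map_sw] at e
  have := congrArg (fun t => sw t f) e
  simp only [sw_sw, sw_tmul, LinearMap.mul_apply'] at this
  rw [this]
  congr! 3 with p q
  simp only [LinearMap.comp_apply, LinearMap.mul'_apply]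
  conv_lhs => rw [← sw_tmul_self (D.coact (D.act a p))]
  simp only [mul_sw, sw_sw, AlgHom.toLinearMap_apply, Algebra.TensorProduct.includeLeft_apply,
    Algebra.TensorProduct.tmul_mul_tmul, one_mul, sw_tmul]

theorem BraidedCommutative.sw_eq {D : RLYetterDrinfeldAlgebra k H R} (hD : D.BraidedCommutative)
    (a y : R) : (sw (D.coact y) fun u v => D.act a u * v) = y * a := by
  rw [← hD, LinearMap.rTensor, map_eq_sw, map_sw]
  rfl

end RLYetterDrinfeldAlgebra

end Right

/-! ### The right action of H on L, and the maps θ and η -/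

/-- A pair of braided commutative Yetter-Drinfeld module algebras, compatible via an
antiisomorphism. -/
structure CompatiblePair (k H L R : Type*) [Field k] [Ring H] [HopfAlgebra k H] [Ring L]
    [Algebra k L] [Ring R] [Algebra k R] where
  left : LRYetterDrinfeldAlgebra k H L
  right : RLYetterDrinfeldAlgebra k H R
  φ : L ≃ₗ[k] R
  braided_left : left.BraidedCommutative
  braided_right : right.BraidedCommutative
  antiIso : IsAntiIso φ
  compatible : CompatibleVia left right φ

namespace CompatiblePair

variable [HopfAlgebra k H] (D : CompatiblePair k H L R)

theorem φ_mul (x y : L) : D.φ (x * y) = D.φ y * D.φ x := D.antiIso x y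

theorem φ_symm_mul (x y : R) : D.φ.symm (x * y) = D.φ.symm y * D.φ.symm x := by
  apply D.φ.injective
  simp [φ_mul]

theorem φ_one : D.φ 1 = 1 := by
  have h := D.φ_mul 1 (D.φ.symm 1)
  rwa [one_mul, D.φ.apply_symm_apply, one_mul, eq_comm] at h

theorem φ_symm_one : D.φ.symm 1 = 1 := by rw [← D.φ_one, D.φ.symm_apply_apply]

/-- The right action of `H` on `L` obtained from the action on `R` along `φ`. -/
def ract : L →ₗ[k] H →ₗ[k] L := linMap₂ fun x h => D.φ.symm (D.right.act (D.φ x) h)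

theorem ract_apply (x : L) (h : H) : D.ract x h = D.φ.symm (D.right.act (D.φ x) h) := rfl

theorem φ_ract (x : L) (h : H) : D.φ (D.ract x h) = D.right.act (D.φ x) h := by
  rw [ract_apply, D.φ.apply_symm_apply]

theorem ract_unit (x : L) : D.ract x 1 = x := by
  rw [ract_apply, D.right.act_unit, D.φ.symm_apply_apply]

theorem ract_ract (x : L) (g h : H) : D.ract (D.ract x g) h = D.ract x (g * h) := by
  simp [ract_apply, D.right.act_act]

/-- The legs of h appear in reverse order because φ reverses products. -/
theorem mul_ract (x y : L) (h : H) :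
    D.ract (x * y) h = sw (δ h) fun p q => D.ract x q * D.ract y p := by
  rw [ract_apply, φ_mul, D.right.mul_act_sw, map_sw]
  simp only [φ_symm_mul, ract_apply]

/-- The left action is thus recovered from the right one, whereas the converse would need an inverse
of S. This is why later computations are carried out with ◁. -/
theorem act_eq_ract (h : H) (x : L) : D.left.act h x = D.ract x (𝑺 h) := by
  rw [ract_apply, ← D.compatible.map_act, D.φ.symm_apply_apply]

theorem sw_coact_φ (x : L) (f : H → R → P) [∀ b, IsLin k fun a => f a b]
    [∀ a, IsLin k fun b => f a b] :
    sw (D.right.coact (D.φ x)) f = sw (D.left.coact x) fun u v => f (𝑺 v) (D.φ u) := by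
  -- A bundled bilinear map suffices; its compositions with linear maps are again visibly bilinear.
  suffices ∀ F : H →ₗ[k] R →ₗ[k] P, (sw (D.right.coact (D.φ x)) fun a b => F a b) =
      sw (D.left.coact x) fun u v => F (𝑺 v) (D.φ u) from this (linMap₂ f)
  intro F
  rw [D.compatible.map_coact, sw_map, sw_comm_tensor]
  rfl

/-- The Yetter-Drinfeld condition of R at φ(x), read in L through the compatibility of the
coactions. -/
theorem sw_yetterDrinfeld_ract (h : H) (x : L) (f : H → L → P) [∀ b, IsLin k fun a => f a b]
    [∀ a, IsLin k fun b => f a b] :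
    (sw (D.left.coact x) fun u v => sw (δ h) fun p q => f (𝑺 v * p) (D.ract u q)) =
      sw (δ h) fun p q => sw (D.left.coact (D.ract x p)) fun u v => f (q * 𝑺 v) u := by
  suffices ∀ F : H →ₗ[k] L →ₗ[k] P, (sw (D.left.coact x) fun u v => sw (δ h) fun p q =>
      F (𝑺 v * p) (D.ract u q)) = sw (δ h) fun p q => sw (D.left.coact (D.ract x p)) fun u v =>
        F (q * 𝑺 v) u from this (linMap₂ f)
  intro F
  have := D.right.sw_yetterDrinfeld h (D.φ x) fun a y => F a (D.φ.symm y)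
  simpa only [sw_coact_φ, ← φ_ract, D.φ.symm_apply_apply] using this

/-- `x ↦ S² x₁ ▷ x₀` -/
def theta : L →ₗ[k] L :=
  linMap fun x => sw (D.left.coact x) fun u v => D.left.act (𝑺 (𝑺 v)) u

theorem theta_apply (x : L) :
    D.theta x = sw (D.left.coact x) fun u v => D.left.act (𝑺 (𝑺 v)) u := rfl

/-- `x ↦ x₀ ◁ x₁` -/
def eta : L →ₗ[k] L := linMap fun x => sw (D.left.coact x) fun u v => D.ract u v

theorem eta_apply (x : L) : D.eta x = sw (D.left.coact x) fun u v => D.ract u v := rfl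

/-- In terms of ◁, θ(y) = y₀ ◁ S³y₁. For y = x ◁ h₁, inserting ε(h₂) as S(h₂)h₃ under an antipode
produces S(h₃) S²(h₂ Sy₁), which contains the expression h₂ Sy₁ of the Yetter-Drinfeld condition.
Exchanging it for S(x₁)h₁, with x₀ ◁ h₂ in place of y₀, leaves h₂S(h₃), which cancels. -/
theorem theta_ract (x : L) (h : H) : D.theta (D.ract x h) = D.ract (D.theta x) (𝑺 (𝑺 h)) := by
  calc D.theta (D.ract x h)
      = sw (δ h) fun p q => ε q • D.theta (D.ract x p) :=
        (sw_counit_smul_right h fun p => D.theta (D.ract x p)).symm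
    _ = sw (δ h) fun p q => sw (δ q) fun q r => sw (D.left.coact (D.ract x p)) fun u v =>
          D.ract u (𝑺 r * 𝑺 (𝑺 (q * 𝑺 v))) := by
        congr! 3 with p q
        rw [theta_apply, smul_sw, sw_comm]
        congr! 3 with u v
        -- Read from right to left, this spreads ε(q) = S(q₁)q₂ over the summand.
        have e : ∀ q r : H, 𝑺 r * 𝑺 (𝑺 (q * 𝑺 v)) = 𝑺 (𝑺 q * r) * 𝑺 (𝑺 (𝑺 v)) := fun q r => by
          simp only [antipode_mul_antidistrib, mul_assoc]
        simp only [e]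
        rw [sw_antipode_mul (f := fun t => D.ract u (𝑺 t * 𝑺 (𝑺 (𝑺 v)))), antipode_one, one_mul,
          act_eq_ract]
    _ = sw (δ h) fun p r => sw (δ p) fun p q => sw (D.left.coact (D.ract x p)) fun u v =>
          D.ract u (𝑺 r * 𝑺 (𝑺 (q * 𝑺 v))) := by
        rw [sw_coassoc (f := fun p q r => sw (D.left.coact (D.ract x p)) fun u v =>
          D.ract u (𝑺 r * 𝑺 (𝑺 (q * 𝑺 v))))]
    _ = sw (δ h) fun p r => sw (D.left.coact x) fun u v => sw (δ p) fun p q =>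
          D.ract (D.ract u q) (𝑺 r * 𝑺 (𝑺 (𝑺 v * p))) := by
        congr! 3 with p r
        exact (D.sw_yetterDrinfeld_ract p x fun a u => D.ract u (𝑺 r * 𝑺 (𝑺 a))).symm
    _ = D.ract (D.theta x) (𝑺 (𝑺 h)) := by
        rw [sw_comm]
        rw [theta_apply, map_sw_apply]
        congr! 3 with u v
        simp only [ract_ract, ← mul_assoc]
        rw [sw_coassoc (f := fun p q r => D.ract u (q * 𝑺 r * 𝑺 (𝑺 (𝑺 v * p)))),
          sw_cancel_right_mul_antipode (f := fun p q => D.ract u (q * 𝑺 (𝑺 (𝑺 v * p)))),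
          one_mul, antipode_mul_antidistrib, antipode_mul_antidistrib, act_eq_ract, ract_ract]

/-- By `theta_ract`, θ(x₀ ◁ x₁) = θ(x₀) ◁ S²x₁ = x₀ ◁ S²(S(x₁)x₂), and the last factor reduces to
the counit. This yields the axiom relating α_R, ε_R and β_L. -/
theorem theta_eta (x : L) : D.theta (D.eta x) = x := by
  rw [eta_apply, map_sw]
  simp only [theta_ract]
  simp only [theta_apply, map_sw_apply, act_eq_ract, ract_ract]
  rw [LRYetterDrinfeldAlgebra.sw_coact_coassoc
    (f := fun a b c => D.ract a (𝑺 (𝑺 (𝑺 b)) * 𝑺 (𝑺 c)))]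
  simp only [← antipode_mul_antidistrib]
  calc _ = sw (D.left.coact x) fun u v => ε v • D.ract u 1 := by
        congr! 3 with u v
        rw [sw_antipode_mul (f := fun v => D.ract u (𝑺 (𝑺 v)))]
        simp only [antipode_one]
    _ = x := by
        rw [D.left.sw_coact_counit (f := fun u => D.ract u 1), ract_unit]

end CompatiblePair

end YetterDrinfeldSweedler

namespace LeftModuleAlgebra

variable {k H L : Type*} [Field k] [Ring H] [Bialgebra k H] [Ring L] [Algebra k L]
  (D : LeftModuleAlgebra k H L)

theorem inl_mul_inr (x : L) (f : H) : D.inl x * D.inr f = D.sharp x f := by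
  rw [inl_apply, inr_apply, sharp_mul_sharp, Bialgebra.comul_one, Algebra.TensorProduct.one_def]
  simp [D.one_act]
  rfl

theorem inr_mul_inl (x : L) (f : H) : D.inr f * D.inl x =
    sw (comul (R := k) f) fun p q => D.inl (D.act p x) * D.inr q := by
  rw [inl_apply, inr_apply, sharp_mul_sharp, map_eq_sw, map_sw]
  simp only [inl_mul_inr, LinearMap.comp_apply, LinearMap.mulLeft_apply, LinearMap.mulRight_apply,
    one_mul, mul_one]
  rfl

end LeftModuleAlgebra

/-! ### Commutation relations in an algebra isomorphic to L ♯ H -/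

namespace CompatiblePair

variable {k H L R K P : Type*} [Field k] [Ring H] [HopfAlgebra k H] [Ring L] [Algebra k L]
  [Ring R] [Algebra k R] [Ring K] [Algebra k K] [AddCommMonoid P] [Module k P]
  (D : CompatiblePair k H L R) (E : D.left.Smash ≃ₐ[k] K)

local notation "δ" => Coalgebra.comul (R := k) (A := H)
local notation "ε" => Coalgebra.counit (R := k) (A := H)
local notation "𝑺" => HopfAlgebra.antipode k (A := H)

/-- The embedding of `L` into an algebra `K` isomorphic to `L ♯ H`. -/
def emb : L →ₐ[k] K := (E : D.left.Smash →ₐ[k] K).comp D.left.inl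

/-- The map from `H` to an algebra `K` isomorphic to `L ♯ H`. -/
def embH : H →ₐ[k] K := (E : D.left.Smash →ₐ[k] K).comp D.left.inr

local notation "α" => emb D E
local notation "ι" => embH D E

theorem emb_mul_embH (x : L) (f : H) : α x * ι f = E (D.left.sharp x f) := by
  rw [← LeftModuleAlgebra.inl_mul_inr, map_mul]
  rfl

theorem embH_mul_emb (x : L) (f : H) :
    ι f * α x = sw (δ f) fun p q => α (D.left.act p x) * ι q := by
  have := congrArg E (D.left.inr_mul_inl x f)
  simp only [map_sw, map_mul] at this
  exact this

theorem induction_emb {p : K → Prop} (h : ∀ x f, p (α x * ι f))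
    (hadd : ∀ s t, p s → p t → p (s + t)) (z : K) : p z := by
  obtain ⟨t, rfl⟩ : ∃ t : L ⊗[k] H, E (D.left.ofTensor t) = z :=
    ⟨D.left.ofTensor.symm (E.symm z), by simp⟩
  induction t with
  | zero => simpa using h 0 0
  | tmul x f =>
    have := h x f
    rwa [emb_mul_embH] at this
  | add s t hs ht => simpa only [map_add] using hadd _ _ hs ht

/-- The linear map on `K` with value `F x f` at `x ♯ f`. -/
def ofSharp (F : L →ₗ[k] H →ₗ[k] P) : K →ₗ[k] P :=
  TensorProduct.lift F ∘ₗ D.left.ofTensor.symm.toLinearMap ∘ₗ E.symm.toLinearMap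

theorem ofSharp_apply (F : L →ₗ[k] H →ₗ[k] P) (x : L) (f : H) :
    D.ofSharp E F (α x * ι f) = F x f := by
  rw [emb_mul_embH, ofSharp, LinearMap.comp_apply, LinearMap.comp_apply]
  simp only [AlgEquiv.toLinearMap_apply, AlgEquiv.symm_apply_apply]
  exact TensorProduct.lift.tmul _ _

/-- The target map `x ↦ x₀ ♯ x₁` of the left bialgebroid. -/
def targetL : L →ₗ[k] K := linMap fun x => sw (D.left.coact x) fun u v => α u * ι v

/-- The antihomomorphism `x ↦ S² x₁ · x₀`. -/
def sourceR : L →ₗ[k] K := linMap fun x => sw (D.left.coact x) fun u v => ι (𝑺 (𝑺 v)) * α u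

local notation "β" => targetL D E
local notation "γ" => sourceR D E

theorem targetL_apply (x : L) : β x = sw (D.left.coact x) fun u v => α u * ι v := rfl

theorem sourceR_apply (x : L) : γ x = sw (D.left.coact x) fun u v => ι (𝑺 (𝑺 v)) * α u := rfl

/-- Moving α(a) to the left in β(x)α(a) gives x₀(x₁ ▷ a) ♯ x₂, and braided commutativity turns this
into a x₀ ♯ x₁. -/
theorem commute_emb_targetL (a x : L) : α a * β x = β x * α a := by
  rw [targetL_apply, mul_sw, sw_mul]
  simp only [mul_assoc, embH_mul_emb, mul_sw]
  rw [← LRYetterDrinfeldAlgebra.sw_coact_coassoc (f := fun u p q => α u * (α (D.left.act p a) * ι q))]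
  congr! 3 with u v
  rw [← mul_assoc, ← map_mul, ← D.braided_left.sw_eq, map_sw, sw_mul]
  simp only [map_mul, mul_assoc]

theorem targetL_one : β 1 = 1 := by
  rw [targetL_apply, D.left.sw_coact_one (f := fun u v => α u * ι v), map_one, map_one, one_mul]

/-- Since ρ(xy) = x₀y₀ ⊗ y₁x₁, the left side is α(x₀)β(y)ι(x₁), and α(x₀) commutes with β(y). -/
theorem targetL_mul (x y : L) : β (x * y) = β y * β x := by
  rw [targetL_apply, D.left.sw_coact_mul (f := fun u v => α u * ι v), targetL_apply D E x, mul_sw]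
  congr! 3 with u v
  rw [← mul_assoc, ← commute_emb_targetL, targetL_apply, mul_sw, sw_mul]
  simp only [map_mul, mul_assoc]

/-- This is the image of the Yetter-Drinfeld condition of L under u ⊗ v ↦ α(u)ι(v). -/
theorem embH_mul_targetL (h : H) (x : L) :
    ι h * β x = sw (δ h) fun p q => β (D.left.act q x) * ι p := by
  have := D.left.sw_yetterDrinfeld h x fun u v => α u * ι v
  simp only [targetL_apply, mul_sw, sw_mul, mul_assoc, ← map_mul (ι)]
  rw [← this, sw_comm]
  congr! 3 with u v
  rw [← mul_assoc, embH_mul_emb, sw_mul]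
  simp only [map_mul, mul_assoc]

/-- The smash product rule solved for α(a)ι(f): expanding the right side gives a ◁ f₁S(f₂), which
cancels. The right action replaces the inverse antipode that would otherwise be needed. -/
theorem embH_mul_emb_ract (a : L) (f : H) :
    α a * ι f = sw (δ f) fun p q => ι q * α (D.ract a p) := by
  simp only [embH_mul_emb, act_eq_ract, ract_ract]
  rw [← sw_coassoc (f := fun p q r => α (D.ract a (p * 𝑺 q)) * ι r),
    sw_cancel_left_mul_antipode (f := fun p q => α (D.ract a p) * ι q), ract_unit]

/-- Conjugation by H on the image of β realises the action: passing S(g₁) to the right of β leaves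
S(g₂)g₃, which cancels. -/
theorem embH_mul_targetL_mul_antipode (g : H) (x : L) :
    (sw (δ g) fun p q => ι (𝑺 p) * β x * ι q) = β (D.left.act (𝑺 g) x) := by
  simp only [embH_mul_targetL, sw_mul]
  simp only [sw_comul_antipode, mul_assoc, ← map_mul (ι)]
  rw [sw_coassoc (f := fun p q r => β (D.left.act (𝑺 p) x) * ι (𝑺 q * r)),
    sw_cancel_right_antipode_mul (f := fun p q => β (D.left.act (𝑺 p) x) * ι q), map_one, mul_one]

/-- Writing the action of S(Sx₁) as the conjugation of the previous lemma with g = Sx₁ gives S²(x₃)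
α(x₀) x₁S(x₂), whose tail cancels. Through this equation γ inherits from β its commutation with α.
-/
theorem sourceR_eq (x : L) : γ x = β (D.theta x) := by
  rw [theta_apply, map_sw]
  simp only [← embH_mul_targetL_mul_antipode]
  simp only [sw_comul_antipode, targetL_apply, mul_sw, sw_mul]
  -- The two coaction sums are made adjacent so that coassociativity of ρ applies.
  have swap : ∀ (u : L) (v : H) (F : H → H → L → H → K),
      (sw (δ v) fun p q => sw (D.left.coact u) fun a b => F p q a b) =
        sw (D.left.coact u) fun a b => sw (δ v) fun p q => F p q a b := fun u v F => sw_comm _ _ F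
  simp only [swap]
  rw [LRYetterDrinfeldAlgebra.sw_coact_coassoc (f := fun a b v => sw (δ v) fun p q =>
    ι (𝑺 (𝑺 q)) * (α a * ι b) * ι (𝑺 p)), sourceR_apply]
  congr! 3 with a c
  simp only [mul_assoc, ← map_mul (ι)]
  rw [← sw_coassoc (f := fun b p q => ι (𝑺 (𝑺 q)) * (α a * ι (b * 𝑺 p))),
    sw_cancel_left_mul_antipode (f := fun p q => ι (𝑺 (𝑺 q)) * (α a * ι p)), map_one, mul_one]

theorem commute_emb_sourceR (a x : L) : α a * γ x = γ x * α a := by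
  rw [sourceR_eq, commute_emb_targetL]

theorem sourceR_one : γ 1 = 1 := by
  rw [sourceR_apply, D.left.sw_coact_one (f := fun u v => ι (𝑺 (𝑺 v)) * α u)]
  simp only [antipode_one, map_one, one_mul]

/-- Here S² preserves products, so γ(xy) = S²(y₁) S²(x₁) x₀y₀ = S²(y₁) γ(x) α(y₀), and γ(x) commutes
with α(y₀). -/
theorem sourceR_mul (x y : L) : γ (x * y) = γ y * γ x := by
  rw [sourceR_apply, D.left.sw_coact_mul (f := fun u v => ι (𝑺 (𝑺 v)) * α u), sw_comm]
  rw [sourceR_apply D E y, sw_mul]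
  congr! 3 with u' v'
  rw [mul_assoc, commute_emb_sourceR, sourceR_apply, sw_mul, mul_sw]
  simp only [antipode_mul_antidistrib, map_mul, mul_assoc]

/-- With γ = β ∘ θ and `theta_ract`, the right side becomes β(θ(a) ◁ S(f₂ S(f₃))) f₁, and the
antipodes cancel. This is the product rule of H ♯ R seen inside `K`. -/
theorem sourceR_mul_embH (a : L) (f : H) :
    γ a * ι f = sw (δ f) fun p q => ι p * γ (D.ract a q) := by
  simp only [sourceR_eq, theta_ract, embH_mul_targetL, act_eq_ract, ract_ract]
  simp only [← antipode_mul_antidistrib]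
  rw [sw_coassoc (f := fun p q r => β (D.ract (D.theta a) (𝑺 (q * 𝑺 r))) * ι p),
    sw_cancel_right_mul_antipode (f := fun p q => β (D.ract (D.theta a) (𝑺 q)) * ι p),
    antipode_one, ract_unit]

/-- Unfolding γ gives S(x₂)S²(x₁) = S(S(x₁)x₂) in front of x₀, which reduces to the counit. -/
theorem emb_eq_sw_sourceR (x : L) : α x = sw (D.left.coact x) fun u v => ι (𝑺 v) * γ u := by
  simp only [sourceR_apply, mul_sw]
  rw [D.left.sw_coact_coassoc (f := fun a b c => ι (𝑺 c) * (ι (𝑺 (𝑺 b)) * α a))]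
  simp only [← mul_assoc, ← map_mul (ι), ← antipode_mul_antidistrib]
  calc α x = sw (D.left.coact x) fun u v => ε v • (ι (𝑺 1) * α u) := by
        rw [D.left.sw_coact_counit (f := fun u => ι (𝑺 1) * α u), antipode_one, map_one, one_mul]
    _ = _ := by
        congr! 3 with u v
        rw [sw_antipode_mul (f := fun v => ι (𝑺 v) * α u)]

/-- The products ι(f)γ(x) span `K`: move α to the right of ι, then express it through γ. -/
theorem induction_sourceR {p : K → Prop} (h : ∀ f x, p (ι f * γ x))
    (hadd : ∀ s t, p s → p t → p (s + t)) (z : K) : p z := by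
  have h₀ : p 0 := by simpa using h 0 0
  induction z using D.induction_emb E with
  | h x f =>
    rw [embH_mul_emb_ract]
    refine sw_induction h₀ hadd _ _ fun q r => ?_
    rw [emb_eq_sw_sourceR, mul_sw]
    refine sw_induction h₀ hadd _ _ fun u v => ?_
    rw [← mul_assoc, ← map_mul]
    exact h _ _
  | hadd s t hs ht => exact hadd _ _ hs ht

end CompatiblePair

/-! ### Maps on balanced tensor products, evaluated on generators -/

section Maps

variable {k A B M N P Q : Type*} [Field k] [AddCommGroup M] [Module k M] [AddCommGroup N]
  [Module k N] [AddCommGroup P] [Module k P] [AddCommGroup Q] [Module k Q]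
  {r₁ : A → M →ₗ[k] M} {l₁ : A → N →ₗ[k] N} {r₂ : B → N →ₗ[k] N} {l₂ : B → P →ₗ[k] P}

theorem BTensor₃.mapLeft_proj (hc : ∀ a b n, r₂ b (l₁ a n) = l₁ a (r₂ b n))
    (f : Q →ₗ[k] BTensor r₁ l₁) (r' : B → Q →ₗ[k] Q)
    (hf : ∀ b q, f (r' b q) = BTensor.actRight (r₂ b) (fun a n => hc a b n) (f q)) (q : Q) (p : P) :
    BTensor₃.mapLeft (l₂ := l₂) hc f r' hf (BTensor.proj r' l₂ (q ⊗ₜ p)) =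
      BTensor₃.ofLeft r₁ l₁ r₂ l₂ (f q) p := rfl

theorem BTensor₃.mapRight_proj (hc : ∀ a b n, r₂ b (l₁ a n) = l₁ a (r₂ b n))
    (g : Q →ₗ[k] BTensor r₂ l₂) (l' : A → Q →ₗ[k] Q)
    (hg : ∀ a q, g (l' a q) = BTensor.actLeft (l₁ a) (fun b n => (hc a b n).symm) (g q))
    (m : M) (q : Q) :
    BTensor₃.mapRight (r₁ := r₁) hc g l' hg (BTensor.proj r₁ l' (m ⊗ₜ q)) =
      BTensor₃.ofRight r₁ l₁ r₂ l₂ m (g q) := rfl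

end Maps

section SourceTarget

variable {k A K : Type*} [Field k] [Ring A] [Algebra k A] [Ring K] [Algebra k K]
  (s : SourceTarget k A K)

theorem SourceTarget.projL_balanced (a : A) (m n : K) :
    s.projL ((s.target a * m) ⊗ₜ n) = s.projL (m ⊗ₜ (s.source a * n)) :=
  BTensor.proj_balanced (fun b : A => LinearMap.mulLeft k (s.target b))
    (fun a : A => LinearMap.mulLeft k (s.source a)) a m n

theorem SourceTarget.projR_balanced (a : A) (m n : K) :
    s.projR ((m * s.source a) ⊗ₜ n) = s.projR (m ⊗ₜ (n * s.target a)) :=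
  BTensor.proj_balanced (fun a : A => LinearMap.mulRight k (s.source a))
    (fun b : A => LinearMap.mulRight k (s.target b)) a m n

end SourceTarget

/-! ### The left bialgebroid over L -/

namespace CompatiblePair

variable {k H L R K P : Type*} [Field k] [Ring H] [HopfAlgebra k H] [Ring L] [Algebra k L]
  [Ring R] [Algebra k R] [Ring K] [Algebra k K] [AddCommMonoid P] [Module k P]
  (D : CompatiblePair k H L R) (E : D.left.Smash ≃ₐ[k] K)

local notation "δ" => Coalgebra.comul (R := k) (A := H)
local notation "ε" => Coalgebra.counit (R := k) (A := H)
local notation "𝑺" => HopfAlgebra.antipode k (A := H)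
local notation "α" => emb D E
local notation "ι" => embH D E
local notation "β" => targetL D E
local notation "γ" => sourceR D E

/-- Source and target of the left bialgebroid. -/
def stL : SourceTarget k L K where
  source := α
  target := β
  target_one := D.targetL_one E
  target_mul := D.targetL_mul E
  commute := D.commute_emb_targetL E

local notation "π" => SourceTarget.projL (stL D E)

theorem stL_source (a : L) : (D.stL E).source a = α a := rfl

theorem projL_balanced (a : L) (m n : K) : π ((β a * m) ⊗ₜ n) = π (m ⊗ₜ (α a * n)) :=
  (D.stL E).projL_balanced a m n

/-- The coproduct of the left bialgebroid. -/
def comulL : K →ₗ[k] (D.stL E).TensorL :=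
  D.ofSharp E (linMap₂ fun x f => sw (δ f) fun p q => π ((α x * ι p) ⊗ₜ ι q))

theorem comulL_apply (x : L) (f : H) :
    D.comulL E (α x * ι f) = sw (δ f) fun p q => π ((α x * ι p) ⊗ₜ ι q) :=
  D.ofSharp_apply E _ x f

theorem comulL_embH (f : H) :
    D.comulL E (ι f) = sw (δ f) fun p q => π (ι p ⊗ₜ ι q) := by
  have := D.comulL_apply E 1 f
  simpa only [map_one, one_mul] using this

theorem comulL_one : D.comulL E 1 = π (1 ⊗ₜ 1) := by
  rw [← map_one (ι), comulL_embH, sw_comul_one (f := fun p q => π (ι p ⊗ₜ ι q))]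

theorem comulL_source_mul (a : L) (z : K) :
    D.comulL E (LinearMap.mulLeft k ((D.stL E).source a) z) =
      BTensor.actLeft (LinearMap.mulLeft k ((D.stL E).source a))
        (fun b y => ((D.stL E).mulLeft_comm a b y).symm) (D.comulL E z) := by
  induction z using D.induction_emb E with
  | h x f =>
    calc D.comulL E (α a * (α x * ι f)) = D.comulL E (α (a * x) * ι f) := by
          rw [map_mul (α), mul_assoc]
      _ = sw (δ f) fun p q => π ((α a * (α x * ι p)) ⊗ₜ ι q) := by
          rw [comulL_apply]
          simp only [map_mul, mul_assoc]
      _ = _ := by rw [comulL_apply, map_sw]; rfl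
  | hadd s t hs ht => simp only [map_add, hs, ht]

/-- Multiplying by β(b) first puts b₀ and b₁b₂ into the two legs. Coassociativity of ρ regroups the
first leg into β(b₀), which crosses the tensor sign as α(b₀) and joins b₁ to form β(b) in the second
leg. -/
theorem comulL_target_mul (b : L) (z : K) :
    D.comulL E (LinearMap.mulLeft k ((D.stL E).target b) z) =
      BTensor.actRight (LinearMap.mulLeft k ((D.stL E).target b))
        (fun a y => (D.stL E).mulLeft_comm a b y) (D.comulL E z) := by
  induction z using D.induction_emb E with
  | h x f =>
    calc D.comulL E (β b * (α x * ι f))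
        = sw (D.left.coact b) fun u v => D.comulL E (α (x * u) * ι (v * f)) := by
          rw [← mul_assoc, ← commute_emb_targetL, targetL_apply, mul_sw, sw_mul, map_sw]
          simp only [map_mul, mul_assoc]
      _ = sw (D.left.coact b) fun u v => sw (δ v) fun v w => sw (δ f) fun p q =>
            π ((α (x * u) * ι (v * p)) ⊗ₜ ι (w * q)) := by
          congr! 3 with u v
          rw [comulL_apply, sw_comul_mul (f := fun p q => π ((α (x * u) * ι p) ⊗ₜ ι q))]
      _ = sw (D.left.coact b) fun u w => sw (D.left.coact u) fun u v => sw (δ f) fun p q =>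
            π ((α (x * u) * ι (v * p)) ⊗ₜ ι (w * q)) :=
          (D.left.sw_coact_coassoc b fun u v w => sw (δ f) fun p q =>
            π ((α (x * u) * ι (v * p)) ⊗ₜ ι (w * q))).symm
      _ = sw (D.left.coact b) fun u w => sw (δ f) fun p q =>
            π ((β u * (α x * ι p)) ⊗ₜ (ι w * ι q)) := by
          congr! 3 with u w
          rw [sw_comm]
          congr! 3 with p q
          rw [← mul_assoc, ← commute_emb_targetL, targetL_apply]
          simp only [mul_sw, sw_mul, sw_tmul_right, map_sw, map_mul, mul_assoc]
      _ = sw (δ f) fun p q => π ((α x * ι p) ⊗ₜ (β b * ι q)) := by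
          rw [sw_comm]
          congr! 3 with p q
          rw [targetL_apply, sw_mul, tmul_sw, map_sw]
          congr! 3 with u w
          rw [projL_balanced, mul_assoc]
      _ = _ := by rw [comulL_apply, map_sw]; rfl
  | hadd s t hs ht => simp only [map_add, hs, ht]

theorem dotL_comulL (x : L) (f : H) (g h : K) :
    (D.stL E).dotL (D.comulL E (α x * ι f)) (g ⊗ₜ h) =
      sw (δ f) fun p q => π ((α x * ι p * g) ⊗ₜ (ι q * h)) := by
  simp only [comulL_apply, map_sw_apply, SourceTarget.dotL_proj,
    Algebra.TensorProduct.tmul_mul_tmul]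

/-- Passing β(a) leftwards through f₁ gives β(f₂ ▷ a), which crosses the tensor sign as α(f₂ ▷ a).
The same factor results from moving α(a) leftwards through the second leg. -/
theorem takeuchiL (z : K) (a : L) (g h : K) :
    (D.stL E).dotL (D.comulL E z) (LinearMap.mulLeft k ((D.stL E).target a) g ⊗ₜ h) =
      (D.stL E).dotL (D.comulL E z) (g ⊗ₜ LinearMap.mulLeft k ((D.stL E).source a) h) := by
  change (D.stL E).dotL (D.comulL E z) ((β a * g) ⊗ₜ h) =
      (D.stL E).dotL (D.comulL E z) (g ⊗ₜ (α a * h))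
  induction z using D.induction_emb E with
  | h x f =>
    rw [dotL_comulL, dotL_comulL]
    calc _ = sw (δ f) fun p r => sw (δ p) fun p q =>
          π ((α x * ι p * g) ⊗ₜ (α (D.left.act q a) * (ι r * h))) := by
          congr! 3 with p r
          rw [mul_assoc, ← mul_assoc (ι p), embH_mul_targetL]
          simp only [sw_mul, mul_sw, sw_tmul_right, map_sw]
          congr! 3 with p q
          rw [← projL_balanced, ← mul_assoc (α x), ← mul_assoc (α x), commute_emb_targetL]
          simp only [mul_assoc]
      _ = _ := by
          rw [sw_coassoc (f := fun p q r =>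
            π ((α x * ι p * g) ⊗ₜ (α (D.left.act q a) * (ι r * h))))]
          congr! 3 with p r
          rw [← mul_assoc, embH_mul_emb]
          simp only [sw_mul, tmul_sw, map_sw, mul_assoc]
  | hadd s t hs ht => simp only [map_add, LinearMap.add_apply, hs, ht]

theorem dotL_comulL_mul (y z g h : K) :
    (D.stL E).dotL (D.comulL E (y * z)) (g ⊗ₜ h) =
      BTensor.lift ((D.stL E).dotL (D.comulL E y)) (D.takeuchiL E y)
        ((D.stL E).dotL (D.comulL E z) (g ⊗ₜ h)) := by
  induction z using D.induction_emb E with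
  | h b e =>
    rw [dotL_comulL, map_sw]
    simp only [BTensor.lift_proj]
    induction y using D.induction_emb E with
    | h a f =>
      simp only [dotL_comulL]
      calc _ = sw (δ f) fun p q => (D.stL E).dotL
              (D.comulL E (α (a * D.left.act p b) * ι (q * e))) (g ⊗ₜ h) := by
            rw [mul_assoc, ← mul_assoc (ι f), embH_mul_emb]
            simp only [sw_mul, mul_sw, map_sw, map_sw, sw_apply, map_mul, mul_assoc]
        _ = sw (δ f) fun p q => sw (δ q) fun q r => sw (δ e) fun s t =>
              π ((α (a * D.left.act p b) * ι (q * s) * g) ⊗ₜ (ι (r * t) * h)) := by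
            congr! 3 with p q
            rw [dotL_comulL, sw_comul_mul
              (f := fun q r => π ((α (a * D.left.act p b) * ι q * g) ⊗ₜ (ι r * h)))]
        _ = sw (δ f) fun p r => sw (δ p) fun p q => sw (δ e) fun s t =>
              π ((α (a * D.left.act p b) * ι (q * s) * g) ⊗ₜ (ι (r * t) * h)) :=
            (sw_coassoc f fun p q r => sw (δ e) fun s t =>
              π ((α (a * D.left.act p b) * ι (q * s) * g) ⊗ₜ (ι (r * t) * h))).symm
        _ = sw (δ f) fun p r => sw (δ e) fun s t =>
              π ((α a * ι p * (α b * ι s * g)) ⊗ₜ (ι r * (ι t * h))) := by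
            congr! 3 with p r
            rw [sw_comm]
            congr! 3 with s t
            rw [mul_assoc (α a), ← mul_assoc (ι p), ← mul_assoc (ι p), embH_mul_emb]
            simp only [sw_mul, mul_sw, sw_tmul_right, map_sw, map_mul, mul_assoc]
        _ = _ := sw_comm _ _ _
    | hadd s t hs ht =>
      simp only [map_add, add_mul, LinearMap.add_apply, hs, ht]
      -- Additivity in y holds term by term, the decomposition of Δ(e) being fixed.
      simp only [sw, Finset.sum_add_distrib]
  | hadd s t hs ht => simp only [map_add, mul_add, LinearMap.add_apply, hs, ht]

/-- The counit of the left bialgebroid. -/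
def counitL : K →ₗ[k] L := D.ofSharp E (linMap₂ fun x f => ε f • x)

theorem counitL_apply (x : L) (f : H) : D.counitL E (α x * ι f) = ε f • x :=
  D.ofSharp_apply E _ x f

theorem counitL_emb (x : L) : D.counitL E (α x) = x := by
  have := D.counitL_apply E x 1
  rwa [map_one, mul_one, Bialgebra.counit_one, one_smul] at this

/-- The counit intertwines left multiplication with the action of L ♯ H on L, in which L multiplies
and H acts by ▷. This gives the counit axiom for products. -/
theorem counitL_mul (x : L) (f : H) (z : K) :
    D.counitL E (α x * ι f * z) = x * D.left.act f (D.counitL E z) := by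
  induction z using D.induction_emb E with
  | h y g =>
    calc _ = sw (δ f) fun p q => D.counitL E (α (x * D.left.act p y) * ι (q * g)) := by
          rw [mul_assoc, ← mul_assoc (ι f), embH_mul_emb]
          simp only [sw_mul, mul_sw, map_sw, map_mul, mul_assoc]
      _ = sw (δ f) fun p q => ε q • (x * ε g • D.left.act p y) := by
          simp only [counitL_apply, Bialgebra.counit_mul, mul_smul, mul_smul_comm]
      _ = _ := by
          rw [sw_counit_smul_right (f := fun p => x * ε g • D.left.act p y), counitL_apply, map_smul]
  | hadd s t hs ht => simp only [map_add, mul_add, hs, ht]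

theorem counitL_bimodule (a b : L) (z : K) :
    D.counitL E ((D.stL E).source a * (D.stL E).target b * z) = a * D.counitL E z * b := by
  change D.counitL E (α a * β b * z) = _
  induction z using D.induction_emb E with
  | h x f =>
    calc _ = sw (D.left.coact b) fun u v => D.counitL E (α (a * x * u) * ι (v * f)) := by
          rw [mul_assoc, ← mul_assoc (β b), ← commute_emb_targetL, targetL_apply]
          simp only [sw_mul, mul_sw, map_sw, map_mul, mul_assoc]
      _ = sw (D.left.coact b) fun u v => ε v • ε f • (a * x * u) := by
          simp only [counitL_apply, Bialgebra.counit_mul, mul_smul]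
      _ = _ := by
          rw [D.left.sw_coact_counit (f := fun u => ε f • (a * x * u)), counitL_apply]
          simp only [mul_smul_comm, smul_mul_assoc]
  | hadd s t hs ht => simp only [map_add, mul_add, add_mul, hs, ht]

/-- The left bialgebroid over `L`. -/
def leftBialgebroid : LeftBialgebroid k L K where
  st := D.stL E
  comul := D.comulL E
  counit := D.counitL E
  comul_source := D.comulL_source_mul E
  comul_target := D.comulL_target_mul E
  counit_bimodule := D.counitL_bimodule E
  coassoc z := by
    induction z using D.induction_emb E with
    | h x f =>
      simp only [comulL_apply, map_sw, BTensor₃.mapLeft_proj, BTensor₃.mapRight_proj, comulL_embH,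
        sw_apply, BTensor₃.ofLeft_proj, BTensor₃.ofRight_proj]
      rw [sw_coassoc]
    | hadd s t hs ht => simp only [map_add, hs, ht]
  counit_left z := by
    induction z using D.induction_emb E with
    | h x f =>
      rw [comulL_apply, map_sw]
      change (sw (δ f) fun p q => α (D.counitL E (α x * ι p)) * ι q) = _
      simp only [counitL_apply, map_smul, smul_mul_assoc]
      exact sw_counit_smul f fun q => α x * ι q
    | hadd s t hs ht => simp only [map_add, hs, ht]
  counit_right z := by
    induction z using D.induction_emb E with
    | h x f =>
      rw [comulL_apply, map_sw]
      change (sw (δ f) fun p q => β (D.counitL E (ι q)) * (α x * ι p)) = _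
      have e : ∀ q, D.counitL E (ι q) = ε q • (1 : L) := fun q => by
        rw [← counitL_apply D E, map_one, one_mul]
      simp only [e, map_smul, smul_mul_assoc, targetL_one, one_mul]
      exact sw_counit_smul_right f fun p => α x * ι p
    | hadd s t hs ht => simp only [map_add, hs, ht]
  takeuchi := D.takeuchiL E
  one_dot t := by
    induction t using BTensor.induction with
    | h m n =>
      refine (BTensor.lift_proj _ _ _).trans ?_
      rw [comulL_one, SourceTarget.dotL_proj, Algebra.TensorProduct.tmul_mul_tmul,
        one_mul, one_mul]
    | hadd s t hs ht => simp only [map_add, hs, ht]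
  mul_dot x y t := by
    induction t using BTensor.induction with
    | h m n => exact D.dotL_comulL_mul E x y m n
    | hadd s t hs ht => simp only [map_add, hs, ht]
  counit_one_source a := by rw [one_mul, stL_source, counitL_emb]
  counit_mul_source x y a := by
    simp only [stL_source]
    induction x using D.induction_emb E with
    | h x f => rw [mul_assoc (α x * ι f), counitL_mul, counitL_mul, counitL_emb]
    | hadd s t hs ht => simp only [map_add, add_mul, hs, ht]

end CompatiblePair

/-! ### The right bialgebroid over R -/

namespace CompatiblePair

variable {k H L R K : Type*} [Field k] [Ring H] [HopfAlgebra k H] [Ring L] [Algebra k L]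
  [Ring R] [Algebra k R] [Ring K] [Algebra k K]
  (D : CompatiblePair k H L R) (E : D.left.Smash ≃ₐ[k] K)

local notation "δ" => Coalgebra.comul (R := k) (A := H)
local notation "ε" => Coalgebra.counit (R := k) (A := H)
local notation "𝑺" => HopfAlgebra.antipode k (A := H)
local notation "α" => emb D E
local notation "ι" => embH D E
local notation "β" => targetL D E
local notation "γ" => sourceR D E

/-- Source and target of the right bialgebroid. -/
def stR : SourceTarget k R K where
  source := AlgHom.ofLinearMap (γ ∘ₗ D.φ.symm.toLinearMap)
    (by simp [φ_symm_one, sourceR_one]) (fun x y => by simp [φ_symm_mul, sourceR_mul])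
  target := (α).toLinearMap ∘ₗ D.φ.symm.toLinearMap
  target_one := by simp [φ_symm_one]
  target_mul a b := by simp [φ_symm_mul]
  commute a b := (D.commute_emb_sourceR E (D.φ.symm b) (D.φ.symm a)).symm

local notation "ϖ" => SourceTarget.projR (stR D E)

theorem stR_source (b : R) : (D.stR E).source b = γ (D.φ.symm b) := rfl

theorem stR_target (b : R) : (D.stR E).target b = α (D.φ.symm b) := rfl

theorem projR_balanced (a : L) (m n : K) : ϖ ((m * γ a) ⊗ₜ n) = ϖ (m ⊗ₜ (n * α a)) := by
  have := (D.stR E).projR_balanced (D.φ a) m n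
  rwa [stR_source, stR_target, D.φ.symm_apply_apply] at this

/-- The coproduct of the right bialgebroid. -/
def comulR : K →ₗ[k] (D.stR E).TensorR :=
  D.ofSharp E (linMap₂ fun x f => sw (δ f) fun p q => ϖ ((α x * ι p) ⊗ₜ ι q))

theorem comulR_apply (x : L) (f : H) :
    D.comulR E (α x * ι f) = sw (δ f) fun p q => ϖ ((α x * ι p) ⊗ₜ ι q) :=
  D.ofSharp_apply E _ x f

theorem comulR_embH (f : H) : D.comulR E (ι f) = sw (δ f) fun p q => ϖ (ι p ⊗ₜ ι q) := by
  have := D.comulR_apply E 1 f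
  simpa only [map_one, one_mul] using this

theorem comulR_one : D.comulR E 1 = ϖ (1 ⊗ₜ 1) := by
  rw [← map_one (ι), comulR_embH, sw_comul_one (f := fun p q => ϖ (ι p ⊗ₜ ι q))]

/-- Moving α(b) through f uses only f₁, so by coassociativity it can be moved back inside the first
leg. -/
theorem comulR_mul_emb (x b : L) (f : H) : D.comulR E (α x * ι f * α b) =
    sw (δ f) fun p q => ϖ ((α x * ι p * α b) ⊗ₜ ι q) := by
  calc _ = sw (δ f) fun p q => D.comulR E (α (x * D.left.act p b) * ι q) := by
        rw [mul_assoc, embH_mul_emb, mul_sw, map_sw]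
        simp only [map_mul, mul_assoc]
    _ = sw (δ f) fun p q => sw (δ q) fun q r => ϖ ((α (x * D.left.act p b) * ι q) ⊗ₜ ι r) := by
        simp only [comulR_apply]
    _ = sw (δ f) fun p r => sw (δ p) fun p q => ϖ ((α (x * D.left.act p b) * ι q) ⊗ₜ ι r) :=
        (sw_coassoc f fun p q r => ϖ ((α (x * D.left.act p b) * ι q) ⊗ₜ ι r)).symm
    _ = _ := by
        congr! 3 with p r
        rw [mul_assoc, embH_mul_emb, mul_sw, sw_tmul_right, map_sw]
        simp only [map_mul, mul_assoc]

/-- The factor S²(a₁) is split between both legs. Coassociativity of ρ assembles γ(a₀) in the first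
one; the R-balancing moves it to the second as α(a₀), where γ(a) is formed. On f γ(x) the coproduct
is therefore f₁ ⊗ f₂ γ(x). -/
theorem comulR_mul_sourceR (x a : L) (f : H) : D.comulR E (α x * ι f * γ a) =
    sw (δ f) fun p q => ϖ ((α x * ι p) ⊗ₜ (ι q * γ a)) := by
  calc _ = sw (D.left.coact a) fun u v => D.comulR E (α x * ι (f * 𝑺 (𝑺 v)) * α u) := by
        rw [sourceR_apply, mul_sw, map_sw]
        simp only [map_mul, mul_assoc]
    _ = sw (D.left.coact a) fun u v => sw (δ v) fun v w => sw (δ f) fun p q =>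
          ϖ ((α x * ι (p * 𝑺 (𝑺 v)) * α u) ⊗ₜ ι (q * 𝑺 (𝑺 w))) := by
        congr! 3 with u v
        rw [comulR_mul_emb, sw_comul_mul (f := fun p q => ϖ ((α x * ι p * α u) ⊗ₜ ι q))]
        simp only [sw_comul_antipode]
        rw [sw_comm]
    _ = sw (D.left.coact a) fun u w => sw (D.left.coact u) fun u v => sw (δ f) fun p q =>
          ϖ ((α x * ι (p * 𝑺 (𝑺 v)) * α u) ⊗ₜ ι (q * 𝑺 (𝑺 w))) :=
        (D.left.sw_coact_coassoc a fun u v w => sw (δ f) fun p q =>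
          ϖ ((α x * ι (p * 𝑺 (𝑺 v)) * α u) ⊗ₜ ι (q * 𝑺 (𝑺 w)))).symm
    _ = sw (D.left.coact a) fun u w => sw (δ f) fun p q =>
          ϖ ((α x * ι p * γ u) ⊗ₜ ι (q * 𝑺 (𝑺 w))) := by
        congr! 3 with u w
        rw [sw_comm]
        congr! 3 with p q
        rw [sourceR_apply, mul_sw, sw_tmul_right, map_sw]
        simp only [map_mul, mul_assoc]
    _ = _ := by
        rw [sw_comm]
        congr! 3 with p q
        rw [sourceR_apply, mul_sw, tmul_sw, map_sw]
        congr! 3 with u w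
        rw [projR_balanced, map_mul, mul_assoc]

theorem comulR_embH_mul_sourceR (f : H) (a : L) : D.comulR E (ι f * γ a) =
    sw (δ f) fun p q => ϖ (ι p ⊗ₜ (ι q * γ a)) := by
  have := D.comulR_mul_sourceR E 1 a f
  simpa only [map_one, one_mul] using this

theorem comulR_mul_source (a : R) (z : K) :
    D.comulR E (LinearMap.mulRight k ((D.stR E).source a) z) =
      BTensor.actRight (LinearMap.mulRight k ((D.stR E).source a))
        (fun b y => (D.stR E).mulRight_comm a b y) (D.comulR E z) := by
  induction z using D.induction_emb E with
  | h x f =>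
    refine (D.comulR_mul_sourceR E x (D.φ.symm a) f).trans ?_
    rw [comulR_apply, map_sw]
    rfl
  | hadd s t hs ht => simp only [map_add, hs, ht]

theorem comulR_mul_target (b : R) (z : K) :
    D.comulR E (LinearMap.mulRight k ((D.stR E).target b) z) =
      BTensor.actLeft (LinearMap.mulRight k ((D.stR E).target b))
        (fun a y => ((D.stR E).mulRight_comm a b y).symm) (D.comulR E z) := by
  induction z using D.induction_emb E with
  | h x f =>
    refine (D.comulR_mul_emb E x (D.φ.symm b) f).trans ?_
    rw [comulR_apply, map_sw]
    rfl
  | hadd s t hs ht => simp only [map_add, hs, ht]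

theorem dotR_comulR (f : H) (x : L) (g h : K) :
    (D.stR E).dotR (D.comulR E (ι f * γ x)) (g ⊗ₜ h) =
      sw (δ f) fun p q => ϖ ((g * ι p) ⊗ₜ (h * (ι q * γ x))) := by
  simp only [comulR_embH_mul_sourceR, map_sw, sw_apply, SourceTarget.dotR_proj,
    Algebra.TensorProduct.tmul_mul_tmul]

/-- On the spanning elements f γ(x): γ(a) passes f₁ as γ(a ◁ f₂), crosses the tensor sign as α(a ◁
f₂) and commutes with γ(x). Moving α(a) through the second leg gives the same by
`embH_mul_emb_ract`. -/
theorem takeuchiR (z : K) (a : R) (g h : K) :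
    (D.stR E).dotR (D.comulR E z) (LinearMap.mulRight k ((D.stR E).source a) g ⊗ₜ h) =
      (D.stR E).dotR (D.comulR E z) (g ⊗ₜ LinearMap.mulRight k ((D.stR E).target a) h) := by
  change (D.stR E).dotR (D.comulR E z) ((g * γ (D.φ.symm a)) ⊗ₜ h) =
      (D.stR E).dotR (D.comulR E z) (g ⊗ₜ (h * α (D.φ.symm a)))
  generalize D.φ.symm a = a
  induction z using D.induction_sourceR E with
  | h f x =>
    rw [dotR_comulR, dotR_comulR]
    calc _ = sw (δ f) fun p r => sw (δ p) fun p q =>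
          ϖ ((g * ι p) ⊗ₜ (h * (ι r * α (D.ract a q) * γ x))) := by
          congr! 3 with p r
          rw [mul_assoc, sourceR_mul_embH]
          simp only [mul_sw, sw_tmul_right, map_sw]
          congr! 3 with p q
          rw [← mul_assoc, projR_balanced]
          simp only [mul_assoc, commute_emb_sourceR]
      _ = _ := by
          rw [sw_coassoc (f := fun p q r =>
            ϖ ((g * ι p) ⊗ₜ (h * (ι r * α (D.ract a q) * γ x))))]
          congr! 3 with p r
          rw [mul_assoc, ← mul_assoc (α a), embH_mul_emb_ract]
          simp only [sw_mul, mul_sw, tmul_sw, map_sw]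
  | hadd s t hs ht => simp only [map_add, LinearMap.add_apply, hs, ht]

/-- Writing the first factor as α(a)e and the second as f γ(x) avoids all reordering: the two
H-parts meet in the middle, and Δ(ef) = Δ(e)Δ(f) suffices. -/
theorem dotR_comulR_mul (y z g h : K) :
    (D.stR E).dotR (D.comulR E (y * z)) (g ⊗ₜ h) =
      BTensor.lift ((D.stR E).dotR (D.comulR E z)) (D.takeuchiR E z)
        ((D.stR E).dotR (D.comulR E y) (g ⊗ₜ h)) := by
  induction y using D.induction_emb E with
  | h a e =>
    have h₁ : (D.stR E).dotR (D.comulR E (α a * ι e)) (g ⊗ₜ h) =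
        sw (δ e) fun s t => ϖ ((g * (α a * ι s)) ⊗ₜ (h * ι t)) := by
      simp only [comulR_apply, map_sw, sw_apply, SourceTarget.dotR_proj,
        Algebra.TensorProduct.tmul_mul_tmul]
    rw [h₁, map_sw]
    simp only [BTensor.lift_proj]
    induction z using D.induction_sourceR E with
    | h f x =>
      simp only [dotR_comulR]
      calc _ = (D.stR E).dotR (D.comulR E (α a * ι (e * f) * γ x)) (g ⊗ₜ h) := by
            simp only [map_mul, mul_assoc]
        _ = _ := by
            rw [comulR_mul_sourceR, sw_comul_mul
              (f := fun p q => ϖ ((α a * ι p) ⊗ₜ (ι q * γ x)))]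
            simp only [map_sw, sw_apply, SourceTarget.dotR_proj,
              Algebra.TensorProduct.tmul_mul_tmul, map_mul, mul_assoc]
    | hadd s t hs ht =>
      simp only [map_add, mul_add, LinearMap.add_apply, hs, ht]
      simp only [sw, Finset.sum_add_distrib]
  | hadd s t hs ht => simp only [map_add, add_mul, LinearMap.add_apply, hs, ht]

/-- The counit of the right bialgebroid. -/
def counitR : K →ₗ[k] R := D.ofSharp E (linMap₂ fun x f => D.right.act (D.φ x) f)

theorem counitR_apply (x : L) (f : H) : D.counitR E (α x * ι f) = D.right.act (D.φ x) f :=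
  D.ofSharp_apply E _ x f

theorem counitR_emb (x : L) : D.counitR E (α x) = D.φ x := by
  have := D.counitR_apply E x 1
  rwa [map_one, mul_one, D.right.act_unit] at this

theorem counitR_embH (f : H) : D.counitR E (ι f) = ε f • (1 : R) := by
  have := D.counitR_apply E 1 f
  rwa [map_one, one_mul, φ_one, D.right.one_act] at this

theorem counitR_mul_embH (z : K) (f : H) :
    D.counitR E (z * ι f) = D.right.act (D.counitR E z) f := by
  induction z using D.induction_emb E with
  | h x g => rw [mul_assoc, ← map_mul, counitR_apply, counitR_apply, D.right.act_act]
  | hadd s t hs ht => simp only [map_add, add_mul, LinearMap.add_apply, hs, ht]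

/-- For z = α(x)f, the action of f₂ on x(b ◁ Sf₁) produces b ◁ S(f₁)f₂, so b is left unchanged while
x becomes x ◁ f. -/
theorem counitR_mul_emb (z : K) (b : L) :
    D.counitR E (z * α b) = D.φ b * D.counitR E z := by
  induction z using D.induction_emb E with
  | h x f =>
    calc _ = sw (δ f) fun p q => D.counitR E (α (x * D.left.act p b) * ι q) := by
          rw [mul_assoc, embH_mul_emb, mul_sw, map_sw]
          simp only [map_mul, mul_assoc]
      _ = sw (δ f) fun p q => sw (δ q) fun q r =>
            D.φ (D.ract x r * D.ract b (𝑺 p * q)) := by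
          simp only [counitR_apply, ← φ_ract, mul_ract, map_sw, act_eq_ract, ract_ract]
      _ = D.φ (D.ract x f * b) := by
          rw [← sw_coassoc (f := fun p q r => D.φ (D.ract x r * D.ract b (𝑺 p * q))),
            sw_cancel_left_antipode_mul (f := fun q r => D.φ (D.ract x r * D.ract b q)),
            ract_unit]
      _ = _ := by rw [φ_mul, φ_ract, counitR_apply]
  | hadd s t hs ht => simp only [map_add, mul_add, add_mul, hs, ht]

/-- In the family f γ(y) the right counit takes the simple form that the left counit has on α(x)f.
-/
theorem counitR_embH_mul_sourceR (f : H) (y : L) :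
    D.counitR E (ι f * γ y) = ε f • D.φ y := by
  calc _ = sw (D.left.coact y) fun u v => D.counitR E (ι (f * 𝑺 (𝑺 v)) * α u) := by
        rw [sourceR_apply, mul_sw, map_sw]
        simp only [map_mul, mul_assoc]
    _ = sw (D.left.coact y) fun u v => ε v • ε f • D.φ u := by
        simp only [counitR_mul_emb, counitR_embH, Bialgebra.counit_mul, counit_antipode,
          mul_smul_comm, mul_one, smul_smul]
        congr! 3 with u v
        rw [mul_comm]
    _ = _ := D.left.sw_coact_counit y fun u => ε f • D.φ u

theorem counitR_mul_sourceR (z : K) (c : L) :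
    D.counitR E (z * γ c) = D.counitR E z * D.φ c := by
  induction z using D.induction_sourceR E with
  | h f x =>
    rw [mul_assoc, ← sourceR_mul, counitR_embH_mul_sourceR, counitR_embH_mul_sourceR, φ_mul,
      smul_mul_assoc]
  | hadd s t hs ht => simp only [map_add, add_mul, hs, ht]

theorem counitR_bimodule (a b : R) (z : K) :
    D.counitR E (z * (D.stR E).source a * (D.stR E).target b) = b * D.counitR E z * a := by
  rw [stR_source, stR_target, counitR_mul_emb, counitR_mul_sourceR, D.φ.apply_symm_apply,
    D.φ.apply_symm_apply, mul_assoc]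

theorem counitR_sourceR (x : L) : D.counitR E (γ x) = D.φ x := by
  have := D.counitR_mul_sourceR E 1 x
  rwa [one_mul, ← map_one (α), counitR_emb, φ_one, one_mul] at this

/-- The right bialgebroid over `R`. -/
def rightBialgebroid : RightBialgebroid k R K where
  st := D.stR E
  comul := D.comulR E
  counit := D.counitR E
  comul_source := D.comulR_mul_source E
  comul_target := D.comulR_mul_target E
  counit_bimodule := D.counitR_bimodule E
  coassoc z := by
    induction z using D.induction_emb E with
    | h x f =>
      simp only [comulR_apply, map_sw, BTensor₃.mapLeft_proj, BTensor₃.mapRight_proj, comulR_embH,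
        sw_apply, BTensor₃.ofLeft_proj, BTensor₃.ofRight_proj]
      rw [sw_coassoc]
    | hadd s t hs ht => simp only [map_add, hs, ht]
  counit_left z := by
    -- On f γ(x) the first leg of the coproduct lies in H, where the counit is ε.
    induction z using D.induction_sourceR E with
    | h f x =>
      rw [comulR_embH_mul_sourceR, map_sw]
      change (sw (δ f) fun p q => ι q * γ x * (D.stR E).target (D.counitR E (ι p))) = _
      simp only [counitR_embH, map_smul, mul_smul_comm, (D.stR E).target_one, mul_one]
      exact sw_counit_smul f fun q => ι q * γ x
    | hadd s t hs ht => simp only [map_add, hs, ht]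
  counit_right z := by
    induction z using D.induction_emb E with
    | h x f =>
      rw [comulR_apply, map_sw]
      change (sw (δ f) fun p q => α x * ι p * (D.stR E).source (D.counitR E (ι q))) = _
      simp only [counitR_embH, map_smul, mul_smul_comm, map_one, mul_one]
      exact sw_counit_smul_right f fun p => α x * ι p
    | hadd s t hs ht => simp only [map_add, hs, ht]
  takeuchi := D.takeuchiR E
  dot_one t := by
    induction t using BTensor.induction with
    | h m n =>
      refine (BTensor.lift_proj _ _ _).trans ?_
      rw [comulR_one, SourceTarget.dotR_proj, Algebra.TensorProduct.tmul_mul_tmul,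
        mul_one, mul_one]
    | hadd s t hs ht => simp only [map_add, hs, ht]
  dot_mul x y t := by
    induction t using BTensor.induction with
    | h m n => exact D.dotR_comulR_mul E x y m n
    | hadd s t hs ht => simp only [map_add, hs, ht]
  counit_source_one a := by
    rw [mul_one, stR_source, counitR_sourceR, D.φ.apply_symm_apply]
  counit_source_mul x y a := by
    -- The counit carries right multiplication by H to the action on R and right multiplication by
    -- γ(z) to right multiplication by φ(z), so only the second factor has to be decomposed.
    induction y using D.induction_sourceR E with
    | h f z =>
      rw [← mul_assoc x, ← mul_assoc, ← mul_assoc, ← mul_assoc, counitR_mul_sourceR,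
        counitR_mul_sourceR, counitR_mul_embH, counitR_mul_embH]
      simp only [stR_source, counitR_sourceR, D.φ.apply_symm_apply]
    | hadd s t hs ht => simp only [map_add, mul_add, hs, ht]

end CompatiblePair

/-! ### The antipode and the symmetric Hopf algebroid -/

namespace CompatiblePair

variable {k H L R K : Type*} [Field k] [Ring H] [HopfAlgebra k H] [Ring L] [Algebra k L]
  [Ring R] [Algebra k R] [Ring K] [Algebra k K]
  (D : CompatiblePair k H L R) (E : D.left.Smash ≃ₐ[k] K)

local notation "δ" => Coalgebra.comul (R := k) (A := H)
local notation "ε" => Coalgebra.counit (R := k) (A := H)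
local notation "𝑺" => HopfAlgebra.antipode k (A := H)
local notation "α" => emb D E
local notation "ι" => embH D E
local notation "β" => targetL D E
local notation "γ" => sourceR D E

theorem counitL_sourceR (x : L) : D.counitL E (γ x) = D.theta x := by
  rw [sourceR_apply, theta_apply, map_sw]
  congr! 3 with u v
  have := D.counitL_mul E 1 (𝑺 (𝑺 v)) (α u)
  rwa [map_one, one_mul, one_mul, counitL_emb] at this

theorem counitR_targetL (x : L) : D.counitR E (β x) = D.φ (D.eta x) := by
  rw [targetL_apply, eta_apply, map_sw, map_sw]
  simp only [counitR_apply, φ_ract]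

/-- The converse of γ = β ∘ θ; only θ ∘ η = id is required. -/
theorem targetL_eq (x : L) : β x = γ (D.eta x) := by rw [sourceR_eq, theta_eta]

/-- The antipode `x ♯ f ↦ S f · S² x₁ · x₀`. -/
def tau : K →ₗ[k] K := D.ofSharp E (linMap₂ fun x f => ι (𝑺 f) * γ x)

theorem tau_apply (x : L) (f : H) : D.tau E (α x * ι f) = ι (𝑺 f) * γ x :=
  D.ofSharp_apply E _ x f

theorem tau_emb (x : L) : D.tau E (α x) = γ x := by
  have := D.tau_apply E x 1
  rwa [map_one, mul_one, antipode_one, map_one, one_mul] at this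

theorem tau_embH (f : H) : D.tau E (ι f) = ι (𝑺 f) := by
  have := D.tau_apply E 1 f
  rwa [map_one, one_mul, sourceR_one, mul_one] at this

theorem tau_one : D.tau E 1 = 1 := by rw [← map_one (ι), tau_embH, antipode_one]

theorem tau_emb_mul (x : L) (z : K) : D.tau E (α x * z) = D.tau E z * γ x := by
  induction z using D.induction_emb E with
  | h y g => rw [← mul_assoc, ← map_mul, tau_apply, tau_apply, sourceR_mul, mul_assoc]
  | hadd s t hs ht => simp only [map_add, add_mul, mul_add, hs, ht]

/-- The antipode turns f₁ ▷ y into γ(y ◁ Sf₁). Since S reverses the coproduct, S(f₂)γ(y ◁ Sf₁) is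
what arises from moving γ(y) past Sf. -/
theorem tau_embH_mul (f : H) (z : K) : D.tau E (ι f * z) = D.tau E z * ι (𝑺 f) := by
  induction z using D.induction_emb E with
  | h y g =>
    calc _ = sw (δ f) fun p q => D.tau E (α (D.left.act p y) * ι (q * g)) := by
          rw [← mul_assoc, embH_mul_emb, sw_mul, map_sw]
          simp only [map_mul, mul_assoc]
      _ = sw (δ f) fun p q => ι (𝑺 g) * (ι (𝑺 q) * γ (D.ract y (𝑺 p))) := by
          simp only [tau_apply]
          simp only [antipode_mul_antidistrib, map_mul, act_eq_ract, mul_assoc]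
      _ = _ := by
          rw [tau_apply, mul_assoc, sourceR_mul_embH,
            sw_comul_antipode (f := fun p q => ι p * γ (D.ract y q)), mul_sw]
  | hadd s t hs ht => simp only [map_add, add_mul, mul_add, hs, ht]

theorem tau_mul (y z : K) : D.tau E (y * z) = D.tau E z * D.tau E y := by
  induction y using D.induction_emb E with
  | h x f => rw [mul_assoc, tau_emb_mul, tau_embH_mul, tau_apply, mul_assoc]
  | hadd s t hs ht => simp only [map_add, add_mul, mul_add, hs, ht]

/-- Applied to x₀ ♯ x₁, the antipode gives S(x₁)γ(x₀), the expansion of α(x) in the second spanning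
family. -/
theorem tau_targetL (x : L) : D.tau E (β x) = α x := by
  rw [targetL_apply, map_sw, emb_eq_sw_sourceR]
  simp only [tau_apply]

/-- Both sides are the class of x f₁ ⊗ f₂ ⊗ f₃. -/
theorem comulR_comulL (hc hc' hf hg) (z : K) :
    BTensor₃.mapLeft (l₁ := fun b => LinearMap.mulRight k ((D.stR E).target b))
      (r₂ := fun a => LinearMap.mulLeft k ((D.stL E).target a))
      (l₂ := fun a => LinearMap.mulLeft k ((D.stL E).source a)) hc
      (D.comulR E) (fun a => LinearMap.mulLeft k ((D.stL E).target a)) hf (D.comulL E z) =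
    BTensor₃.mapRight (r₁ := fun b => LinearMap.mulRight k ((D.stR E).source b))
      (l₁ := fun b => LinearMap.mulRight k ((D.stR E).target b))
      (r₂ := fun a => LinearMap.mulLeft k ((D.stL E).target a)) hc'
      (D.comulL E) (fun b => LinearMap.mulRight k ((D.stR E).target b)) hg (D.comulR E z) := by
  induction z using D.induction_emb E with
  | h x f =>
    simp only [comulL_apply, comulR_apply, map_sw, BTensor₃.mapLeft_proj, BTensor₃.mapRight_proj,
      comulL_embH, sw_apply, BTensor₃.ofLeft_proj, BTensor₃.ofRight_proj]
    rw [sw_coassoc]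
  | hadd s t hs ht => simp only [map_add, hs, ht]

theorem comulL_comulR (hc hc' hf hg) (z : K) :
    BTensor₃.mapLeft (l₁ := fun a => LinearMap.mulLeft k ((D.stL E).source a))
      (r₂ := fun b => LinearMap.mulRight k ((D.stR E).source b))
      (l₂ := fun b => LinearMap.mulRight k ((D.stR E).target b)) hc
      (D.comulL E) (fun b => LinearMap.mulRight k ((D.stR E).source b)) hf (D.comulR E z) =
    BTensor₃.mapRight (r₁ := fun a => LinearMap.mulLeft k ((D.stL E).target a))
      (l₁ := fun a => LinearMap.mulLeft k ((D.stL E).source a))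
      (r₂ := fun b => LinearMap.mulRight k ((D.stR E).source b)) hc'
      (D.comulR E) (fun a => LinearMap.mulLeft k ((D.stL E).source a)) hg (D.comulL E z) := by
  induction z using D.induction_emb E with
  | h x f =>
    simp only [comulL_apply, comulR_apply, map_sw, BTensor₃.mapLeft_proj, BTensor₃.mapRight_proj,
      comulR_embH, sw_apply, BTensor₃.ofLeft_proj, BTensor₃.ofRight_proj]
    rw [sw_coassoc]
  | hadd s t hs ht => simp only [map_add, hs, ht]

/-- The symmetric Hopf algebroid structure on an algebra `K` isomorphic to `L ♯ H`. -/
def symmetricHopfAlgebroid : SymmetricHopfAlgebroid k L R K where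
  left := D.leftBialgebroid E
  right := D.rightBialgebroid E
  antipode := D.tau E
  antipode_one := D.tau_one E
  antipode_mul := D.tau_mul E
  source_counit_target_right b := congrArg (α) (D.counitL_emb E _)
  target_counit_source_right b := by
    -- Since ε_L ∘ γ = θ, this is the identity β ∘ θ = γ.
    change β (D.counitL E (γ (D.φ.symm b))) = γ (D.φ.symm b)
    rw [counitL_sourceR, sourceR_eq]
  source_counit_target_left a := by
    -- Since φ⁻¹ ∘ ε_R ∘ β = η, this is the identity γ ∘ η = β.
    change γ (D.φ.symm (D.counitR E (β a))) = β a
    rw [counitR_targetL, D.φ.symm_apply_apply, targetL_eq]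
  target_counit_source_left a := by
    change α (D.φ.symm (D.counitR E (α a))) = α a
    rw [counitR_emb, D.φ.symm_apply_apply]
  mixed_coassoc₁ := D.comulR_comulL E _ _ _ _
  mixed_coassoc₂ := D.comulL_comulR E _ _ _ _
  antipode_target_left := D.tau_targetL E
  antipode_target_right b := D.tau_emb E _
  mul_antipode_left z := by
    change (D.stL E).mulAntipodeL _ _ _ (D.comulL E z) = γ (D.φ.symm (D.counitR E z))
    induction z using D.induction_emb E with
    | h x f =>
      rw [comulL_apply, map_sw, counitR_apply, ← φ_ract, D.φ.symm_apply_apply]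
      calc _ = sw (δ f) fun p q => D.tau E (α x * ι p) * ι q := rfl
        -- Moving γ(x) past f₂ brings S(f₁) next to f₂, and γ(x ◁ f) remains.
        _ = sw (δ f) fun p q => sw (δ q) fun q r => ι (𝑺 p * q) * γ (D.ract x r) := by
          simp only [tau_apply, mul_assoc, sourceR_mul_embH, mul_sw, map_mul]
        _ = _ := by
          rw [← sw_coassoc (f := fun p q r => ι (𝑺 p * q) * γ (D.ract x r)),
            sw_cancel_left_antipode_mul (f := fun q r => ι q * γ (D.ract x r)), map_one, one_mul]
    | hadd s t hs ht => simp only [map_add, hs, ht]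
  mul_antipode_right z := by
    change (D.stR E).mulAntipodeR _ _ _ (D.comulR E z) = α (D.counitL E z)
    induction z using D.induction_emb E with
    | h x f =>
      rw [comulR_apply, map_sw, counitL_apply]
      calc _ = sw (δ f) fun p q => α x * ι p * D.tau E (ι q) := rfl
        _ = sw (δ f) fun p q => α x * ι (p * 𝑺 q) := by
          simp only [tau_embH, mul_assoc, map_mul]
        _ = _ := by
          rw [sw_mul_antipode (f := fun q => α x * ι q), map_one, mul_one, map_smul]
    | hadd s t hs ht => simp only [map_add, hs, ht]

/-! ### Transport along isomorphisms -/

section Iso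

variable {K' : Type*} [Ring K'] [Algebra k K'] (E' : D.left.Smash ≃ₐ[k] K') (Ψ : K ≃ₐ[k] K')

theorem map_emb (hΨ : ∀ z, Ψ (E z) = E' z) (x : L) : Ψ (α x) = emb D E' x := hΨ _

theorem map_embH (hΨ : ∀ z, Ψ (E z) = E' z) (f : H) : Ψ (ι f) = embH D E' f := hΨ _

theorem map_targetL (hΨ : ∀ z, Ψ (E z) = E' z) (x : L) : Ψ (β x) = targetL D E' x := by
  simp only [targetL_apply, map_sw, map_mul, map_emb D E E' Ψ hΨ, map_embH D E E' Ψ hΨ]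

theorem map_sourceR (hΨ : ∀ z, Ψ (E z) = E' z) (x : L) : Ψ (γ x) = sourceR D E' x := by
  simp only [sourceR_apply, map_sw, map_mul, map_emb D E E' Ψ hΨ, map_embH D E E' Ψ hΨ]

/-- All structure maps are given by the same formulas in α and ι, which Ψ carries to their
counterparts for `E'`. -/
theorem isIso (hΨ : ∀ z, Ψ (E z) = E' z) :
     (D.symmetricHopfAlgebroid E).IsIso (D.symmetricHopfAlgebroid E') Ψ where
  source_left := D.map_emb E E' Ψ hΨ
  target_left := D.map_targetL E E' Ψ hΨ
  source_right _ := D.map_sourceR E E' Ψ hΨ _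
  target_right _ := D.map_emb E E' Ψ hΨ _
  counit_left z := by
    change D.counitL E' (Ψ z) = D.counitL E z
    induction z using D.induction_emb E with
    | h x f => rw [map_mul, map_emb D E E' Ψ hΨ, map_embH D E E' Ψ hΨ, counitL_apply, counitL_apply]
    | hadd s t hs ht => simp only [map_add, hs, ht]
  counit_right z := by
    change D.counitR E' (Ψ z) = D.counitR E z
    induction z using D.induction_emb E with
    | h x f => rw [map_mul, map_emb D E E' Ψ hΨ, map_embH D E E' Ψ hΨ, counitR_apply, counitR_apply]
    | hadd s t hs ht => simp only [map_add, hs, ht]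
  comul_left z := by
    change SourceTarget.mapL (s := D.stL E) (s' := D.stL E') _ _ _ (D.comulL E z) =
      D.comulL E' (Ψ z)
    have e : ∀ x f, Ψ (α x * ι f) = emb D E' x * embH D E' f := fun x f => by
      rw [map_mul, map_emb D E E' Ψ hΨ, map_embH D E E' Ψ hΨ]
    induction z using D.induction_emb E with
    | h x f =>
      rw [e, comulL_apply, comulL_apply, map_sw]
      congr! 3 with p q
      rw [← e, ← map_embH D E E' Ψ hΨ]
      rfl
    | hadd s t hs ht => simp only [map_add, hs, ht]
  comul_right z := by
    change SourceTarget.mapR (s := D.stR E) (s' := D.stR E') _ _ _ (D.comulR E z) =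
      D.comulR E' (Ψ z)
    have e : ∀ x f, Ψ (α x * ι f) = emb D E' x * embH D E' f := fun x f => by
      rw [map_mul, map_emb D E E' Ψ hΨ, map_embH D E E' Ψ hΨ]
    induction z using D.induction_emb E with
    | h x f =>
      rw [e, comulR_apply, comulR_apply, map_sw]
      congr! 3 with p q
      rw [← e, ← map_embH D E E' Ψ hΨ]
      rfl
    | hadd s t hs ht => simp only [map_add, hs, ht]
  antipode z := by
    change Ψ (D.tau E z) = D.tau E' (Ψ z)
    induction z using D.induction_emb E with
    | h x f =>
      rw [tau_apply, map_mul, map_mul, map_emb D E E' Ψ hΨ, map_embH D E E' Ψ hΨ,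
        map_embH D E E' Ψ hΨ, map_sourceR D E E' Ψ hΨ, tau_apply]
    | hadd s t hs ht => simp only [map_add, hs, ht]

end Iso

end CompatiblePair

/-! ### Commutation relations in H ♯ R -/

namespace RightModuleAlgebra

variable {k H R : Type*} [Field k] [Ring H] [Bialgebra k H] [Ring R] [Algebra k R]
  (D : RightModuleAlgebra k H R)

theorem inl_mul_inr (f : H) (y : R) : D.inl f * D.inr y = D.sharp f y := by
  rw [inl_apply, inr_apply, sharp_mul_sharp, Bialgebra.comul_one, Algebra.TensorProduct.one_def]
  simp [D.act_unit]
  rfl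

theorem inr_mul_inl (f : H) (y : R) : D.inr y * D.inl f =
    sw (comul (R := k) f) fun p q => D.inl p * D.inr (D.act y q) := by
  rw [inl_apply, inr_apply, sharp_mul_sharp, map_eq_sw, map_sw]
  simp only [inl_mul_inr, LinearMap.comp_apply, LinearMap.mulLeft_apply, LinearMap.mulRight_apply,
    one_mul, mul_one]
  rfl

theorem induction_inl_mul_inr {p : D.Smash → Prop} (h : ∀ f y, p (D.inl f * D.inr y))
    (hadd : ∀ s t, p s → p t → p (s + t)) (z : D.Smash) : p z := by
  obtain ⟨t, rfl⟩ := D.ofTensor.surjective z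
  induction t with
  | zero => simpa using h 0 0
  | tmul f y =>
    have := h f y
    rwa [inl_mul_inr] at this
  | add s t hs ht => simpa only [map_add] using hadd _ _ hs ht

end RightModuleAlgebra

namespace RLYetterDrinfeldAlgebra

variable {k H R : Type*} [Field k] [Ring H] [Ring R] [Algebra k R]

local notation "δ" => Coalgebra.comul (R := k) (A := H)
local notation "𝑺" => HopfAlgebra.antipode k (A := H)

section Bialgebra

variable [Bialgebra k H] (D : RLYetterDrinfeldAlgebra k H R)

/-- The coaction as a map `R → H ♯ R`. -/
def lam : R →ₗ[k] D.Smash := D.ofTensor.toLinearMap ∘ₗ D.coact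

theorem lam_apply (y : R) : D.lam y = sw (D.coact y) fun u v => D.inl u * D.inr v := by
  simp only [RightModuleAlgebra.inl_mul_inr]
  conv_lhs => rw [lam, LinearMap.comp_apply, ← sw_tmul_self (D.coact y), map_sw]
  rfl

theorem lam_one : D.lam 1 = 1 := by
  rw [lam_apply, D.sw_coact_one (f := fun u v => D.inl u * D.inr v), map_one, map_one, one_mul]

/-- Moving a past y₋₁ on the left side produces (a ◁ y₋₁)y₀, which braided commutativity of R
replaces by ya. -/
theorem inr_mul_lam (hD : D.BraidedCommutative) (a y : R) :
    D.inr a * D.lam y = D.lam y * D.inr a := by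
  rw [lam_apply, mul_sw, sw_mul]
  simp only [← mul_assoc, RightModuleAlgebra.inr_mul_inl, sw_mul]
  rw [D.sw_coact_coassoc (f := fun p q v => D.inl p * D.inr (D.act a q) * D.inr v)]
  congr! 3 with u v
  rw [mul_assoc, ← map_mul, ← hD.sw_eq, map_sw, mul_sw]
  simp only [map_mul, mul_assoc]

theorem lam_mul (hD : D.BraidedCommutative) (a b : R) :
    D.lam (a * b) = D.lam b * D.lam a := by
  rw [lam_apply, D.sw_coact_mul (f := fun u v => D.inl u * D.inr v), sw_comm, D.lam_apply b, sw_mul]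
  congr! 3 with u v
  rw [mul_assoc, inr_mul_lam D hD, lam_apply, sw_mul, mul_sw]
  simp only [map_mul, mul_assoc]

theorem lam_mul_inl (h : H) (y : R) :
    D.lam y * D.inl h = sw (δ h) fun p q => D.inl q * D.lam (D.act y p) := by
  have := D.sw_yetterDrinfeld h y fun u v => D.inl u * D.inr v
  simp only [lam_apply, mul_sw, sw_mul, ← mul_assoc, ← map_mul D.inl]
  rw [← this]
  congr! 3 with u v
  rw [mul_assoc, RightModuleAlgebra.inr_mul_inl, mul_sw]
  simp only [map_mul, mul_assoc]

end Bialgebra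

/-- `lam_mul_inl` solved for the opposite order. By φ(h ▷ x) = φ(x) ◁ Sh it is the L ♯ H product
rule carried to λ ∘ φ. -/
theorem inl_mul_lam [HopfAlgebra k H] (D : RLYetterDrinfeldAlgebra k H R) (h : H) (y : R) :
    D.inl h * D.lam y = sw (δ h) fun p q => D.lam (D.act y (𝑺 p)) * D.inl q := by
  simp only [lam_mul_inl, ← D.act_act]
  rw [← sw_coassoc (f := fun p q r => D.inl r * D.lam (D.act y (𝑺 p * q))),
    sw_cancel_left_antipode_mul (f := fun q r => D.inl r * D.lam (D.act y q)), D.act_unit]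

end RLYetterDrinfeldAlgebra

/-! ### The isomorphism Ψ and its inverse -/

namespace CompatiblePair

variable {k H L R : Type*} [Field k] [Ring H] [HopfAlgebra k H] [Ring L] [Algebra k L]
  [Ring R] [Algebra k R] (D : CompatiblePair k H L R)

local notation "δ" => Coalgebra.comul (R := k) (A := H)
local notation "ε" => Coalgebra.counit (R := k) (A := H)
local notation "𝑺" => HopfAlgebra.antipode k (A := H)
local notation "α" => emb D AlgEquiv.refl
local notation "ι" => embH D AlgEquiv.refl
local notation "γ" => sourceR D AlgEquiv.refl

/-- The linear map `L ♯ H → H ♯ R`, `x ♯ f ↦ λ(φ x) · f`. -/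
def smashMap : D.left.Smash →ₗ[k] D.right.Smash :=
  D.ofSharp AlgEquiv.refl (linMap₂ fun x f => D.right.lam (D.φ x) * D.right.inl f)

theorem smashMap_apply (x : L) (f : H) :
    D.smashMap (α x * ι f) = D.right.lam (D.φ x) * D.right.inl f :=
  D.ofSharp_apply AlgEquiv.refl _ x f

theorem smashMap_emb (x : L) : D.smashMap (α x) = D.right.lam (D.φ x) := by
  have := D.smashMap_apply x 1
  rwa [map_one, mul_one, map_one, mul_one] at this

theorem smashMap_embH (f : H) : D.smashMap (ι f) = D.right.inl f := by
  have := D.smashMap_apply 1 f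
  rwa [map_one, one_mul, φ_one, D.right.lam_one, one_mul] at this

/-- λ ∘ φ is a homomorphism, being a composite of two antihomomorphisms, and it satisfies with H the
relation that defines L ♯ H. -/
theorem smashMap_mul (y z : D.left.Smash) :
    D.smashMap (y * z) = D.smashMap y * D.smashMap z := by
  induction y using D.induction_emb AlgEquiv.refl with
  | h x f =>
    induction z using D.induction_emb AlgEquiv.refl with
    | h y g =>
      calc _ = sw (δ f) fun p q => D.smashMap (α (x * D.left.act p y) * ι (q * g)) := by
            rw [mul_assoc, ← mul_assoc (ι f), embH_mul_emb, sw_mul, mul_sw, map_sw]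
            simp only [map_mul, mul_assoc]
        _ = _ := by
            simp only [smashMap_apply]
            rw [mul_assoc, ← mul_assoc (D.right.inl f), RLYetterDrinfeldAlgebra.inl_mul_lam,
              sw_mul, mul_sw]
            simp only [φ_mul, D.right.lam_mul D.braided_right, map_mul, D.compatible.map_act,
              mul_assoc]
    | hadd s t hs ht => simp only [map_add, mul_add, hs, ht]
  | hadd s t hs ht => simp only [map_add, add_mul, hs, ht]

/-- As λ(φ x) = S(x₁) ♯ φ(x₀), the image is S²(x₂)S(x₁) ♯ φ(x₀), and S(x₁S(x₂)) reduces to the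
counit. So γ(x) is the element of R inside L ♯ H. -/
theorem smashMap_sourceR (x : L) : D.smashMap (γ x) = D.right.inr (D.φ x) := by
  simp only [sourceR_apply, map_sw, smashMap_mul, smashMap_emb, smashMap_embH,
    RLYetterDrinfeldAlgebra.lam_apply, sw_coact_φ, mul_sw]
  rw [D.left.sw_coact_coassoc
    (f := fun a b c => D.right.inl (𝑺 (𝑺 c)) * (D.right.inl (𝑺 b) * D.right.inr (D.φ a)))]
  simp only [← mul_assoc, ← map_mul D.right.inl, ← antipode_mul_antidistrib]
  calc _ = sw (D.left.coact x) fun u v => ε v • (D.right.inl (𝑺 1) * D.right.inr (D.φ u)) := by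
        congr! 3 with u v
        rw [sw_mul_antipode (f := fun v => D.right.inl (𝑺 v) * D.right.inr (D.φ u))]
    _ = _ := by
        rw [D.left.sw_coact_counit (f := fun u => D.right.inl (𝑺 1) * D.right.inr (D.φ u)),
          antipode_one, map_one, one_mul]

/-- The linear map `H ♯ R → L ♯ H`, `f ♯ y ↦ f S y₋₁ · φ⁻¹ y₀`. -/
def smashInv : D.right.Smash →ₗ[k] D.left.Smash :=
  TensorProduct.lift (linMap₂ fun f y => ι f * γ (D.φ.symm y)) ∘ₗ D.right.ofTensor.symm.toLinearMap

theorem smashInv_apply (f : H) (y : R) :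
    D.smashInv (D.right.inl f * D.right.inr y) = ι f * γ (D.φ.symm y) := by
  rw [RightModuleAlgebra.inl_mul_inr]
  exact TensorProduct.lift.tmul _ _

theorem smashInv_smashMap (z : D.left.Smash) : D.smashInv (D.smashMap z) = z := by
  induction z using D.induction_emb AlgEquiv.refl with
  | h x f =>
    rw [smashMap_apply, RLYetterDrinfeldAlgebra.lam_apply, sw_mul, map_sw, sw_coact_φ
      (f := fun a b => D.smashInv (D.right.inl a * D.right.inr b * D.right.inl f)),
      emb_eq_sw_sourceR, sw_mul]
    congr! 3 with u v
    -- R and the image of γ have the same commutation rule with H, so the two sums agree term by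
    -- term.
    rw [mul_assoc, mul_assoc, RightModuleAlgebra.inr_mul_inl, sourceR_mul_embH, mul_sw, mul_sw,
      map_sw]
    congr! 3 with p q
    rw [← mul_assoc, ← map_mul, smashInv_apply, map_mul, ← ract_apply, mul_assoc]
  | hadd s t hs ht => simp only [map_add, hs, ht]

theorem smashMap_smashInv (z : D.right.Smash) : D.smashMap (D.smashInv z) = z := by
  induction z using D.right.induction_inl_mul_inr with
  | h f y =>
    rw [smashInv_apply, smashMap_mul, smashMap_embH, smashMap_sourceR, D.φ.apply_symm_apply]
  | hadd s t hs ht => simp only [map_add, hs, ht]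

/-- The isomorphism `L ♯ H ≃ H ♯ R`. -/
def smashEquiv : D.left.Smash ≃ₐ[k] D.right.Smash :=
  AlgEquiv.ofLinearEquiv
    { D.smashMap with
      invFun := D.smashInv
      left_inv := D.smashInv_smashMap
      right_inv := D.smashMap_smashInv }
    ((congrArg D.smashMap (map_one (ι)).symm).trans ((D.smashMap_embH 1).trans (map_one _)))
    D.smashMap_mul

theorem emb_smashEquiv (x : L) : emb D D.smashEquiv x = D.right.lam (D.φ x) := D.smashMap_emb x

theorem embH_smashEquiv (f : H) : embH D D.smashEquiv f = D.right.inl f := D.smashMap_embH f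

theorem sourceR_smashEquiv (x : L) : sourceR D D.smashEquiv x = D.right.inr (D.φ x) :=
  (D.map_sourceR AlgEquiv.refl D.smashEquiv D.smashEquiv (fun _ => rfl) x).symm.trans
    (D.smashMap_sourceR x)

/-! ### Structure maps on products f γ(x), injectivity and images -/

section Sharp

variable {K : Type*} [Ring K] [Algebra k K] (E : D.left.Smash ≃ₐ[k] K)

theorem comulL_embH_mul_sourceR (f : H) (x : L) :
    D.comulL E (embH D E f * sourceR D E x) = sw (δ f) fun p q =>
      (D.stL E).projL (embH D E p ⊗ₜ (embH D E q * sourceR D E x)) := by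
  -- `G` stands for right multiplication of the second leg by γ(x); since γ(x) = β(θ(x)) lies in the
  -- image of the target, the coproduct is compatible with it.
  have key : ∀ G : (D.stL E).TensorL →ₗ[k] (D.stL E).TensorL,
      D.comulL E (embH D E f * sourceR D E x) = G (D.comulL E (embH D E f)) →
      (∀ m n, G ((D.stL E).projL (m ⊗ₜ n)) = (D.stL E).projL (m ⊗ₜ (n * sourceR D E x))) →
      D.comulL E (embH D E f * sourceR D E x) = sw (δ f) fun p q =>
        (D.stL E).projL (embH D E p ⊗ₜ (embH D E q * sourceR D E x)) := fun G h h' => by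
    rw [h, comulL_embH, map_sw]
    simp only [h']
  exact key _ ((D.leftBialgebroid E).comul_mul_target (embH D E f) (sourceR D E x) (D.theta x)
    (D.sourceR_eq E x).symm) fun _ _ => rfl

theorem counitL_embH_mul_sourceR (f : H) (x : L) :
    D.counitL E (embH D E f * sourceR D E x) = D.left.act f (D.theta x) := by
  have := D.counitL_mul E 1 f (sourceR D E x)
  rwa [map_one, one_mul, one_mul, counitL_sourceR] at this

theorem tau_sourceR (x : L) : D.tau E (sourceR D E x) =
    sw (D.left.coact x) fun u v => sourceR D E u * embH D E (𝑺 (𝑺 (𝑺 v))) := by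
  rw [sourceR_apply, map_sw]
  simp only [tau_mul, tau_emb, tau_embH]

theorem tau_embH_mul_sourceR (f : H) (x : L) :
    D.tau E (embH D E f * sourceR D E x) = sw (D.left.coact x) fun u v =>
      sourceR D E u * embH D E (𝑺 (𝑺 (𝑺 v)) * 𝑺 f) := by
  rw [tau_mul, tau_sourceR, tau_embH, sw_mul]
  simp only [map_mul, mul_assoc]

theorem injective_emb : Function.Injective (emb D E) :=
  Function.LeftInverse.injective (D.counitL_emb E)

/-- The right counit recovers φ(x) from γ(x). -/
theorem injective_sourceR : Function.Injective (sourceR D E) := fun x y h =>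
  D.φ.injective (by rw [← counitR_sourceR D E, h, counitR_sourceR])

theorem range_targetL : Set.range (targetL D E) = Set.range (sourceR D E) := by
  refine Set.Subset.antisymm ?_ ?_
  · rintro _ ⟨x, rfl⟩
    exact ⟨D.eta x, (D.targetL_eq E x).symm⟩
  · rintro _ ⟨x, rfl⟩
    exact ⟨D.theta x, (D.sourceR_eq E x).symm⟩

theorem injective_source_left : Function.Injective (D.symmetricHopfAlgebroid E).left.st.source :=
  D.injective_emb E

theorem injective_source_right :
    Function.Injective (D.symmetricHopfAlgebroid E).right.st.source :=
  (D.injective_sourceR E).comp D.φ.symm.injective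

theorem range_source_left : Set.range (D.symmetricHopfAlgebroid E).left.st.source =
    Set.range (D.symmetricHopfAlgebroid E).right.st.target :=
  (D.φ.symm.surjective.range_comp (emb D E)).symm

theorem range_source_right : Set.range (D.symmetricHopfAlgebroid E).right.st.source =
    Set.range (D.symmetricHopfAlgebroid E).left.st.target :=
  (D.φ.symm.surjective.range_comp (sourceR D E)).trans (D.range_targetL E).symm

end Sharp

end CompatiblePair

/-- Over a field, k → L stays injective after tensoring with H. -/
theorem LeftModuleAlgebra.injective_inr {k H L : Type*} [Field k] [Ring H] [Bialgebra k H]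
    [Ring L] [Algebra k L] [Nontrivial L] (D : LeftModuleAlgebra k H L) :
    Function.Injective D.inr :=
  Algebra.TensorProduct.includeRight_injective (R := k) (A := L) (B := H)
    (algebraMap k L).injective

/-! ### Explicit structure maps in both presentations -/

namespace CompatiblePair

variable {k H L R : Type*} [Field k] [Ring H] [HopfAlgebra k H] [Ring L] [Algebra k L]
  [Ring R] [Algebra k R] (D : CompatiblePair k H L R)

local notation "δ" => Coalgebra.comul (R := k) (A := H)
local notation "𝑺" => HopfAlgebra.antipode k (A := H)

theorem smash_structure :
    let 𝓗 := D.symmetricHopfAlgebroid AlgEquiv.refl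
    (∀ x, 𝓗.left.st.source x = D.left.sharp x 1) ∧
      (∀ x, 𝓗.left.st.target x = D.left.ofTensor (D.left.coact x)) ∧
      (∀ x f, 𝓗.left.comul (D.left.sharp x f) =
        𝓗.left.st.projL (TensorProduct.map (D.left.sharp x) (D.left.sharp 1) (comul f))) ∧
      (∀ x f, 𝓗.left.counit (D.left.sharp x f) = counit (R := k) f • x) ∧
      (∀ y, 𝓗.right.st.source y = LinearMap.mul' k D.left.Smash
        (TensorProduct.map (D.left.inr.toLinearMap ∘ₗ antipode k)
          (D.left.inl.toLinearMap ∘ₗ D.φ.symm.toLinearMap) (D.right.coact y))) ∧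
      (∀ y, 𝓗.right.st.target y = D.left.sharp (D.φ.symm y) 1) ∧
      (∀ x f, 𝓗.right.comul (D.left.sharp x f) =
        𝓗.right.st.projR (TensorProduct.map (D.left.sharp x) (D.left.sharp 1) (comul f))) ∧
      (∀ x f, 𝓗.right.counit (D.left.sharp x f) = D.right.act (D.φ x) f) ∧
      (∀ x f, 𝓗.antipode (D.left.sharp x f) = LinearMap.mul' k D.left.Smash
        (TensorProduct.map
          (D.left.inr.toLinearMap ∘ₗ LinearMap.mulLeft k (antipode k f) ∘ₗ antipode k ∘ₗ antipode k)
          D.left.inl.toLinearMap (TensorProduct.comm k L H (D.left.coact x)))) := by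
  have sharp_eq : ∀ x f, D.left.sharp x f = emb D AlgEquiv.refl x * embH D AlgEquiv.refl f :=
    fun x f => (D.emb_mul_embH AlgEquiv.refl x f).symm
  have one_sharp : ∀ f, D.left.sharp 1 f = embH D AlgEquiv.refl f := fun f => rfl
  refine ⟨fun x => rfl, fun x => ?_, fun x f => ?_, fun x f => ?_, fun y => ?_, fun y => rfl,
    fun x f => ?_, fun x f => ?_, fun x f => ?_⟩
  · refine (D.targetL_apply AlgEquiv.refl x).trans ?_
    conv_rhs => rw [← sw_tmul_self (D.left.coact x), map_sw]
    simp only [← sharp_eq]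
    rfl
  · rw [sharp_eq, map_eq_sw, map_sw]
    refine (D.comulL_apply AlgEquiv.refl x f).trans ?_
    simp only [sharp_eq, map_one, one_mul]
    rfl
  · rw [sharp_eq]
    exact D.counitL_apply AlgEquiv.refl x f
  -- Writing y as φ(x) expresses its coaction by that of x; S(y₋₁) then becomes S²(x₁).
  · obtain ⟨x, rfl⟩ := D.φ.surjective y
    refine (congrArg (sourceR D AlgEquiv.refl) (D.φ.symm_apply_apply x)).trans ?_
    rw [map_eq_sw, map_sw, sw_coact_φ (f := fun a b => LinearMap.mul' k D.left.Smash
      ((D.left.inr.toLinearMap ∘ₗ antipode k) a ⊗ₜ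
        (D.left.inl.toLinearMap ∘ₗ D.φ.symm.toLinearMap) b))]
    simp only [LinearMap.comp_apply, LinearEquiv.coe_coe, D.φ.symm_apply_apply]
    rfl
  · rw [sharp_eq, map_eq_sw, map_sw]
    refine (D.comulR_apply AlgEquiv.refl x f).trans ?_
    simp only [sharp_eq, map_one, one_mul]
    rfl
  · rw [sharp_eq]
    exact D.counitR_apply AlgEquiv.refl x f
  · rw [sharp_eq, map_eq_sw, sw_comm_tensor, map_sw]
    refine (D.tau_apply AlgEquiv.refl x f).trans ?_
    rw [sourceR_apply, mul_sw]
    simp only [← mul_assoc, ← map_mul (embH D AlgEquiv.refl)]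
    rfl

theorem smash_structure_right :
    let 𝓗 := D.symmetricHopfAlgebroid D.smashEquiv
    (∀ x, 𝓗.left.st.source x = D.right.ofTensor (D.right.coact (D.φ x))) ∧
      (∀ x, 𝓗.left.st.target x =
        D.right.sharp 1 (TensorProduct.lift (D.right.act ∘ₗ D.φ.toLinearMap) (D.left.coact x))) ∧
      (∀ f y, 𝓗.left.comul (D.right.sharp f y) = 𝓗.left.st.projL
        (TensorProduct.map (D.right.sharp.flip 1) (D.right.sharp.flip y) (comul f))) ∧
      (∀ f y, 𝓗.left.counit (D.right.sharp f y) = TensorProduct.lift D.left.act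
        (TensorProduct.map (LinearMap.mulLeft k f ∘ₗ antipode k) D.φ.symm.toLinearMap
          (D.right.coact y))) ∧
      (∀ y, 𝓗.right.st.source y = D.right.sharp 1 y) ∧
      (∀ y, 𝓗.right.st.target y = D.right.ofTensor (D.right.coact y)) ∧
      (∀ f y, 𝓗.right.comul (D.right.sharp f y) = 𝓗.right.st.projR
        (TensorProduct.map (D.right.sharp.flip 1) (D.right.sharp.flip y) (comul f))) ∧
      (∀ f y, 𝓗.right.counit (D.right.sharp f y) = counit (R := k) f • y) ∧
      (∀ f y, 𝓗.antipode (D.right.sharp f y) = LinearMap.mul' k D.right.Smash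
        (TensorProduct.map D.right.inr.toLinearMap
          (D.right.inl.toLinearMap ∘ₗ LinearMap.mulRight k (antipode k f) ∘ₗ
            antipode k ∘ₗ antipode k)
          (TensorProduct.comm k H R (D.right.coact y)))) := by
  have sharp_eq : ∀ f x, D.right.sharp f (D.φ x) =
      embH D D.smashEquiv f * sourceR D D.smashEquiv x := fun f x => by
    rw [embH_smashEquiv, sourceR_smashEquiv, RightModuleAlgebra.inl_mul_inr]
  have sharp_one : ∀ f, D.right.sharp f 1 = embH D D.smashEquiv f := fun f => by
    rw [← D.φ_one, sharp_eq, sourceR_one, mul_one]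
  refine ⟨fun x => D.emb_smashEquiv x, fun x => ?_, fun f y => ?_, fun f y => ?_, fun y => ?_,
    fun y => ?_, fun f y => ?_, fun f y => ?_, fun f y => ?_⟩
  -- In H ♯ R the target is read through β = γ ∘ η, since γ is x ↦ 1 ♯ φ(x) there.
  · refine (D.targetL_eq D.smashEquiv x).trans ((D.sourceR_smashEquiv _).trans ?_)
    rw [eta_apply, map_sw, lift_eq_sw]
    simp only [φ_ract]
    rfl
  · obtain ⟨x, rfl⟩ := D.φ.surjective y
    rw [sharp_eq, map_eq_sw, map_sw]
    refine (D.comulL_embH_mul_sourceR D.smashEquiv f x).trans ?_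
    simp only [LinearMap.flip_apply, sharp_eq, sharp_one]
    rfl
  · obtain ⟨x, rfl⟩ := D.φ.surjective y
    rw [sharp_eq, map_eq_sw, map_sw, sw_coact_φ (f := fun a b => TensorProduct.lift D.left.act
      ((LinearMap.mulLeft k f ∘ₗ antipode k) a ⊗ₜ D.φ.symm.toLinearMap b))]
    refine (D.counitL_embH_mul_sourceR D.smashEquiv f x).trans ?_
    rw [theta_apply, map_sw]
    congr! 3 with u v
    simp only [TensorProduct.lift.tmul, LinearMap.comp_apply, LinearMap.mulLeft_apply,
      LinearEquiv.coe_coe, D.φ.symm_apply_apply, D.left.mul_act]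
  · exact (D.sourceR_smashEquiv _).trans (congrArg _ (D.φ.apply_symm_apply y))
  · exact (D.emb_smashEquiv _).trans (congrArg _ (D.φ.apply_symm_apply y))
  · obtain ⟨x, rfl⟩ := D.φ.surjective y
    rw [sharp_eq, map_eq_sw, map_sw]
    refine (D.comulR_embH_mul_sourceR D.smashEquiv f x).trans ?_
    simp only [LinearMap.flip_apply, sharp_eq, sharp_one]
    rfl
  · obtain ⟨x, rfl⟩ := D.φ.surjective y
    rw [sharp_eq]
    exact D.counitR_embH_mul_sourceR D.smashEquiv f x
  · obtain ⟨x, rfl⟩ := D.φ.surjective y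
    rw [sharp_eq, map_eq_sw, sw_comm_tensor, map_sw]
    rw [sw_coact_φ (f := fun a b => LinearMap.mul' k D.right.Smash
      (D.right.inr.toLinearMap b ⊗ₜ (D.right.inl.toLinearMap ∘ₗ
        LinearMap.mulRight k (antipode k f) ∘ₗ antipode k ∘ₗ antipode k) a))]
    refine (D.tau_embH_mul_sourceR D.smashEquiv f x).trans ?_
    simp only [embH_smashEquiv, sourceR_smashEquiv]
    rfl

theorem smashEquiv_symm_sharp (f : H) (y : R) : D.smashEquiv.symm (D.right.sharp f y) =
    LinearMap.mul' k D.left.Smash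
      (TensorProduct.map (D.left.inr.toLinearMap ∘ₗ LinearMap.mulLeft k f ∘ₗ antipode k)
        (D.left.inl.toLinearMap ∘ₗ D.φ.symm.toLinearMap) (D.right.coact y)) := by
  obtain ⟨x, rfl⟩ := D.φ.surjective y
  rw [map_eq_sw, map_sw, sw_coact_φ (f := fun a b => LinearMap.mul' k D.left.Smash
    ((D.left.inr.toLinearMap ∘ₗ LinearMap.mulLeft k f ∘ₗ antipode k) a ⊗ₜ
      (D.left.inl.toLinearMap ∘ₗ D.φ.symm.toLinearMap) b)), ← RightModuleAlgebra.inl_mul_inr]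
  refine (D.smashInv_apply f (D.φ x)).trans ?_
  rw [D.φ.symm_apply_apply, sourceR_apply, mul_sw]
  simp only [← mul_assoc, ← map_mul (embH D AlgEquiv.refl), LinearMap.comp_apply,
    LinearEquiv.coe_coe, D.φ.symm_apply_apply]
  rfl

theorem smashEquiv_inr (f : H) : D.smashEquiv (D.left.inr f) = D.right.inl f := D.smashMap_embH f

theorem smashEquiv_sharp (x : L) (f : H) : D.smashEquiv (D.left.sharp x f) =
    D.right.ofTensor (D.right.coact (D.φ x)) * D.right.inl f := by
  have := D.smashMap_apply x f
  rwa [emb_mul_embH] at this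

end CompatiblePair

end ScalarExtension

end

/-! ### The main theorem -/

theorem theorem4p5 {k H L R : Type*} [Field k] [Ring H] [HopfAlgebra k H]
    [Ring L] [Algebra k L] [Ring R] [Algebra k R]
    (𝓛 : LRYetterDrinfeldAlgebra k H L) (h𝓛 : 𝓛.BraidedCommutative)
    (𝓡 : RLYetterDrinfeldAlgebra k H R) (h𝓡 : 𝓡.BraidedCommutative)
    (φ : L ≃ₗ[k] R) (hφ : IsAntiIso φ) (hcompat : CompatibleVia 𝓛 𝓡 φ) :
    ∃ (𝓗 : SymmetricHopfAlgebroid k L R 𝓛.Smash) (𝓗' : SymmetricHopfAlgebroid k L R 𝓡.Smash)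
      (Ψ : 𝓛.Smash ≃ₐ[k] 𝓡.Smash),
      -- the structure maps of `L ♯ H`
      ((∀ x, 𝓗.left.st.source x = 𝓛.sharp x 1) ∧
        (∀ x, 𝓗.left.st.target x = 𝓛.ofTensor (𝓛.coact x)) ∧
        (∀ x f, 𝓗.left.comul (𝓛.sharp x f) =
          𝓗.left.st.projL (TensorProduct.map (𝓛.sharp x) (𝓛.sharp 1) (comul f))) ∧
        (∀ x f, 𝓗.left.counit (𝓛.sharp x f) = counit (R := k) f • x) ∧
        (∀ y, 𝓗.right.st.source y = LinearMap.mul' k 𝓛.Smash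
          (TensorProduct.map (𝓛.inr.toLinearMap ∘ₗ antipode k)
            (𝓛.inl.toLinearMap ∘ₗ φ.symm.toLinearMap) (𝓡.coact y))) ∧
        (∀ y, 𝓗.right.st.target y = 𝓛.sharp (φ.symm y) 1) ∧
        (∀ x f, 𝓗.right.comul (𝓛.sharp x f) =
          𝓗.right.st.projR (TensorProduct.map (𝓛.sharp x) (𝓛.sharp 1) (comul f))) ∧
        (∀ x f, 𝓗.right.counit (𝓛.sharp x f) = 𝓡.act (φ x) f) ∧
        (∀ x f, 𝓗.antipode (𝓛.sharp x f) = LinearMap.mul' k 𝓛.Smash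
          (TensorProduct.map
            (𝓛.inr.toLinearMap ∘ₗ LinearMap.mulLeft k (antipode k f) ∘ₗ antipode k ∘ₗ antipode k)
            𝓛.inl.toLinearMap (TensorProduct.comm k L H (𝓛.coact x))))) ∧
      -- the structure maps of `H ♯ R`
      ((∀ x, 𝓗'.left.st.source x = 𝓡.ofTensor (𝓡.coact (φ x))) ∧
        (∀ x, 𝓗'.left.st.target x =
          𝓡.sharp 1 (TensorProduct.lift (𝓡.act ∘ₗ φ.toLinearMap) (𝓛.coact x))) ∧
        (∀ f y, 𝓗'.left.comul (𝓡.sharp f y) =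
          𝓗'.left.st.projL (TensorProduct.map (𝓡.sharp.flip 1) (𝓡.sharp.flip y) (comul f))) ∧
        (∀ f y, 𝓗'.left.counit (𝓡.sharp f y) = TensorProduct.lift 𝓛.act
          (TensorProduct.map (LinearMap.mulLeft k f ∘ₗ antipode k) φ.symm.toLinearMap
            (𝓡.coact y))) ∧
        (∀ y, 𝓗'.right.st.source y = 𝓡.sharp 1 y) ∧
        (∀ y, 𝓗'.right.st.target y = 𝓡.ofTensor (𝓡.coact y)) ∧
        (∀ f y, 𝓗'.right.comul (𝓡.sharp f y) =
          𝓗'.right.st.projR (TensorProduct.map (𝓡.sharp.flip 1) (𝓡.sharp.flip y) (comul f))) ∧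
        (∀ f y, 𝓗'.right.counit (𝓡.sharp f y) = counit (R := k) f • y) ∧
        (∀ f y, 𝓗'.antipode (𝓡.sharp f y) = LinearMap.mul' k 𝓡.Smash
          (TensorProduct.map 𝓡.inr.toLinearMap
            (𝓡.inl.toLinearMap ∘ₗ LinearMap.mulRight k (antipode k f) ∘ₗ
              antipode k ∘ₗ antipode k)
            (TensorProduct.comm k H R (𝓡.coact y))))) ∧
      -- the isomorphism `Ψ` and its inverse
      ((∀ x f, Ψ (𝓛.sharp x f) = 𝓡.ofTensor (𝓡.coact (φ x)) * 𝓡.inl f) ∧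
        (∀ f y, Ψ.symm (𝓡.sharp f y) = LinearMap.mul' k 𝓛.Smash
          (TensorProduct.map (𝓛.inr.toLinearMap ∘ₗ LinearMap.mulLeft k f ∘ₗ antipode k)
            (𝓛.inl.toLinearMap ∘ₗ φ.symm.toLinearMap) (𝓡.coact y))) ∧
        𝓗.IsIso 𝓗' Ψ) ∧
      -- the embeddings of `L`, `R` and `H`, compatible with `Ψ`
      (Function.Injective 𝓗.left.st.source ∧ Function.Injective 𝓗.right.st.source ∧
        Function.Injective 𝓗'.left.st.source ∧ Function.Injective 𝓗'.right.st.source ∧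
        (Nontrivial L → Function.Injective 𝓛.inr ∧ Function.Injective 𝓡.inl) ∧
        (∀ f, Ψ (𝓛.inr f) = 𝓡.inl f)) ∧
      -- the images of the source and target maps
      (Set.range 𝓗.left.st.source = Set.range 𝓗.right.st.target ∧
        Set.range 𝓗.right.st.source = Set.range 𝓗.left.st.target ∧
        Set.range 𝓗'.left.st.source = Set.range 𝓗'.right.st.target ∧
        Set.range 𝓗'.right.st.source = Set.range 𝓗'.left.st.target) ∧
      -- the antiisomorphism `φ` and its inverse
      ((∀ x, φ x = 𝓗.right.counit (𝓗.left.st.source x)) ∧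
        (∀ y, φ.symm y = 𝓗.left.counit (𝓗.right.st.target y)) ∧
        (∀ x, φ x = 𝓗'.right.counit (𝓗'.left.st.source x)) ∧
        (∀ y, φ.symm y = 𝓗'.left.counit (𝓗'.right.st.target y))) := by
  let D : CompatiblePair k H L R := ⟨𝓛, 𝓡, φ, h𝓛, h𝓡, hφ, hcompat⟩
  have inr_injective : Nontrivial L → Function.Injective 𝓛.inr := fun _ => 𝓛.injective_inr
  refine ⟨D.symmetricHopfAlgebroid AlgEquiv.refl, D.symmetricHopfAlgebroid D.smashEquiv,
    D.smashEquiv, D.smash_structure, D.smash_structure_right,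
    ⟨D.smashEquiv_sharp, D.smashEquiv_symm_sharp, D.isIso _ _ _ fun _ => rfl⟩,
    ⟨D.injective_source_left _, D.injective_source_right _, D.injective_source_left _,
      D.injective_source_right _, fun hL => ⟨inr_injective hL, ?_⟩, D.smashEquiv_inr⟩,
    ⟨D.range_source_left _, D.range_source_right _, D.range_source_left _,
      D.range_source_right _⟩,
    ⟨fun x => (D.counitR_emb _ x).symm, fun y => (D.counitL_emb _ _).symm,
      fun x => (D.counitR_emb _ x).symm, fun y => (D.counitL_emb _ _).symm⟩⟩
  -- Injectivity of H → H ♯ R is carried over from L ♯ H by Ψ.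
  intro f g h
  rw [← D.smashEquiv_inr, ← D.smashEquiv_inr] at h
  exact inr_injective hL (D.smashEquiv.injective h)
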